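/- **Setting.** Let $n\in\mathbb N$, $d=n+1$, and work over $\mathbb R$. Let $\mathcal V$ be an NP-manifold of degree $n$ given in Darboux coordinates over an open subset of the space of its degree $0$ coordinates: coordinates $x^\mu,p_\mu$ of degrees $0,n$; $\psi^{\alpha_i},\chi_{\alpha_i}$ of degrees $i,n-i$ for $1\le i\le (n-1)/2$; and, for $n$ even, $\xi^a$ of degree $n/2$, with an invertible constant matrix $\kappa_{ab}=-(-1)^{n/2}\kappa_{ba}$; the symplectic form is $dx^\mu\wedge dp_\mu+\sum_i d\psi^{\alpha_i}\wedge d\chi_{\alpha_i}+\frac12\kappa_{ab}\,d\xi^a\wedge d\xi^b$. Functions on $\mathcal V$ are smooth in the coordinates of degree $0$ and polynomial (graded commutative) in the others. The Poisson bracket, of degree $-n$, is $\{f,g\}=\sum_{a,b}(-1)^{|f|\deg b}P^{ab}\,\partial_a f\,\partial_b g$, with $P$ the (constant) inverse of the symplectic form: $P^{x^\mu p_\mu}=P^{\psi\chi}=1$, $P^{\xi^a\xi^b}=\kappa^{ab}$, and $P^{ba}=(-1)^{n+1}(-1)^{\deg a\deg b}P^{ab}$. Let $\mathcal T^{(n)}_{\rm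 poly}=C^\infty(\mathcal V)[n]$, $s:\mathcal T^{(n)}_{\rm poly}\to C^\infty(\mathcal V)$ the suspension of degree $n$, and $[\cdot,\cdot]_S=s^{-1}\circ\{\cdot,\cdot\}\circ(s\otimes s)$ (the $n$-Schouten algebra). **Graphs.** $\mathsf{Gra}_d(N)$ is the graded space of (possibly infinite) linear combinations of directed graphs with $N$ numbered vertices and $k\ge0$ ordered edges (tadpoles and multiple edges allowed), in degree $k(1-d)$, modulo: permuting the edges by $\tau$ multiplies by $\operatorname{sgn}(\tau)^{d+1}$, reversing an edge multiplies by $(-1)^d$. It is an operad: $\gamma\circ_i\gamma'$ inserts $\gamma'$ in the vertex $i$ of $\gamma$ and sums over all ways of reconnecting the edge ends attached to $i$ to the vertices of $\gamma'$ (edges of $\gamma$ come first). The full graph complex $\mathsf{fGC}_d=\prod_{N\ge1}(\mathsf{Gra}_d(N)\otimes{\rm sgn}_N^{\otimes d}[d(1-N)])^{\mathbb S_N}$, in which a graph with $N$ vertices and $k$ edges has degree $d(N-1)+k(1-d)$, has the pre-Lie product $\gamma\circ\gamma'=\sum_\sigma \operatorname{sgn}(\sigma)^d\,(\gamma\circ_1\gamma')\cdot\sigma$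 over unshuffles $\sigma$ of type $(N',N-1)$, the graded commutator bracket $[\cdot,\cdot]$, and the differential $\delta=[\Gamma,\cdot]$, where $\Gamma$ is the graph with two vertices and one edge from $1$ to $2$. A Maurer–Cartan element is $\mathfrak m\in\mathsf{fGC}_d$ of degree $1$ with $\delta\mathfrak m+\frac12[\mathfrak m,\mathfrak m]=0$. For a graph $\gamma$ with $N$ vertices let ${\sf Rep}_N(\gamma)(f_1\otimes\cdots\otimes f_N)=\mu_N\big(\prod_{(i,j)\in E_\gamma}\Delta_{ij}(f_1\otimes\cdots\otimes f_N)\big)$, where $\Delta_{ij}=\sum_{a,b}P^{ab}\partial_a^{(i)}\partial_b^{(j)}$ (with Koszul signs) and $\mu_N$ is multiplication, and let $s^*{\sf Rep}(\gamma)=s^{-1}\circ{\sf Rep}_N(\gamma)\circ s^{\otimes N}$, so that $s^*{\sf Rep}(\Gamma)=[\cdot,\cdot]_S$. It is extended linearly and arity by arity. **Universal deformations.** Let ${\rm CE}^k(\mathcal T^{(n)}_{\rm poly})=\prod_{i+j=k}{\rm Hom}^i((\mathcal T^{(n)}_{\rm poly})^{\wedge (j+1)},\mathcal T^{(n)}_{\rm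 poly})$, with the Nijenhuis–Richardson bracket and $\delta_S=[[\cdot,\cdot]_S,\cdot]_{NR}$. A cochain $c$ is a *universal deformation of $(\mathcal T^{(n)}_{\rm poly},[\cdot,\cdot]_S)$ as a $\mathsf{Lie}_\infty$-algebra* if * $c\in{\rm CE}^1$ and $\delta_S c+\frac12[c,c]_{NR}=0$; * the arity components $l_N$, $N\ge1$, of $[\cdot,\cdot]_S+c$ are the brackets, $l_N$ of degree $2-N$, of a $\mathsf{Lie}_\infty$-algebra structure on $\mathcal T^{(n)}_{\rm poly}$; * this structure factors through the graph operad: there is $\gamma\in\mathsf{fGC}_d$ of degree $1$ with $[\gamma,\gamma]=0$, with finitely many numbers of edges in each arity, and with $[\cdot,\cdot]_S+c=s^*{\sf Rep}(\gamma)$. A family $(c_r)_{r\ge0}$ is a *formal* universal deformation if $\sum_r\epsilon^rc_r$ has the same properties $\mathbb R[[\epsilon]]$-linearly, $\epsilon$ a formal parameter of degree $0$ (with $\gamma=\sum_r\epsilon^r\gamma_r$, each $\gamma_r$ having finitely many numbers of edges in each arity). **Statement.** 1. If $n\ge1$, then for every Maurer–Cartan element $\mathfrak m$ of $(\mathsf{fGC}_d,\delta,[\cdot,\cdot])$,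 the cochain $s^*{\sf Rep}(\mathfrak m)$ is a universal deformation of the graded Lie algebra $(\mathcal T^{(n)}_{\rm poly},[\cdot,\cdot]_S)$ as a $\mathsf{Lie}_\infty$-algebra. 2. If $n=0$ (where $\mathfrak m$ may be an infinite series in the number of edges), then for every Maurer–Cartan element $\mathfrak m=\sum_{k}\mathfrak m_k$ of $\mathsf{fGC}_1$, $\mathfrak m_k$ being the part with $k$ edges, the family $c_r=s^*{\sf Rep}(\mathfrak m_{r+1})$ is a formal universal deformation. 3. For every $n$ and every formal Maurer–Cartan element $\sum_r\epsilon^r\mathfrak m_r$ of $\mathsf{fGC}_d[[\epsilon]]$, where each $\mathfrak m_r$ has finitely many numbers of edges in each arity (automatic for $n\ge1$), the family $c_r=s^*{\sf Rep}(\mathfrak m_r)$ is a formal universal deformation. -/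

import Mathlib

open scoped TensorProduct ContDiff

noncomputable section

namespace NPGraph

/-! ### The graph operad and the full graph complex -/

/-- Multidigraphs with `N` labelled vertices and `k` labelled directed edges (tadpoles and multiple
edges allowed): the edge `e` goes from `(G e).1` to `(G e).2`. -/
abbrev Multidigraph (N k : ℕ) : Type := Fin k → Fin N × Fin N

/-- Reverse the direction of the edge `e`. -/
def flipEdge {N k : ℕ} (e : Fin k) (G : Multidigraph N k) : Multidigraph N k :=
  Function.update G e (G e).swap

/-- The right action of `S_N`: the vertex label `v` becomes `σ⁻¹ v`. -/
def relabel {N k : ℕ} (σ : Equiv.Perm (Fin N)) (G : Multidigraph N k) : Multidigraph N k :=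
  fun e => (σ⁻¹ (G e).1, σ⁻¹ (G e).2)

/-- The relations defining the coinvariants: reordering the edges by `τ` costs
`sgn(τ)^(d+1)`, flipping an edge costs `(-1)^d`. -/
def graRel (d : ℤ) (N k : ℕ) : Submodule ℝ (Multidigraph N k →₀ ℝ) :=
  Submodule.span ℝ
    ({w | ∃ (G : Multidigraph N k) (τ : Equiv.Perm (Fin k)),
        w = Finsupp.single (G ∘ τ) 1 - (Equiv.Perm.sign τ) ^ (d + 1) • Finsupp.single G 1} ∪
     {w | ∃ (G : Multidigraph N k) (e : Fin k),
        w = Finsupp.single (flipEdge e G) 1 - (-1 : ℤˣ) ^ d • Finsupp.single G 1})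

/-- The part of `Gra_d(N)` with `k` edges; it sits in degree `k (1 - d)`, and `Gra_d(N)` is the
product of these spaces over all `k`. -/
abbrev Gra (d : ℤ) (N k : ℕ) : Type := (Multidigraph N k →₀ ℝ) ⧸ graRel d N k

/-- The class of a graph. -/
def Gra.mk (d : ℤ) {N k : ℕ} (G : Multidigraph N k) : Gra d N k :=
  (graRel d N k).mkQ (Finsupp.single G 1)

/-- To define a linear map on `Gra d N k` it suffices to give its values on graphs, compatibly with
the two kinds of relations. -/
def Gra.lift (d : ℤ) {N k : ℕ} {M : Type*} [AddCommGroup M] [Module ℝ M]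
    (F : Multidigraph N k → M)
    (hperm : ∀ (G : Multidigraph N k) (τ : Equiv.Perm (Fin k)),
      F (G ∘ τ) = (Equiv.Perm.sign τ) ^ (d + 1) • F G)
    (hflip : ∀ (G : Multidigraph N k) (e : Fin k), F (flipEdge e G) = (-1 : ℤˣ) ^ d • F G) :
    Gra d N k →ₗ[ℝ] M :=
  (graRel d N k).liftQ (Finsupp.linearCombination ℝ F) (by
    rw [graRel, Submodule.span_le]
    rintro w (⟨G, τ, rfl⟩ | ⟨G, e, rfl⟩)
    · simp [hperm, Units.smul_def, Int.cast_smul_eq_zsmul]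
    · simp [hflip, Units.smul_def, Int.cast_smul_eq_zsmul])

theorem Gra.mk_perm (d : ℤ) {N k : ℕ} (G : Multidigraph N k) (τ : Equiv.Perm (Fin k)) :
    Gra.mk d (G ∘ τ) = (Equiv.Perm.sign τ) ^ (d + 1) • Gra.mk d G := by
  rw [← sub_eq_zero]
  have h : (Finsupp.single (G ∘ τ) (1 : ℝ) -
      (Equiv.Perm.sign τ) ^ (d + 1) • Finsupp.single G (1 : ℝ)) ∈ graRel d N k :=
    Submodule.subset_span (Or.inl ⟨G, τ, rfl⟩)
  have h' := (Submodule.Quotient.mk_eq_zero _).2 h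
  rwa [← Submodule.mkQ_apply, map_sub, Units.smul_def, map_zsmul] at h'

theorem Gra.mk_flip (d : ℤ) {N k : ℕ} (G : Multidigraph N k) (e : Fin k) :
    Gra.mk d (flipEdge e G) = (-1 : ℤˣ) ^ d • Gra.mk d G := by
  rw [← sub_eq_zero]
  have h : (Finsupp.single (flipEdge e G) (1 : ℝ) -
      (-1 : ℤˣ) ^ d • Finsupp.single G (1 : ℝ)) ∈ graRel d N k :=
    Submodule.subset_span (Or.inr ⟨G, e, rfl⟩)
  have hq := (Submodule.Quotient.mk_eq_zero _).2 h
  rwa [← Submodule.mkQ_apply, map_sub, Units.smul_def, map_zsmul] at hq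

/-- The right action `Σ_N( · | σ)` of the symmetric group on `Gra_d(N)`. -/
def Gra.act (d : ℤ) {N k : ℕ} (σ : Equiv.Perm (Fin N)) : Gra d N k →ₗ[ℝ] Gra d N k :=
  Gra.lift d (fun G => Gra.mk d (relabel σ G))
    (fun G τ => Gra.mk_perm d (relabel σ G) τ)
    (fun G e => by
      rw [← Gra.mk_flip d (relabel σ G) e]
      congr 1
      funext e'
      by_cases h : e' = e
      · subst h; simp [relabel, flipEdge]
      · simp [relabel, flipEdge, h])

/-- The vertices of `γ ∘₁ γ'`, where `γ` has `p + 1` and `γ'` has `q + 1` vertices, are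
`0, …, p + q`. The first `q + 1` of them come from `γ'` and are collapsed to the first vertex of
`γ`; the vertex `q + i` comes from the vertex `i` of `γ`. -/
def collapse {p q P : ℕ} (h : p + q = P) (v : Fin (P + 1)) : Fin (p + 1) :=
  ⟨v.1 - q, by omega⟩

/-- Position in `γ ∘₁ γ'` of the vertices of `γ'`. -/
def embed {p q P : ℕ} (h : p + q = P) (v : Fin (q + 1)) : Fin (P + 1) :=
  ⟨v.1, by omega⟩

/-- The edges `E` (coming from `γ`) followed by the edges of `γ'`. -/
def glue {p q P j k K : ℕ} (h : p + q = P) (hK : j + k = K)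
    (E : Multidigraph (P + 1) j) (H : Multidigraph (q + 1) k) : Multidigraph (P + 1) K :=
  fun e => Fin.append E (fun e' => (embed h (H e').1, embed h (H e').2)) (Fin.cast hK.symm e)

/-- `E` is obtained from the graph `G` by reconnecting every edge end attached to the first vertex
to one of the first `q + 1` vertices. -/
def IsReconnection {p q P j : ℕ} (h : p + q = P) (G : Multidigraph (p + 1) j)
    (E : Multidigraph (P + 1) j) : Prop :=
  ∀ e, (collapse h (E e).1, collapse h (E e).2) = G e

open Classical in
/-- The partial composition `G ∘₁ H` of two graphs: insert `H` in place of the first vertex of `G`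
and sum over all the ways of reconnecting to the vertices of `H` the edge ends (of `G`) that were
attached to this vertex. -/
def compGraph (d : ℤ) {p q P j k K : ℕ} (h : p + q = P) (hK : j + k = K)
    (G : Multidigraph (p + 1) j) (H : Multidigraph (q + 1) k) : Gra d (P + 1) K :=
  ∑ E : Multidigraph (P + 1) j,
    if IsReconnection h G E then Gra.mk d (glue h hK E H) else 0

theorem glue_perm_right {p q P j k K : ℕ} (h : p + q = P) (hK : j + k = K)
    (E : Multidigraph (P + 1) j) (H : Multidigraph (q + 1) k) (τ : Equiv.Perm (Fin k)) :
    ∃ τ' : Equiv.Perm (Fin K), Equiv.Perm.sign τ' = Equiv.Perm.sign τ ∧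
      glue h hK E (H ∘ τ) = glue h hK E H ∘ τ' := by
  subst hK
  refine ⟨finSumFinEquiv.permCongr (Equiv.Perm.sumCongr 1 τ), by simp, ?_⟩
  funext e
  obtain ⟨e, rfl⟩ := finSumFinEquiv.surjective e
  rcases e with e | e <;> simp [glue, Equiv.permCongr_apply]

theorem glue_perm_left {p q P j k K : ℕ} (h : p + q = P) (hK : j + k = K)
    (E : Multidigraph (P + 1) j) (H : Multidigraph (q + 1) k) (τ : Equiv.Perm (Fin j)) :
    ∃ τ' : Equiv.Perm (Fin K), Equiv.Perm.sign τ' = Equiv.Perm.sign τ ∧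
      glue h hK (E ∘ τ) H = glue h hK E H ∘ τ' := by
  subst hK
  refine ⟨finSumFinEquiv.permCongr (Equiv.Perm.sumCongr τ 1), by simp, ?_⟩
  funext e
  obtain ⟨e, rfl⟩ := finSumFinEquiv.surjective e
  rcases e with e | e <;> simp [glue, Equiv.permCongr_apply]

theorem glue_flip_right {p q P j k K : ℕ} (h : p + q = P) (hK : j + k = K)
    (E : Multidigraph (P + 1) j) (H : Multidigraph (q + 1) k) (e : Fin k) :
    ∃ e' : Fin K, glue h hK E (flipEdge e H) = flipEdge e' (glue h hK E H) := by
  subst hK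
  refine ⟨Fin.natAdd j e, ?_⟩
  funext e'
  refine Fin.addCases (fun i => ?_) (fun i => ?_) e'
  · have hne : Fin.castAdd k i ≠ Fin.natAdd j e := by
      intro hh; have := congrArg Fin.val hh; simp at this; omega
    simp [glue, flipEdge, hne]
  · by_cases hi : i = e
    · subst hi; simp [glue, flipEdge]
    · have hne : Fin.natAdd j i ≠ Fin.natAdd j e := by
        intro hh; exact hi (by simpa using hh)
      simp [glue, flipEdge, hi]

theorem glue_flip_left {p q P j k K : ℕ} (h : p + q = P) (hK : j + k = K)
    (E : Multidigraph (P + 1) j) (H : Multidigraph (q + 1) k) (e : Fin j) :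
    ∃ e' : Fin K, glue h hK (flipEdge e E) H = flipEdge e' (glue h hK E H) := by
  subst hK
  refine ⟨Fin.castAdd k e, ?_⟩
  funext e'
  refine Fin.addCases (fun i => ?_) (fun i => ?_) e'
  · by_cases hi : i = e
    · subst hi; simp [glue, flipEdge]
    · have hne : Fin.castAdd k i ≠ Fin.castAdd k e := by
        intro hh; exact hi (by simpa using hh)
      simp [glue, flipEdge, hi]
  · have hne : Fin.natAdd j i ≠ Fin.castAdd k e := by
      intro hh; have := congrArg Fin.val hh; simp at this; omega
    simp [glue, flipEdge, hne]

theorem flipEdge_flipEdge {N k : ℕ} (e : Fin k) (G : Multidigraph N k) :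
    flipEdge e (flipEdge e G) = G := by
  simp [flipEdge]

theorem isReconnection_flip {p q P j : ℕ} (h : p + q = P) (G : Multidigraph (p + 1) j)
    (E : Multidigraph (P + 1) j) (e : Fin j) (hE : IsReconnection h G E) :
    IsReconnection h (flipEdge e G) (flipEdge e E) := by
  intro ej
  by_cases hi : ej = e
  · subst hi; simp [flipEdge, ← hE ej]
  · simpa [flipEdge, hi] using hE ej

/-- The partial composition `∘₁` of the operad `Gra_d`. -/
def Gra.comp (d : ℤ) {p q P j k K : ℕ} (h : p + q = P) (hK : j + k = K) :
    Gra d (p + 1) j →ₗ[ℝ] Gra d (q + 1) k →ₗ[ℝ] Gra d (P + 1) K :=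
  Gra.lift d
    (fun G => Gra.lift d (fun H => compGraph d h hK G H)
      (fun H τ => by
        classical
        rw [compGraph, compGraph, Finset.smul_sum]
        refine Finset.sum_congr rfl fun E _ => ?_
        obtain ⟨τ', hs, he⟩ := glue_perm_right h hK E H τ
        rw [he, Gra.mk_perm, hs, smul_ite, smul_zero])
      (fun H e => by
        classical
        rw [compGraph, compGraph, Finset.smul_sum]
        refine Finset.sum_congr rfl fun E _ => ?_
        obtain ⟨e', he⟩ := glue_flip_right h hK E H e
        rw [he, Gra.mk_flip, smul_ite, smul_zero]))
    (fun G τ => by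
      classical
      refine Submodule.linearMap_qext _ (Finsupp.lhom_ext' fun H => LinearMap.ext_ring ?_)
      simp only [Gra.lift, LinearMap.comp_apply, Finsupp.lsingle_apply, Units.smul_def,
        LinearMap.smul_apply, Submodule.mkQ_apply, Submodule.liftQ_apply,
        Finsupp.linearCombination_single, one_smul]
      rw [← Units.smul_def, compGraph, compGraph, Finset.smul_sum]
      symm
      refine Fintype.sum_equiv (Equiv.arrowCongr τ.symm (Equiv.refl _)) _ _ fun E => ?_
      have hE : (Equiv.arrowCongr τ.symm (Equiv.refl _)) E = E ∘ τ := by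
        funext e; simp
      rw [hE]
      obtain ⟨τ', hs, he⟩ := glue_perm_left h hK E H τ
      have hiff : IsReconnection h (G ∘ τ) (E ∘ τ) ↔ IsReconnection h G E :=
        ⟨fun hh e => by simpa using hh (τ.symm e), fun hh e => hh (τ e)⟩
      rw [he, Gra.mk_perm, hs, smul_ite, smul_zero]
      simp only [hiff])
    (fun G e => by
      classical
      refine Submodule.linearMap_qext _ (Finsupp.lhom_ext' fun H => LinearMap.ext_ring ?_)
      simp only [Gra.lift, LinearMap.comp_apply, Finsupp.lsingle_apply, Units.smul_def,
        LinearMap.smul_apply, Submodule.mkQ_apply, Submodule.liftQ_apply,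
        Finsupp.linearCombination_single, one_smul]
      rw [← Units.smul_def, compGraph, compGraph, Finset.smul_sum]
      symm
      refine Fintype.sum_equiv
        (Function.Involutive.toPerm (flipEdge e) (flipEdge_flipEdge e)) _ _ fun E => ?_
      change _ = if IsReconnection h (flipEdge e G) (flipEdge e E) then
        Gra.mk d (glue h hK (flipEdge e E) H) else 0
      obtain ⟨e', he⟩ := glue_flip_left h hK E H e
      have hiff : IsReconnection h (flipEdge e G) (flipEdge e E) ↔ IsReconnection h G E :=
        ⟨fun hh => by
          simpa [flipEdge_flipEdge] using isReconnection_flip h _ _ e hh,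
          fun hh => isReconnection_flip h _ _ e hh⟩
      rw [he, Gra.mk_flip, smul_ite, smul_zero]
      simp only [hiff])

/-- `σ` is an unshuffle of type `(a, N - a)`: the inverse permutation is increasing on the first `a`
and on the last `N - a` elements. -/
def IsUnshuffle (a : ℕ) {N : ℕ} (σ : Equiv.Perm (Fin N)) : Prop :=
  ∀ i j : Fin N, i < j → (j.1 < a ∨ a ≤ i.1) → σ⁻¹ i < σ⁻¹ j

/-- Families of elements of `Gra_d(p + 1)`, `p ≥ 0`, i.e. elements of the product over all numbers
of vertices `N = p + 1 ≥ 1` and of edges `k ≥ 0`. -/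
abbrev GraphSeries (d : ℤ) : Type := (p k : ℕ) → Gra d (p + 1) k

/-- Degree in the full graph complex of a graph with `N = p + 1` vertices and `k` edges,
`d (N - 1) + k (1 - d)`. -/
def graphDegree (d : ℤ) (p k : ℕ) : ℤ := d * p + k * (1 - d)

/-- The full graph complex `fGC_d`: the invariants for the action of the symmetric groups on the
vertices, twisted by the signature when `d` is odd. -/
def fGC (d : ℤ) : Submodule ℝ (GraphSeries d) where
  carrier := {m | ∀ (p k : ℕ) (σ : Equiv.Perm (Fin (p + 1))),
    (Equiv.Perm.sign σ) ^ d • Gra.act d σ (m p k) = m p k}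
  add_mem' := by
    intro a b ha hb p k σ
    simp only [Pi.add_apply, map_add, smul_add, ha p k σ, hb p k σ]
  zero_mem' := by
    intro p k σ
    simp
  smul_mem' := by
    intro c a ha p k σ
    simp only [Pi.smul_apply, map_smul]
    rw [smul_comm, ha p k σ]

/-- `m` is homogeneous of degree `i`. -/
def HasDegree {d : ℤ} (i : ℤ) (m : GraphSeries d) : Prop :=
  ∀ p k, graphDegree d p k ≠ i → m p k = 0

open Classical in
/-- The pre-Lie product of `fGC_d` on homogeneous components (`p + 1` and `q + 1` vertices, `j` and
`k` edges). -/
def preLie (d : ℤ) {p q P j k K : ℕ} (h : p + q = P) (hK : j + k = K)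
    (γ : Gra d (p + 1) j) (γ' : Gra d (q + 1) k) : Gra d (P + 1) K :=
  ∑ σ : Equiv.Perm (Fin (P + 1)),
    if IsUnshuffle (q + 1) σ then
      (Equiv.Perm.sign σ) ^ d • Gra.act d σ (Gra.comp d h hK γ γ') else 0

/-- The graded Lie bracket of `fGC_d`: the graded commutator of the pre-Lie product. -/
def bracket {d : ℤ} (m m' : GraphSeries d) : GraphSeries d := fun P K =>
  ∑ x : Finset.HasAntidiagonal.antidiagonal P, ∑ y : Finset.HasAntidiagonal.antidiagonal K,
    (preLie d (Finset.HasAntidiagonal.mem_antidiagonal.1 x.2)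
        (Finset.HasAntidiagonal.mem_antidiagonal.1 y.2)
        (m x.1.1 y.1.1) (m' x.1.2 y.1.2)
      - (-1 : ℤˣ) ^ (graphDegree d x.1.1 y.1.1 * graphDegree d x.1.2 y.1.2) •
        preLie d ((add_comm _ _).trans (Finset.HasAntidiagonal.mem_antidiagonal.1 x.2))
          ((add_comm _ _).trans (Finset.HasAntidiagonal.mem_antidiagonal.1 y.2))
          (m' x.1.2 y.1.2) (m x.1.1 y.1.1))

/-- The graph with two vertices `1`, `2` and one edge, from `1` to `2`, as an element of `fGC_d`. -/
def edgeGraph (d : ℤ) : GraphSeries d := fun p k =>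
  if p = 1 ∧ k = 1 then Gra.mk d (fun _ => (0, Fin.last p)) else 0

/-- The differential of `fGC_d`. -/
def differential {d : ℤ} (m : GraphSeries d) : GraphSeries d := bracket (edgeGraph d) m

/-- Maurer–Cartan elements of the dg Lie algebra `fGC_d`: elements `m` of degree `1` with
`δ m + ½ [m, m] = 0`. -/
structure IsMaurerCartan {d : ℤ} (m : GraphSeries d) : Prop where
  mem : m ∈ fGC d
  degree : HasDegree 1 m
  eqn : differential m + (1 / 2 : ℝ) • bracket m m = 0

/-- Every arity component involves finitely many numbers of edges only. -/
def HasFiniteEdges {d : ℤ} (m : GraphSeries d) : Prop :=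
  ∀ p, {k | m p k ≠ 0}.Finite

/-- Maurer–Cartan elements `∑ r, ε ^ r m_r` of the dg Lie algebra `fGC_d[[ε]]`. -/
structure IsFormalMaurerCartan {d : ℤ} (m : ℕ → GraphSeries d) : Prop where
  mem : ∀ r, m r ∈ fGC d
  degree : ∀ r, HasDegree 1 (m r)
  eqn : ∀ r, differential (m r) +
    (1 / 2 : ℝ) • ∑ ij ∈ Finset.HasAntidiagonal.antidiagonal r, bracket (m ij.1) (m ij.2) = 0

/-- The part of `m` with exactly `k` edges. -/
def edgePart {d : ℤ} (k : ℕ) (m : GraphSeries d) : GraphSeries d := fun p k' =>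
  if k' = k then m p k' else 0

/-! ### Functions on an NP-manifold in Darboux coordinates -/

/-- Homogeneous Darboux coordinates of degree `n`: `x^μ` (degree `0`), `p_μ` (degree `n`),
`ψ^α_i` (degree `i`), `χ_{α,i}` (degree `n - i`), `ξ^a` (degree `n / 2`). The integer `i` with
`1 ≤ i ≤ (n - 1) / 2` is represented by the element `i - 1` of `Fin ((n - 1) / 2)`. -/
inductive Coord (n m s : ℕ) (r : Fin ((n - 1) / 2) → ℕ) : Type
  | x (μ : Fin m)
  | p (μ : Fin m)
  | psi (i : Fin ((n - 1) / 2)) (α : Fin (r i))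
  | chi (i : Fin ((n - 1) / 2)) (α : Fin (r i))
  | xi (a : Fin s)
  deriving DecidableEq, Fintype

/-- Degree of a coordinate. -/
def Coord.deg {n m s : ℕ} {r : Fin ((n - 1) / 2) → ℕ} : Coord n m s r → ℕ
  | .x _ => 0
  | .p _ => n
  | .psi i _ => i.1 + 1
  | .chi i _ => n - (i.1 + 1)
  | .xi _ => n / 2

/-- An NP-manifold of degree `n` presented by global Darboux coordinates: the numbers of coordinates
of each kind (coordinates `ξ^a` exist for even `n` only), the constant matrix `κ_{ab}`, which is
invertible with `κ_{ab} = -(-1)^(n/2) κ_{ba}`, and the open subset of the space of the degree `0`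
coordinates that is the base. -/
structure NPDomain (n : ℕ) where
  m : ℕ
  r : Fin ((n - 1) / 2) → ℕ
  s : ℕ
  s_eq_zero : Odd n → s = 0
  κ : Matrix (Fin s) (Fin s) ℝ
  κ_det : IsUnit κ.det
  κ_symm : ∀ a b, κ a b = -(-1) ^ (n / 2) * κ b a
  base : TopologicalSpace.Opens ({c : Coord n m s r // c.deg = 0} → ℝ)

/-- Smooth real functions on an open subset `U` of `ℝ^ι`. -/
def SmoothFun {ι : Type} [Fintype ι] (U : TopologicalSpace.Opens (ι → ℝ)) :
    Subalgebra ℝ (U → ℝ) where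
  carrier := {f | ∃ g : (ι → ℝ) → ℝ, ContDiffOn ℝ ∞ g U ∧ ∀ u : U, f u = g u}
  mul_mem' := by
    rintro a b ⟨g, hg, ha⟩ ⟨g', hg', hb⟩
    exact ⟨fun x => g x * g' x, hg.mul hg', fun u => by simp [ha, hb]⟩
  add_mem' := by
    rintro a b ⟨g, hg, ha⟩ ⟨g', hg', hb⟩
    exact ⟨fun x => g x + g' x, hg.add hg', fun u => by simp [ha, hb]⟩
  algebraMap_mem' := fun c => ⟨fun _ => c, contDiffOn_const, fun u => rfl⟩

/-- Extension by zero of a function on `U`. -/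
def extendFun {ι : Type} {U : TopologicalSpace.Opens (ι → ℝ)} (f : U → ℝ) : (ι → ℝ) → ℝ :=
  Function.extend Subtype.val f 0

theorem extendFun_apply {ι : Type} {U : TopologicalSpace.Opens (ι → ℝ)} (f : U → ℝ) (u : U) :
    extendFun f u = f u :=
  Subtype.val_injective.extend_apply f 0 u

theorem contDiffOn_extendFun {ι : Type} [Fintype ι] {U : TopologicalSpace.Opens (ι → ℝ)}
    (f : SmoothFun U) : ContDiffOn ℝ ∞ (extendFun f.1) U := by
  obtain ⟨f, g, hg, h⟩ := f
  exact hg.congr fun x hx => by rw [← h ⟨x, hx⟩]; exact extendFun_apply f ⟨x, hx⟩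

theorem differentiableAt_extendFun {ι : Type} [Fintype ι] {U : TopologicalSpace.Opens (ι → ℝ)}
    (f : SmoothFun U) (u : U) : DifferentiableAt ℝ (extendFun f.1) u :=
  ((contDiffOn_extendFun f).differentiableOn (by simp)).differentiableAt (U.2.mem_nhds u.2)

/-- Partial derivative of a smooth function on `U` in the direction of the coordinate `i`. -/
def partialDeriv {ι : Type} [Fintype ι] [DecidableEq ι] {U : TopologicalSpace.Opens (ι → ℝ)}
    (i : ι) : Module.End ℝ (SmoothFun U) where
  toFun f := ⟨fun u => fderiv ℝ (extendFun f.1) u (Pi.single i 1),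
    fun y => fderiv ℝ (extendFun f.1) y (Pi.single i 1),
    ((contDiffOn_extendFun f).fderiv_of_isOpen U.2 (by simp)).clm_apply contDiffOn_const,
    fun _ => rfl⟩
  map_add' f g := by
    ext u
    have h : extendFun (f + g).1 = extendFun f.1 + extendFun g.1 := by
      funext y
      by_cases hy : ∃ u : U, u.1 = y
      · obtain ⟨u, rfl⟩ := hy
        simp [extendFun_apply]
      · simp [extendFun, Function.extend_apply' _ _ _ hy]
    change fderiv ℝ (extendFun (f + g).1) u (Pi.single i 1) = _
    rw [h, fderiv_add (differentiableAt_extendFun f u) (differentiableAt_extendFun g u)]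
    rfl
  map_smul' c f := by
    ext u
    have h : extendFun (c • f).1 = c • extendFun f.1 := by
      funext y
      by_cases hy : ∃ u : U, u.1 = y
      · obtain ⟨u, rfl⟩ := hy
        simp [extendFun_apply]
      · simp [extendFun, Function.extend_apply' _ _ _ hy]
    change fderiv ℝ (extendFun (c • f).1) u (Pi.single i 1) = _
    rw [h, fderiv_const_smul (differentiableAt_extendFun f u)]
    rfl

theorem partialDeriv_comm {ι : Type} [Fintype ι] [DecidableEq ι]
    {U : TopologicalSpace.Opens (ι → ℝ)} (i j : ι) :
    partialDeriv (U := U) i * partialDeriv j = partialDeriv j * partialDeriv i := by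
  have key : ∀ (f : SmoothFun U) (u : U) (i j : ι),
      (partialDeriv i (partialDeriv j f)).1 u =
        fderiv ℝ (fderiv ℝ (extendFun f.1)) u (Pi.single i 1) (Pi.single j 1) := by
    intro f u i j
    have hd : DifferentiableAt ℝ (fderiv ℝ (extendFun f.1)) u :=
      (((contDiffOn_extendFun f).fderiv_of_isOpen (m := 1) U.2
        (WithTop.coe_le_coe.2 le_top)).differentiableOn one_ne_zero).differentiableAt (U.2.mem_nhds u.2)
    have he : extendFun (partialDeriv j f).1 =ᶠ[nhds u.1]
        fun y => fderiv ℝ (extendFun f.1) y (Pi.single j 1) := by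
      filter_upwards [U.2.mem_nhds u.2] with y hy
      exact extendFun_apply (partialDeriv j f).1 ⟨y, hy⟩
    change fderiv ℝ (extendFun (partialDeriv j f).1) u (Pi.single i 1) = _
    rw [he.fderiv_eq, fderiv_clm_apply hd (differentiableAt_const _)]
    simp
  refine LinearMap.ext fun f => Subtype.ext (funext fun u => ?_)
  refine (key f u i j).trans (Eq.trans ?_ (key f u j i).symm)
  have hs : IsSymmSndFDerivAt ℝ (extendFun f.1) u.1 :=
    ((contDiffOn_extendFun f).contDiffAt (U.2.mem_nhds u.2)).isSymmSndFDerivAt (by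
      rw [minSmoothness_of_isRCLikeNormedField]; exact WithTop.coe_le_coe.2 le_top)
  exact hs _ _

theorem pderiv_comm' {σ : Type} (i j : σ) (f : MvPolynomial σ ℝ) :
    MvPolynomial.pderiv i (MvPolynomial.pderiv j f) =
      MvPolynomial.pderiv j (MvPolynomial.pderiv i f) := by
  have h : ⁅MvPolynomial.pderiv (R := ℝ) i, MvPolynomial.pderiv (R := ℝ) j⁆ = 0 := by
    classical
    refine MvPolynomial.derivation_ext fun k => ?_
    rw [Derivation.commutator_apply]
    simp only [MvPolynomial.pderiv_X, Derivation.coe_zero, Pi.zero_apply]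
    by_cases hi : i = k <;> by_cases hj : j = k <;> simp [hi, hj]
  have h' := congrArg (fun D : Derivation ℝ (MvPolynomial σ ℝ) (MvPolynomial σ ℝ) => D f) h
  simpa [Derivation.commutator_apply, sub_eq_zero] using h'

theorem involute_contractLeft' {M : Type} [AddCommGroup M] [Module ℝ M]
    (φ : Module.Dual ℝ M) (x : ExteriorAlgebra ℝ M) :
    CliffordAlgebra.involute (Q := (0 : QuadraticForm ℝ M)) (CliffordAlgebra.contractLeft φ x) =
      -CliffordAlgebra.contractLeft φ (CliffordAlgebra.involute (Q := (0 : QuadraticForm ℝ M)) x) := by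
  induction x using CliffordAlgebra.left_induction with
  | algebraMap r => simp
  | add x y hx hy => simp only [map_add, hx, hy, neg_add]
  | ι_mul x m hx =>
    rw [CliffordAlgebra.contractLeft_ι_mul, map_sub, map_smul, map_mul, map_mul,
      CliffordAlgebra.involute_ι, hx, neg_mul, neg_mul, map_neg, CliffordAlgebra.contractLeft_ι_mul]
    simp

theorem map_slot_mul {V : Type} [AddCommGroup V] [Module ℝ V] {N : ℕ}
    (π π' δ δ' : Module.End ℝ V) (c : ℝ) (i j : Fin N) (h1 : π * π' = π' * π)
    (h2 : δ * π' = c • (π' * δ)) (h3 : π * δ' = c • (δ' * π)) (h4 : δ * δ' = c • (δ' * δ)) :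
    (PiTensorProduct.map (fun s => if s < i then π else if s = i then δ else 1) *
      PiTensorProduct.map (fun s => if s < j then π' else if s = j then δ' else 1) :
        Module.End ℝ (⨂[ℝ] _ : Fin N, V)) =
      c • (PiTensorProduct.map (fun s => if s < j then π' else if s = j then δ' else 1) *
        PiTensorProduct.map (fun s => if s < i then π else if s = i then δ else 1)) := by
  have key : ∀ (L L' : Fin N → Module.End ℝ V) (t : Fin N),
      (∀ s, s ≠ t → L s = L' s) → L t = c • L' t →
      (PiTensorProduct.map L : Module.End ℝ (⨂[ℝ] _ : Fin N, V)) =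
        c • PiTensorProduct.map L' := by
    intro L L' t h1 h2
    have hL : L = Function.update L' t (c • L' t) := by
      funext s
      by_cases hs : s = t
      · subst hs; simp [h2]
      · simp [hs, h1 s hs]
    rw [hL, PiTensorProduct.map_update_smul, Function.update_eq_self]
  rw [← PiTensorProduct.map_mul, ← PiTensorProduct.map_mul]
  rcases lt_trichotomy i j with hij | rfl | hij
  · refine key _ _ i (fun s hs => ?_) ?_
    · by_cases h1' : s < i
      · simp [h1', h1'.trans hij, h1]
      · simp only [if_neg h1', if_neg hs, one_mul, mul_one]
    · simp [hij, h2]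
  · refine key _ _ i (fun s hs => ?_) ?_
    · by_cases h1' : s < i
      · simp [h1', h1]
      · simp [h1', hs]
    · simpa using h4
  · refine key _ _ j (fun s hs => ?_) ?_
    · by_cases h1' : s < j
      · simp [h1', h1'.trans hij, h1]
      · simp only [if_neg h1', if_neg hs, one_mul, mul_one]
    · simp [hij, h3]

theorem sum_pairing_mul {A C : Type} [Ring A] [Algebra ℝ A] [Fintype C] (P : C → C → ℝ)
    (deg : C → ℕ) (n : ℕ) (hP : ∀ a b, P a b ≠ 0 → deg a + deg b = n) (S T S' T' : C → A)
    (h1 : ∀ a b, S a * S' b = (-1 : ℝ) ^ (deg a * deg b) • (S' b * S a))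
    (h2 : ∀ a b, S a * T' b = (-1 : ℝ) ^ (deg a * deg b) • (T' b * S a))
    (h3 : ∀ a b, T a * S' b = (-1 : ℝ) ^ (deg a * deg b) • (S' b * T a))
    (h4 : ∀ a b, T a * T' b = (-1 : ℝ) ^ (deg a * deg b) • (T' b * T a)) :
    (∑ a, ∑ b, P a b • (S a * T b)) * (∑ a, ∑ b, P a b • (S' a * T' b)) =
      (-1 : ℝ) ^ n • ((∑ a, ∑ b, P a b • (S' a * T' b)) * (∑ a, ∑ b, P a b • (S a * T b))) := by
  have hcomm : ∀ a b a' b', (P a b • (S a * T b)) * (P a' b' • (S' a' * T' b')) =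
      (-1 : ℝ) ^ n • ((P a' b' • (S' a' * T' b')) * (P a b • (S a * T b))) := by
    intro a b a' b'
    by_cases hab : P a b = 0
    · simp [hab]
    by_cases hab' : P a' b' = 0
    · simp [hab']
    have e1 := hP a b hab
    have e2 := hP a' b' hab'
    have : S a * T b * (S' a' * T' b') = (-1 : ℝ) ^ n • (S' a' * T' b' * (S a * T b)) := by
      calc S a * T b * (S' a' * T' b') = S a * (T b * S' a') * T' b' := by simp only [mul_assoc]
        _ = (-1 : ℝ) ^ (deg b * deg a') • ((S a * S' a') * (T b * T' b')) := by
            rw [h3]; simp only [mul_smul_comm, smul_mul_assoc, mul_assoc]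
        _ = ((-1 : ℝ) ^ (deg b * deg a') * ((-1) ^ (deg a * deg a') * (-1) ^ (deg b * deg b'))) •
              (S' a' * (S a * T' b') * T b) := by
            rw [h1, h4, mul_comm ((-1 : ℝ) ^ (deg a * deg a'))]
            simp only [mul_smul_comm, smul_mul_assoc, mul_assoc, smul_smul]
        _ = ((-1 : ℝ) ^ (deg b * deg a') * ((-1) ^ (deg a * deg a') * (-1) ^ (deg b * deg b')) *
              (-1) ^ (deg a * deg b')) • (S' a' * T' b' * (S a * T b)) := by
            rw [h2]; simp only [mul_smul_comm, smul_mul_assoc, mul_assoc, smul_smul]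
        _ = _ := by
            congr 1
            rw [← pow_add, ← pow_add, ← pow_add]
            have : deg b * deg a' + (deg a * deg a' + deg b * deg b') + deg a * deg b' = n * n := by
              nth_rewrite 1 [← e1]; rw [← e2]; ring
            rw [this, pow_mul]
            rcases Nat.even_or_odd n with hn | hn <;> simp [hn.neg_one_pow]
    rw [smul_mul_smul_comm, smul_mul_smul_comm, this, smul_comm, mul_comm (P a b)]
  have hl : ∀ X : A, ∀ Y : A, (∀ a' b', X * (P a' b' • (S' a' * T' b')) =
      (-1 : ℝ) ^ n • ((P a' b' • (S' a' * T' b')) * X)) →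
      X * (∑ a, ∑ b, P a b • (S' a * T' b)) =
        (-1 : ℝ) ^ n • ((∑ a, ∑ b, P a b • (S' a * T' b)) * X) := by
    intro X _ hX
    simp only [Finset.mul_sum, Finset.sum_mul, Finset.smul_sum, hX]
  rw [Finset.sum_mul, Finset.mul_sum, Finset.smul_sum]
  refine Finset.sum_congr rfl fun a _ => ?_
  rw [Finset.sum_mul, Finset.mul_sum, Finset.smul_sum]
  refine Finset.sum_congr rfl fun b _ => ?_
  exact hl _ 0 fun a' b' => hcomm a b a' b'

theorem sum_pairing_swap {A C : Type} [Ring A] [Algebra ℝ A] [Fintype C] (P : C → C → ℝ)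
    (deg : C → ℕ) (n : ℕ)
    (hP : ∀ a b, P b a = (-1) ^ (n + 1) * (-1) ^ (deg a * deg b) * P a b) (S T : C → A)
    (h : ∀ a b, T a * S b = (-1 : ℝ) ^ (deg a * deg b) • (S b * T a)) :
    (∑ a, ∑ b, P a b • (T a * S b)) = (-1 : ℝ) ^ (n + 1) • ∑ a, ∑ b, P a b • (S a * T b) := by
  rw [Finset.sum_comm, Finset.smul_sum]
  refine Finset.sum_congr rfl fun a _ => ?_
  rw [Finset.smul_sum]
  refine Finset.sum_congr rfl fun b _ => ?_
  rw [h, hP a b, smul_smul, smul_smul]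
  congr 1
  have : ((-1 : ℝ) ^ (deg b * deg a)) * (-1) ^ (deg b * deg a) = 1 := by
    rw [← mul_pow]; simp
  rw [mul_comm (deg a)]
  linear_combination (-1 : ℝ) ^ (n + 1) * P a b * this

theorem prod_ofFn_perm {A : Type} [Ring A] (ε : ℤˣ) {k : ℕ} (g : Fin k → A)
    (hg : ∀ i j, g i * g j = ε • (g j * g i)) (τ : Equiv.Perm (Fin k)) (φ : ℤˣ →* ℤˣ)
    (hφ : φ (-1) = ε) :
    (List.ofFn (g ∘ τ)).prod = φ (Equiv.Perm.sign τ) • (List.ofFn g).prod := by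
  have hadj : ∀ (k : ℕ) (i : Fin k) (g : Fin (k + 1) → A),
      (∀ i j, g i * g j = ε • (g j * g i)) →
      (List.ofFn (g ∘ Equiv.swap i.castSucc i.succ)).prod = ε • (List.ofFn g).prod := by
    intro k
    induction k with
    | zero => intro i; exact i.elim0
    | succ k ih =>
      intro i g hg
      induction i using Fin.cases with
      | zero =>
        have h2 : ∀ x : Fin k, Equiv.swap (0 : Fin (k + 2)) 1 x.succ.succ = x.succ.succ := by
          intro x
          refine Equiv.swap_apply_of_ne_of_ne (Fin.succ_ne_zero _) ?_
          intro h
          exact Fin.succ_ne_zero x (Fin.succ_injective _ (by simpa using h))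
        simp only [List.ofFn_succ, List.prod_cons, Function.comp_apply, Fin.castSucc_zero,
          Fin.succ_zero_eq_one, Equiv.swap_apply_left, Equiv.swap_apply_right, h2]
        rw [← mul_assoc, hg 1 0, smul_mul_assoc, mul_assoc]
      | succ i =>
        have h0 : Equiv.swap i.succ.castSucc i.succ.succ (0 : Fin (k + 2)) = 0 := by
          refine Equiv.swap_apply_of_ne_of_ne ?_ (Fin.succ_ne_zero _).symm
          rw [Fin.castSucc_succ]
          exact (Fin.succ_ne_zero _).symm
        have h1 : ∀ x : Fin (k + 1), Equiv.swap i.succ.castSucc i.succ.succ x.succ =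
            (Equiv.swap i.castSucc i.succ x).succ := by
          intro x
          rw [Fin.castSucc_succ]
          exact (Fin.succ_injective _).swap_apply _ _ _
        have := ih i (fun x => g x.succ) fun a b => hg _ _
        rw [List.ofFn_succ, List.prod_cons, List.ofFn_succ (f := g), List.prod_cons]
        simp only [Function.comp_apply, h0, h1]
        simp only [Function.comp_def] at this
        rw [this, mul_smul_comm]
  rcases k with _ | k
  · have : τ = 1 := Subsingleton.elim _ _
    subst this
    simp
  · have hτ : τ ∈ Submonoid.closure
        (Set.range fun i : Fin k => Equiv.swap i.castSucc i.succ) := by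
      rw [Equiv.Perm.mclosure_swap_castSucc_succ]; trivial
    induction hτ using Submonoid.closure_induction_right with
    | one => simp
    | mul_right τ _ s hs ih =>
      obtain ⟨i, rfl⟩ := hs
      have := hadj k i (g ∘ τ) fun a b => hg _ _
      rw [Equiv.Perm.coe_mul, ← Function.comp_assoc, this, ih, Equiv.Perm.sign_mul, map_mul,
        Equiv.Perm.sign_swap (Fin.castSucc_lt_succ).ne, hφ, smul_smul, mul_comm]

theorem prod_ofFn_update {A : Type} [Ring A] (ε : ℤˣ) {k : ℕ} (g g' : Fin k → A) (e : Fin k)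
    (h1 : ∀ i, i ≠ e → g' i = g i) (h2 : g' e = ε • g e) :
    (List.ofFn g').prod = ε • (List.ofFn g).prod := by
  induction k with
  | zero => exact e.elim0
  | succ k ih =>
    rw [List.ofFn_succ, List.ofFn_succ (f := g), List.prod_cons, List.prod_cons]
    induction e using Fin.cases with
    | zero =>
      rw [h2, smul_mul_assoc]
      congr 3
      exact congrArg List.ofFn (funext fun i => h1 _ (Fin.succ_ne_zero i))
    | succ e =>
      rw [h1 0 (Fin.succ_ne_zero e).symm,
        ih (fun i => g i.succ) (fun i => g' i.succ) e
          (fun i hi => h1 _ fun h => hi (Fin.succ_injective _ h)) h2, mul_smul_comm]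

namespace NPDomain

variable {n : ℕ} (D : NPDomain n)

/-- The coordinates. -/
abbrev Crd : Type := Coord n D.m D.s D.r

/-- The coordinates of degree `0`, of even positive degree, and of odd degree. -/
abbrev BaseCrd : Type := {c : D.Crd // c.deg = 0}
abbrev EvenCrd : Type := {c : D.Crd // c.deg ≠ 0 ∧ Even c.deg}
abbrev OddCrd : Type := {c : D.Crd // Odd c.deg}

/-- The algebra of functions on the graded manifold: smooth functions on the base, tensored with the
free graded commutative algebra on the coordinates of positive degree (polynomials in the even
ones, exterior algebra on the odd ones). -/
def Fun : Type :=
  SmoothFun D.base ⊗[ℝ] (MvPolynomial D.EvenCrd ℝ ⊗[ℝ] ExteriorAlgebra ℝ (D.OddCrd → ℝ))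

instance : Ring D.Fun :=
  inferInstanceAs (Ring
    (SmoothFun D.base ⊗[ℝ] (MvPolynomial D.EvenCrd ℝ ⊗[ℝ] ExteriorAlgebra ℝ (D.OddCrd → ℝ))))

instance : Algebra ℝ D.Fun :=
  inferInstanceAs (Algebra ℝ
    (SmoothFun D.base ⊗[ℝ] (MvPolynomial D.EvenCrd ℝ ⊗[ℝ] ExteriorAlgebra ℝ (D.OddCrd → ℝ))))

/-- The function `f(x) · y · θ`, for a smooth function `f` of the coordinates of degree `0`, a
polynomial `y` in the even and an element `θ` of the exterior algebra on the odd coordinates. -/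
def tmul (f : SmoothFun D.base) (y : MvPolynomial D.EvenCrd ℝ)
    (θ : ExteriorAlgebra ℝ (D.OddCrd → ℝ)) : D.Fun :=
  (f ⊗ₜ[ℝ] (y ⊗ₜ[ℝ] θ) :
    SmoothFun D.base ⊗[ℝ] (MvPolynomial D.EvenCrd ℝ ⊗[ℝ] ExteriorAlgebra ℝ (D.OddCrd → ℝ)))

/-- Operators acting on one of the three factors. -/
def onBase (φ : Module.End ℝ (SmoothFun D.base)) : Module.End ℝ D.Fun :=
  LinearMap.rTensor (MvPolynomial D.EvenCrd ℝ ⊗[ℝ] ExteriorAlgebra ℝ (D.OddCrd → ℝ)) φ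

def onEven (φ : Module.End ℝ (MvPolynomial D.EvenCrd ℝ)) : Module.End ℝ D.Fun :=
  LinearMap.lTensor (SmoothFun D.base)
    (LinearMap.rTensor (ExteriorAlgebra ℝ (D.OddCrd → ℝ)) φ)

def onOdd (φ : Module.End ℝ (ExteriorAlgebra ℝ (D.OddCrd → ℝ))) : Module.End ℝ D.Fun :=
  LinearMap.lTensor (SmoothFun D.base) (LinearMap.lTensor (MvPolynomial D.EvenCrd ℝ) φ)

/-- The homogeneous functions of degree `k`. -/
def funGrading (k : ℤ) : Submodule ℝ D.Fun :=
  Submodule.span ℝ {w | ∃ (f : SmoothFun D.base) (a : D.EvenCrd →₀ ℕ) (l : List D.OddCrd),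
    ((a.sum fun c e => e * c.1.deg : ℕ) + ((l.map fun c => c.1.deg).sum : ℕ) : ℤ) = k ∧
    w = D.tmul f (MvPolynomial.monomial a 1)
      (l.map fun c => ExteriorAlgebra.ι ℝ (Pi.single c (1 : ℝ))).prod}

/-- The parity operator `f ↦ (-1)^f f`. -/
def parity : Module.End ℝ D.Fun :=
  D.onOdd (CliffordAlgebra.involute (Q := (0 : QuadraticForm ℝ (D.OddCrd → ℝ)))).toLinearMap

/-- The (left) partial derivative with respect to a coordinate. -/
def deriv (c : D.Crd) : Module.End ℝ D.Fun :=
  if h0 : c.deg = 0 then D.onBase (partialDeriv (⟨c, h0⟩ : D.BaseCrd))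
  else if h : Even c.deg then
    D.onEven (MvPolynomial.pderiv (R := ℝ) (⟨c, h0, h⟩ : D.EvenCrd)).toLinearMap
  else
    D.onOdd (CliffordAlgebra.contractLeft (Q := (0 : QuadraticForm ℝ (D.OddCrd → ℝ)))
      (LinearMap.proj (⟨c, Nat.not_even_iff_odd.1 h⟩ : D.OddCrd)))

/-- The constant coefficients `P^{ab}` of the Poisson bivector, i.e. of the operator
`Δ_{ij} = ∑ P^{ab} ∂_a^{(i)} ∂_b^{(j)}`. -/
def pairing : D.Crd → D.Crd → ℝ
  | .x μ, .p ν => if μ = ν then 1 else 0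
  | .p μ, .x ν => if μ = ν then (if Odd n then 1 else -1) else 0
  | .psi i α, .chi j β => if (⟨i, α⟩ : Σ i, Fin (D.r i)) = ⟨j, β⟩ then 1 else 0
  | .chi i α, .psi j β =>
      if (⟨i, α⟩ : Σ i, Fin (D.r i)) = ⟨j, β⟩ then
        (if Odd n then 1 else -(-1) ^ (i.1 + 1)) else 0
  | .xi a, .xi b => D.κ⁻¹ a b
  | _, _ => 0

theorem onBase_mul (φ ψ : Module.End ℝ (SmoothFun D.base)) :
    D.onBase φ * D.onBase ψ = D.onBase (φ * ψ) :=
  (LinearMap.rTensor_comp _ φ ψ).symm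

theorem onEven_mul (φ ψ : Module.End ℝ (MvPolynomial D.EvenCrd ℝ)) :
    D.onEven φ * D.onEven ψ = D.onEven (φ * ψ) := by
  refine (LinearMap.lTensor_comp (SmoothFun D.base) _ _).symm.trans ?_
  exact congrArg (LinearMap.lTensor (SmoothFun D.base)) (LinearMap.rTensor_comp _ φ ψ).symm

theorem onOdd_mul (φ ψ : Module.End ℝ (ExteriorAlgebra ℝ (D.OddCrd → ℝ))) :
    D.onOdd φ * D.onOdd ψ = D.onOdd (φ * ψ) := by
  refine (LinearMap.lTensor_comp (SmoothFun D.base) _ _).symm.trans ?_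
  exact congrArg (LinearMap.lTensor (SmoothFun D.base)) (LinearMap.lTensor_comp _ φ ψ).symm

theorem onOdd_neg (φ : Module.End ℝ (ExteriorAlgebra ℝ (D.OddCrd → ℝ))) :
    D.onOdd (-φ) = (-1 : ℝ) • D.onOdd φ := by
  have h : -φ = (-1 : ℝ) • φ := (neg_one_smul ℝ φ).symm
  rw [h]
  refine Eq.trans ?_ (LinearMap.lTensor_smul (SmoothFun D.base) (-1 : ℝ) _)
  exact congrArg (LinearMap.lTensor (SmoothFun D.base)) (LinearMap.lTensor_smul _ (-1 : ℝ) φ)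

theorem onBase_mul_onEven (φ : Module.End ℝ (SmoothFun D.base))
    (ψ : Module.End ℝ (MvPolynomial D.EvenCrd ℝ)) :
    D.onBase φ * D.onEven ψ = D.onEven ψ * D.onBase φ :=
  (LinearMap.rTensor_comp_lTensor _ _ _).trans (LinearMap.lTensor_comp_rTensor _ _ _).symm

theorem onBase_mul_onOdd (φ : Module.End ℝ (SmoothFun D.base))
    (ψ : Module.End ℝ (ExteriorAlgebra ℝ (D.OddCrd → ℝ))) :
    D.onBase φ * D.onOdd ψ = D.onOdd ψ * D.onBase φ :=
  (LinearMap.rTensor_comp_lTensor _ _ _).trans (LinearMap.lTensor_comp_rTensor _ _ _).symm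

theorem onEven_mul_onOdd (φ : Module.End ℝ (MvPolynomial D.EvenCrd ℝ))
    (ψ : Module.End ℝ (ExteriorAlgebra ℝ (D.OddCrd → ℝ))) :
    D.onEven φ * D.onOdd ψ = D.onOdd ψ * D.onEven φ := by
  refine (LinearMap.lTensor_comp (SmoothFun D.base) _ _).symm.trans
    (Eq.trans ?_ (LinearMap.lTensor_comp (SmoothFun D.base) _ _))
  exact congrArg (LinearMap.lTensor (SmoothFun D.base))
    ((LinearMap.rTensor_comp_lTensor _ _ _).trans (LinearMap.lTensor_comp_rTensor _ _ _).symm)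

theorem parity_mul_deriv (c : D.Crd) :
    D.parity * D.deriv c = (-1 : ℝ) ^ c.deg • (D.deriv c * D.parity) := by
  unfold deriv
  split_ifs with h0 h
  · rw [h0, pow_zero, one_smul, parity, onBase_mul_onOdd]
  · rw [h.neg_one_pow, one_smul, parity, onEven_mul_onOdd]
  · rw [(Nat.not_even_iff_odd.1 h).neg_one_pow, parity, onOdd_mul, onOdd_mul, ← onOdd_neg]
    congr 1
    exact LinearMap.ext fun x => involute_contractLeft' _ x

theorem deriv_mul_deriv (a b : D.Crd) :
    D.deriv a * D.deriv b = (-1 : ℝ) ^ (a.deg * b.deg) • (D.deriv b * D.deriv a) := by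
  have hcomm : Even (a.deg * b.deg) → D.deriv a * D.deriv b = D.deriv b * D.deriv a →
      D.deriv a * D.deriv b = (-1 : ℝ) ^ (a.deg * b.deg) • (D.deriv b * D.deriv a) := by
    intro h h'
    rw [h.neg_one_pow, one_smul, h']
  by_cases ha0 : a.deg = 0
  · refine hcomm (by simp [ha0]) ?_
    by_cases hb0 : b.deg = 0
    · simp only [deriv, ha0, hb0, dif_pos, onBase_mul]
      rw [partialDeriv_comm]
    · by_cases hb : Even b.deg
      · simp only [deriv, ha0, hb0, hb, dif_pos, dif_neg, not_false_eq_true, onBase_mul_onEven]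
      · simp only [deriv, ha0, hb0, hb, dif_pos, dif_neg, not_false_eq_true, onBase_mul_onOdd]
  by_cases hb0 : b.deg = 0
  · refine hcomm (by simp [hb0]) ?_
    by_cases ha : Even a.deg
    · simp only [deriv, ha0, hb0, ha, dif_pos, dif_neg, not_false_eq_true, onBase_mul_onEven]
    · simp only [deriv, ha0, hb0, ha, dif_pos, dif_neg, not_false_eq_true, onBase_mul_onOdd]
  by_cases ha : Even a.deg
  · refine hcomm (ha.mul_right _) ?_
    by_cases hb : Even b.deg
    · simp only [deriv, ha0, hb0, ha, hb, dif_pos, dif_neg, not_false_eq_true, onEven_mul]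
      congr 1
      exact LinearMap.ext fun x => pderiv_comm' _ _ x
    · simp only [deriv, ha0, hb0, ha, hb, dif_pos, dif_neg, not_false_eq_true, onEven_mul_onOdd]
  · by_cases hb : Even b.deg
    · refine hcomm (hb.mul_left _) ?_
      simp only [deriv, ha0, hb0, ha, hb, dif_pos, dif_neg, not_false_eq_true, onEven_mul_onOdd]
    · have hodd : Odd (a.deg * b.deg) :=
        (Nat.not_even_iff_odd.1 ha).mul (Nat.not_even_iff_odd.1 hb)
      rw [hodd.neg_one_pow]
      simp only [deriv, ha0, hb0, ha, hb, dif_neg, not_false_eq_true, onOdd_mul]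
      rw [← onOdd_neg]
      congr 1
      exact LinearMap.ext fun x => CliffordAlgebra.contractLeft_comm _ _ x

theorem parity_pow_mul_deriv (k : ℕ) (c : D.Crd) :
    D.parity ^ k * D.deriv c = (-1 : ℝ) ^ (k * c.deg) • (D.deriv c * D.parity ^ k) := by
  induction k with
  | zero => simp
  | succ k ih =>
    rw [pow_succ, mul_assoc, parity_mul_deriv, mul_smul_comm, ← mul_assoc, ih, smul_mul_assoc,
      smul_smul, mul_assoc, ← pow_add]
    congr 2; ring

theorem deriv_mul_parity_pow (k : ℕ) (c : D.Crd) :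
    D.deriv c * D.parity ^ k = (-1 : ℝ) ^ (k * c.deg) • (D.parity ^ k * D.deriv c) := by
  rw [parity_pow_mul_deriv, smul_smul, ← mul_pow]
  simp

theorem pairing_deg (a b : D.Crd) (h : D.pairing a b ≠ 0) : a.deg + b.deg = n := by
  rcases a with μ | μ | ⟨i, α⟩ | ⟨i, α⟩ | a <;> rcases b with ν | ν | ⟨j, β⟩ | ⟨j, β⟩ | b <;>
    simp only [pairing, ne_eq, not_true_eq_false] at h
  · simp [Coord.deg]
  · simp [Coord.deg]
  · have hij : i = j := by
      by_contra hne
      exact h (if_neg fun hh => hne (congrArg Sigma.fst hh))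
    subst hij
    have := i.2
    simp only [Coord.deg]; omega
  · have hij : i = j := by
      by_contra hne
      exact h (if_neg fun hh => hne (congrArg Sigma.fst hh))
    subst hij
    have := i.2
    simp only [Coord.deg]; omega
  · have hn : ¬ Odd n := fun hn => by
      have := D.s_eq_zero hn
      exact absurd a.2 (by omega)
    obtain ⟨t, rfl⟩ := Nat.not_odd_iff_even.1 hn
    simp only [Coord.deg]; omega

theorem kappa_inv_symm (a b : Fin D.s) : D.κ⁻¹ b a = -(-1) ^ (n / 2) * D.κ⁻¹ a b := by
  have hT : D.κ.transpose = (-(-1) ^ (n / 2) : ℝ) • D.κ := by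
    ext i j
    simpa using D.κ_symm j i
  have hu : (-(-1) ^ (n / 2) : ℝ) * (-(-1) ^ (n / 2)) = 1 := by
    rw [neg_mul_neg, ← mul_pow]; simp
  have h1 : (D.κ⁻¹).transpose = (-(-1) ^ (n / 2) : ℝ) • D.κ⁻¹ := by
    rw [Matrix.transpose_nonsing_inv, hT]
    refine Matrix.inv_eq_right_inv ?_
    rw [Matrix.smul_mul, Matrix.mul_smul, smul_smul, hu, one_smul,
      Matrix.mul_nonsing_inv _ D.κ_det]
  simpa using congrFun (congrFun h1 a) b

theorem neg_one_pow_psi_chi (i : Fin ((n - 1) / 2)) :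
    (-1 : ℝ) ^ ((i.1 + 1) * (n - (i.1 + 1))) = if Odd n then 1 else (-1) ^ (i.1 + 1) := by
  have := i.2
  obtain ⟨t, ht⟩ : ∃ t, n = (i.1 + 1) + t := ⟨n - (i.1 + 1), by omega⟩
  have h1 : n - (i.1 + 1) = t := by omega
  rw [h1, pow_mul]
  rcases Nat.even_or_odd (i.1 + 1) with hi | hi
  · split_ifs <;> simp [hi.neg_one_pow]
  · rcases Nat.even_or_odd t with h | h
    · have hn : Odd n := by rw [ht]; exact hi.add_even h
      simp [hi.neg_one_pow, h.neg_one_pow, hn]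
    · have hn : ¬ Odd n := by rw [ht, Nat.not_odd_iff_even]; exact hi.add_odd h
      simp [hi.neg_one_pow, h.neg_one_pow, hn]

theorem pairing_symm (a b : D.Crd) :
    D.pairing b a = (-1) ^ (n + 1) * (-1) ^ (a.deg * b.deg) * D.pairing a b := by
  have hn1 : (-1 : ℝ) ^ (n + 1) = if Odd n then 1 else -1 := by
    rw [pow_succ]
    rcases Nat.even_or_odd n with hn | hn
    · simp [hn.neg_one_pow, Nat.not_odd_iff_even.2 hn]
    · simp [hn.neg_one_pow, hn]
  have hsq : ∀ k : ℕ, (-1 : ℝ) ^ k * (-1) ^ k = 1 := fun k => by rw [← mul_pow]; simp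
  rw [hn1]
  rcases a with μ | μ | ⟨i, α⟩ | ⟨i, α⟩ | a <;> rcases b with ν | ν | ⟨j, β⟩ | ⟨j, β⟩ | b <;>
    simp only [pairing, mul_zero]
  · by_cases h : μ = ν
    · subst h
      simp [Coord.deg]
    · simp [h, Ne.symm h]
  · by_cases h : μ = ν
    · subst h
      by_cases hn : Odd n <;> simp [Coord.deg, hn]
    · simp [h, Ne.symm h]
  · by_cases h : (⟨i, α⟩ : Σ i, Fin (D.r i)) = ⟨j, β⟩
    · rw [if_pos h, if_pos h.symm]
      obtain ⟨rfl, -⟩ := Sigma.mk.inj_iff.1 h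
      simp only [Coord.deg, neg_one_pow_psi_chi]
      by_cases hn : Odd n <;> simp [hn]
    · rw [if_neg h, if_neg (Ne.symm h), mul_zero]
  · by_cases h : (⟨i, α⟩ : Σ i, Fin (D.r i)) = ⟨j, β⟩
    · rw [if_pos h, if_pos h.symm]
      obtain ⟨rfl, -⟩ := Sigma.mk.inj_iff.1 h
      simp only [Coord.deg]
      rw [mul_comm (n - (i.1 + 1)), neg_one_pow_psi_chi]
      by_cases hn : Odd n
      · simp [hn]
      · simp only [hn, if_false]
        linear_combination -hsq (i.1 + 1)
    · rw [if_neg h, if_neg (Ne.symm h), mul_zero]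
  · have hn : ¬ Odd n := fun hn => by
      have := D.s_eq_zero hn
      exact absurd a.2 (by omega)
    rw [kappa_inv_symm, if_neg hn]
    simp only [Coord.deg]
    congr 1
    rw [pow_mul]
    rcases Nat.even_or_odd (n / 2) with h | h <;> simp [h.neg_one_pow]

/-! ### The representation of the graph operad -/

/-- The derivative `∂_a^{(i)}` acting on the `i`-th factor of a tensor product of `N` functions, with
the Koszul sign `(-1)^(deg a · (f_1 + ⋯ + f_{i-1}))`. -/
def slotDeriv {N : ℕ} (a : D.Crd) (i : Fin N) : Module.End ℝ (⨂[ℝ] _ : Fin N, D.Fun) :=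
  PiTensorProduct.map fun j =>
    if j < i then D.parity ^ a.deg else if j = i then D.deriv a else 1

/-- The operator `Δ_{ij}`. -/
def edgeOp {N : ℕ} (i j : Fin N) : Module.End ℝ (⨂[ℝ] _ : Fin N, D.Fun) :=
  ∑ a : D.Crd, ∑ b : D.Crd, D.pairing a b • (D.slotDeriv a i * D.slotDeriv b j)

/-- The multiplication `f_1 ⊗ ⋯ ⊗ f_N ↦ f_1 ⋯ f_N`. -/
def mulMap (N : ℕ) : (⨂[ℝ] _ : Fin N, D.Fun) →ₗ[ℝ] D.Fun :=
  PiTensorProduct.lift (MultilinearMap.mkPiAlgebraFin ℝ N D.Fun)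

theorem slotDeriv_mul_slotDeriv {N : ℕ} (a b : D.Crd) (i j : Fin N) :
    D.slotDeriv a i * D.slotDeriv b j =
      (-1 : ℝ) ^ (a.deg * b.deg) • (D.slotDeriv b j * D.slotDeriv a i) :=
  map_slot_mul _ _ _ _ _ i j (by rw [← pow_add, ← pow_add, add_comm])
    (by rw [deriv_mul_parity_pow, mul_comm a.deg]) (D.parity_pow_mul_deriv _ _)
    (D.deriv_mul_deriv a b)

theorem edgeOp_swap {N : ℕ} (i j : Fin N) :
    D.edgeOp j i = (-1 : ℝ) ^ (n + 1) • D.edgeOp i j :=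
  sum_pairing_swap D.pairing Coord.deg n D.pairing_symm (fun a => D.slotDeriv a i)
    (fun a => D.slotDeriv a j) fun a b => D.slotDeriv_mul_slotDeriv a b j i

theorem edgeOp_mul_edgeOp {N : ℕ} (i j i' j' : Fin N) :
    D.edgeOp i j * D.edgeOp i' j' = (-1 : ℝ) ^ n • (D.edgeOp i' j' * D.edgeOp i j) :=
  sum_pairing_mul D.pairing Coord.deg n D.pairing_deg _ _ _ _
    (fun _ _ => D.slotDeriv_mul_slotDeriv _ _ _ _) (fun _ _ => D.slotDeriv_mul_slotDeriv _ _ _ _)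
    (fun _ _ => D.slotDeriv_mul_slotDeriv _ _ _ _) (fun _ _ => D.slotDeriv_mul_slotDeriv _ _ _ _)

/-- `f_1 ⊗ ⋯ ⊗ f_N ↦ μ_N (∏_{(i,j) ∈ E} Δ_{ij} (f_1 ⊗ ⋯ ⊗ f_N))`, the product being taken in the
order of the edges. -/
def repGraph {N k : ℕ} (G : Multidigraph N k) : MultilinearMap ℝ (fun _ : Fin N => D.Fun) D.Fun :=
  (D.mulMap N ∘ₗ (List.ofFn fun e => D.edgeOp (G e).1 (G e).2).prod).compMultilinearMap
    (PiTensorProduct.tprod ℝ)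



theorem neg_one_zpow_smul {A : Type*} [AddCommGroup A] [Module ℝ A] (k : ℕ) (x : A) :
    ((-1 : ℤˣ) ^ (k : ℤ)) • x = (-1 : ℝ) ^ k • x := by
  rw [zpow_natCast]
  rcases Nat.even_or_odd k with h | h <;> simp [h.neg_one_pow, Units.smul_def]

theorem compMultilinearMap_units_smul {N : ℕ} (L L' : Module.End ℝ (⨂[ℝ] _ : Fin N, D.Fun))
    (u : ℤˣ) (h : L = u • L') :
    (D.mulMap N ∘ₗ L).compMultilinearMap (PiTensorProduct.tprod ℝ) =
      u • (D.mulMap N ∘ₗ L').compMultilinearMap (PiTensorProduct.tprod ℝ) := by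
  subst h
  rcases Int.units_eq_one_or u with rfl | rfl
  · simp
  · ext v
    simp [Units.smul_def]

/-- `Rep_N` on the part of `Gra_d(N)` with `k` edges, `d = n + 1`. -/
def rep {N k : ℕ} :
    Gra ((n : ℤ) + 1) N k →ₗ[ℝ] MultilinearMap ℝ (fun _ : Fin N => D.Fun) D.Fun :=
  Gra.lift _ D.repGraph
    (fun G τ => by
      have h := prod_ofFn_perm ((-1 : ℤˣ) ^ ((n : ℤ) + 1 + 1))
        (fun e => D.edgeOp (G e).1 (G e).2)
        (fun i j => by
          have h2 : (-1 : ℤˣ) ^ ((n : ℤ) + 1 + 1) = (-1 : ℤˣ) ^ (n : ℤ) := by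
            rw [zpow_add_one, zpow_add_one, mul_assoc]; simp
          rw [edgeOp_mul_edgeOp, h2, neg_one_zpow_smul])
        τ (zpowGroupHom ((n : ℤ) + 1 + 1)) rfl
      exact D.compMultilinearMap_units_smul _ _ _ h)
    (fun G e => by
      have h := prod_ofFn_update ((-1 : ℤˣ) ^ ((n : ℤ) + 1))
        (fun e => D.edgeOp (G e).1 (G e).2)
        (fun e' => D.edgeOp (flipEdge e G e').1 (flipEdge e G e').2) e
        (fun i hi => by simp [flipEdge, hi])
        (by
          have h2 : (n : ℤ) + 1 = ((n + 1 : ℕ) : ℤ) := by push_cast; rfl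
          rw [h2, neg_one_zpow_smul]
          simpa [flipEdge] using D.edgeOp_swap (G e).1 (G e).2)
      exact D.compMultilinearMap_units_smul _ _ _ h)

end NPDomain

/-! ### The Chevalley–Eilenberg complex and `Lie_∞`-algebras -/

/-- Families of multilinear maps `V^(p + 1) → V`, `p ≥ 0`, i.e. elements of the product over all
arities. -/
abbrev Cochains (V : Type*) [AddCommGroup V] [Module ℝ V] : Type _ :=
  (p : ℕ) → MultilinearMap ℝ (fun _ : Fin (p + 1) => V) V

/-- The Koszul sign of the passage from `X_1 ⊗ ⋯ ⊗ X_N` to `X_{τ 1} ⊗ ⋯ ⊗ X_{τ N}`, where `X_i` is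
homogeneous of degree `x i`. -/
def koszul {N : ℕ} (τ : Equiv.Perm (Fin N)) (x : Fin N → ℤ) : ℤˣ :=
  ∏ i, ∏ j, if i < j ∧ τ j < τ i then (-1) ^ (x (τ i) * x (τ j)) else 1

section CE

variable {V : Type*} [AddCommGroup V] [Module ℝ V]

/-- `c` belongs to the component `CE^k = ∏_{i + p = k} Hom^i(𝔤^{∧ (p + 1)}, 𝔤)` of the graded
Chevalley–Eilenberg cochains of the graded vector space `𝔤 = ⨁ 𝒜 i`. -/
structure IsCE (𝒜 : ℤ → Submodule ℝ V) (k : ℤ) (c : Cochains V) : Prop where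
  degree : ∀ (p : ℕ) (x : Fin (p + 1) → ℤ) (X : Fin (p + 1) → V), (∀ i, X i ∈ 𝒜 (x i)) →
    c p X ∈ 𝒜 (∑ i, x i + (k - p))
  antisymm : ∀ (p : ℕ) (x : Fin (p + 1) → ℤ) (X : Fin (p + 1) → V), (∀ i, X i ∈ 𝒜 (x i)) →
    ∀ τ : Equiv.Perm (Fin (p + 1)), c p (X ∘ τ) = (Equiv.Perm.sign τ * koszul τ x) • c p X

open Classical in
/-- The component of arity `P + 1` of the Nijenhuis–Richardson product `c ∘ c'`, where `c'` has
total degree `k'`, evaluated on arguments `X i` of degree `x i`. The summand of arities `p + 1`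
for `c` and `q + 1` for `c'` carries the sign `(-1)^(p |c'_q|)`, where `|c'_q| = k' - q` is the
degree of `c'_q` as a map, besides the signature and the Koszul sign of the unshuffle. -/
def nrProd (k' : ℤ) (c c' : Cochains V) (P : ℕ) (x : Fin (P + 1) → ℤ) (X : Fin (P + 1) → V) : V :=
  ∑ y : Finset.HasAntidiagonal.antidiagonal P, ∑ σ : Equiv.Perm (Fin (P + 1)),
    if IsUnshuffle (y.1.2 + 1) σ then
      (Equiv.Perm.sign σ * koszul σ⁻¹ x * (-1) ^ ((y.1.1 : ℤ) * (k' - y.1.2))) •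
        c y.1.1 (Fin.cons
          (c' y.1.2 fun i => X (σ⁻¹ (embed (Finset.HasAntidiagonal.mem_antidiagonal.1 y.2) i)))
          fun i : Fin y.1.1 => X (σ⁻¹ ⟨y.1.2 + 1 + i.1, by
            have := Finset.HasAntidiagonal.mem_antidiagonal.1 y.2
            omega⟩))
    else 0

/-- The Nijenhuis–Richardson bracket of cochains of total degrees `k` and `k'`. -/
def nrBracket (k k' : ℤ) (c c' : Cochains V) (P : ℕ) (x : Fin (P + 1) → ℤ)
    (X : Fin (P + 1) → V) : V :=
  nrProd k' c c' P x X - (-1 : ℤˣ) ^ (k * k') • nrProd k c' c P x X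

/-- `Lie_∞`-algebra structures on the graded vector space `⨁ 𝒜 i`: graded antisymmetric brackets
`l_N` with `N ≥ 1` arguments (here `l_N = l (N - 1)`), of degree `2 - N`, with
`∑ ± l_{p + 1}(l_{q + 1}(X_{σ⁻¹ 0}, …, X_{σ⁻¹ q}), X_{σ⁻¹ (q + 1)}, …) = 0`, the sign being
`(-1)^(p (q + 1))` times the signature and the Koszul sign of the unshuffle. -/
structure IsLieInfty (𝒜 : ℤ → Submodule ℝ V) (l : Cochains V) : Prop where
  cochain : IsCE 𝒜 1 l
  jacobi : ∀ (P : ℕ) (x : Fin (P + 1) → ℤ) (X : Fin (P + 1) → V), (∀ i, X i ∈ 𝒜 (x i)) →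
    nrProd 1 l l P x X = 0

/-- Families `∑ r, ε ^ r l_r` of cochains that form an `ℝ[[ε]]`-linear `Lie_∞`-algebra structure on
formal power series in `ε`, the parameter `ε` having degree `0`. -/
structure IsFormalLieInfty (𝒜 : ℤ → Submodule ℝ V) (l : ℕ → Cochains V) : Prop where
  cochain : ∀ r, IsCE 𝒜 1 (l r)
  jacobi : ∀ (r P : ℕ) (x : Fin (P + 1) → ℤ) (X : Fin (P + 1) → V), (∀ i, X i ∈ 𝒜 (x i)) →
    ∑ ij ∈ Finset.HasAntidiagonal.antidiagonal r, nrProd 1 (l ij.1) (l ij.2) P x X = 0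

end CE

namespace NPDomain

variable {n : ℕ} (D : NPDomain n)

/-! ### The Schouten algebra and its universal deformations -/

/-- The Poisson bracket `{f, g} = ∑ P^{ab} (-1)^(f · deg b) ∂_a f · ∂_b g`, of degree `-n`. -/
def poisson : MultilinearMap ℝ (fun _ : Fin 2 => D.Fun) D.Fun :=
  ∑ a : D.Crd, ∑ b : D.Crd, D.pairing a b •
    (MultilinearMap.mkPiAlgebraFin ℝ 2 D.Fun).compLinearMap
      ![D.deriv a * D.parity ^ b.deg, D.deriv b]

/-- The grading of `T_poly = Fun[n]`: the elements of degree `k` are the functions of degree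
`k + n`. -/
def tGrading (k : ℤ) : Submodule ℝ D.Fun := D.funGrading (k + n)

/-- The operator `X ↦ (-1)^X X` for the degree of `T_poly`. -/
def tParity : Module.End ℝ D.Fun := (-1 : ℝ) ^ n • D.parity

/-- The pullback `s⁻¹ ∘ θ ∘ (s ⊗ ⋯ ⊗ s)` along the suspension map `s : T_poly → Fun` of degree `n`
(the identity of the underlying vector space), where
`(s ⊗ ⋯ ⊗ s) (X_1 ⊗ ⋯ ⊗ X_N) = (-1)^(∑ i, n (N - i) X_i) s X_1 ⊗ ⋯ ⊗ s X_N`. -/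
def pullback {N : ℕ} :
    MultilinearMap ℝ (fun _ : Fin N => D.Fun) D.Fun →ₗ[ℝ]
      MultilinearMap ℝ (fun _ : Fin N => D.Fun) D.Fun :=
  MultilinearMap.compLinearMapₗ fun i : Fin N => D.tParity ^ (n * (N - 1 - i.1))

/-- The Schouten bracket `[ , ]_S = s⁻¹ ∘ { , } ∘ (s ⊗ s)`, as a cochain. -/
def schouten : Cochains D.Fun
  | 1 => D.pullback D.poisson
  | _ => 0

/-- The map `s* Rep`. The sum over the numbers of edges has finitely many non-zero terms if
`HasFiniteEdges m`; for `n ≥ 1` this holds whenever `m` is homogeneous. -/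
def sRep (m : GraphSeries ((n : ℤ) + 1)) : Cochains D.Fun := fun p =>
  ∑ᶠ k, D.pullback (D.rep (m p k))

/-- The cochain `c` is a universal deformation of the graded Lie algebra `(T_poly, [ , ]_S)` as a
`Lie_∞`-algebra: it is a Maurer–Cartan element of the Chevalley–Eilenberg dg Lie algebra, so that
`[ , ]_S + c` is a `Lie_∞`-structure, and this structure is universal, i.e. given by the action of
a structure `γ` in the graph operad (`γ ∈ fGC_d` of degree `1` with `[γ, γ] = 0`, i.e. a morphism to
`Gra_d` from the operad governing (shifted) `Lie_∞`-algebras). -/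
structure IsUniversalDeformation (c : Cochains D.Fun) : Prop where
  cochain : IsCE D.tGrading 1 c
  maurerCartan : ∀ (P : ℕ) (x : Fin (P + 1) → ℤ) (X : Fin (P + 1) → D.Fun),
    (∀ i, X i ∈ D.tGrading (x i)) →
      nrBracket 1 1 D.schouten c P x X + (1 / 2 : ℝ) • nrBracket 1 1 c c P x X = 0
  lieInfty : IsLieInfty D.tGrading (D.schouten + c)
  universal : ∃ γ ∈ fGC ((n : ℤ) + 1), HasDegree 1 γ ∧ HasFiniteEdges γ ∧ bracket γ γ = 0 ∧
    D.schouten + c = D.sRep γ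

/-- The brackets of the deformation given by a formal power series `∑ r, ε ^ r c_r`, that is, the
coefficients of `[ , ]_S + ∑ r, ε ^ r c_r`. -/
def deformed (c : ℕ → Cochains D.Fun) (r : ℕ) : Cochains D.Fun :=
  if r = 0 then D.schouten + c 0 else c r

/-- The analogue over `ℝ[[ε]]` of `IsUniversalDeformation`, for `∑ r, ε ^ r c_r`. -/
structure IsFormalUniversalDeformation (c : ℕ → Cochains D.Fun) : Prop where
  cochain : ∀ r, IsCE D.tGrading 1 (c r)
  maurerCartan : ∀ (r P : ℕ) (x : Fin (P + 1) → ℤ) (X : Fin (P + 1) → D.Fun),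
    (∀ i, X i ∈ D.tGrading (x i)) →
      nrBracket 1 1 D.schouten (c r) P x X + (1 / 2 : ℝ) •
        ∑ ij ∈ Finset.HasAntidiagonal.antidiagonal r, nrBracket 1 1 (c ij.1) (c ij.2) P x X = 0
  lieInfty : IsFormalLieInfty D.tGrading (D.deformed c)
  universal : ∃ γ : ℕ → GraphSeries ((n : ℤ) + 1),
    (∀ r, γ r ∈ fGC ((n : ℤ) + 1) ∧ HasDegree 1 (γ r) ∧ HasFiniteEdges (γ r)) ∧
    (∀ r, ∑ ij ∈ Finset.HasAntidiagonal.antidiagonal r, bracket (γ ij.1) (γ ij.2) = 0) ∧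
    ∀ r, D.deformed c r = D.sRep (γ r)

end NPDomain

end NPGraph

end

/-! `s^* Rep` is a morphism of pre-Lie products, from the full graph complex to the cochains with
the Nijenhuis–Richardson product. By the Leibniz rule, `Δ_ij` applied to a product of functions is
the sum of the `Δ` between their factors, so inserting one graph in a vertex of another amounts to
composing the two multidifferential operators; the suspension `s` turns the Koszul signs of
functions into those of the Schouten algebra, and unshuffles of vertices into unshuffles of
arguments.

The edge graph `Γ` is sent to the Schouten bracket and `Γ ∘ Γ = 0`, so the Maurer–Cartan equation
for `m` says that `(Γ + m) ∘ (Γ + m) = 0`. Both the Maurer–Cartan equation and the `Lie_∞` relations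
therefore hold for the images. For `n = 0` the number of edges, lowered by one, is additive under
insertion, so that it grades the Maurer–Cartan equation by powers of `ε`; the edgeless part of an
element of degree one vanishes by antisymmetry. -/

noncomputable section

namespace NPGraph

/-! ### Leibniz rules and signs -/

theorem extendFun_mul {ι : Type} {U : TopologicalSpace.Opens (ι → ℝ)} (f g : U → ℝ) :
    extendFun (f * g) = extendFun f * extendFun g := by
  funext y
  by_cases hy : ∃ u : U, u.1 = y
  · obtain ⟨u, rfl⟩ := hy
    simp only [Pi.mul_apply, extendFun_apply]
  · simp [extendFun, Function.extend_apply' _ _ _ hy]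

theorem partialDeriv_mul {ι : Type} [Fintype ι] [DecidableEq ι]
    {U : TopologicalSpace.Opens (ι → ℝ)} (i : ι) (f g : SmoothFun U) :
    partialDeriv i (f * g) = partialDeriv i f * g + f * partialDeriv i g := by
  ext u
  change fderiv ℝ (extendFun (f.1 * g.1)) u (Pi.single i 1) =
    fderiv ℝ (extendFun f.1) u (Pi.single i 1) * g.1 u +
      f.1 u * fderiv ℝ (extendFun g.1) u (Pi.single i 1)
  rw [extendFun_mul, fderiv_mul (differentiableAt_extendFun f u) (differentiableAt_extendFun g u)]
  simp only [extendFun_apply, add_apply, smul_apply, smul_eq_mul]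
  ring

theorem contractLeft_mul {R M : Type*} [CommRing R] [AddCommGroup M] [Module R M]
    {Q : QuadraticForm R M} (φ : Module.Dual R M) (x y : CliffordAlgebra Q) :
    CliffordAlgebra.contractLeft φ (x * y) =
      CliffordAlgebra.contractLeft φ x * y +
        CliffordAlgebra.involute x * CliffordAlgebra.contractLeft φ y := by
  induction x using CliffordAlgebra.left_induction with
  | algebraMap r => simp [← Algebra.smul_def]
  | add x x' hx hx' => simp only [map_add, add_mul, hx, hx']; abel
  | ι_mul x m hx =>
    rw [mul_assoc, CliffordAlgebra.contractLeft_ι_mul, hx, CliffordAlgebra.contractLeft_ι_mul,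
      map_mul, CliffordAlgebra.involute_ι]
    simp only [sub_mul, mul_add, smul_mul_assoc, neg_mul, mul_assoc]
    abel

section ExteriorAlgebra

variable {R M : Type*} [CommRing R] [AddCommGroup M] [Module R M]

theorem ι_mul_prod_map_ι (v : M) (l : List M) :
    ExteriorAlgebra.ι R v * (l.map (ExteriorAlgebra.ι R)).prod =
      (-1 : R) ^ l.length • ((l.map (ExteriorAlgebra.ι R)).prod * ExteriorAlgebra.ι R v) := by
  induction l with
  | nil => simp
  | cons w l ih =>
    have hvw : ExteriorAlgebra.ι R v * ExteriorAlgebra.ι R w =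
        -(ExteriorAlgebra.ι R w * ExteriorAlgebra.ι R v) :=
      eq_neg_of_add_eq_zero_left (ExteriorAlgebra.ι_add_mul_swap v w)
    rw [List.map_cons, List.prod_cons, ← mul_assoc, hvw, neg_mul, mul_assoc, ih, mul_smul_comm,
      List.length_cons, pow_succ, mul_neg_one, neg_smul, mul_assoc]

theorem prod_map_ι_mul_prod_map_ι (l l' : List M) :
    (l.map (ExteriorAlgebra.ι R)).prod * (l'.map (ExteriorAlgebra.ι R)).prod =
      (-1 : R) ^ (l.length * l'.length) •
        ((l'.map (ExteriorAlgebra.ι R)).prod * (l.map (ExteriorAlgebra.ι R)).prod) := by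
  induction l with
  | nil => simp
  | cons v l ih =>
    rw [List.map_cons, List.prod_cons, mul_assoc, ih, mul_smul_comm, ← mul_assoc,
      ι_mul_prod_map_ι, smul_mul_assoc, smul_smul, ← pow_add, List.length_cons, mul_assoc,
      add_one_mul]

end ExteriorAlgebra

theorem multilinearMap_units_smul {R ι W : Type*} {V : ι → Type*} [CommRing R] [Fintype ι]
    [∀ i, AddCommGroup (V i)] [∀ i, Module R (V i)] [AddCommGroup W] [Module R W]
    (φ : MultilinearMap R V W) (c : ι → ℤˣ) (X : (i : ι) → V i) :
    φ (fun i => c i • X i) = (∏ i, c i) • φ X := by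
  simp only [Units.smul_def, ← Int.cast_smul_eq_zsmul R]
  rw [φ.map_smul_univ, Units.coe_prod, Int.cast_prod]

theorem neg_one_zpow_sub (k l : ℤ) : (-1 : ℤˣ) ^ (k - l) = (-1) ^ k * (-1) ^ l :=
  Int.negOnePow_sub k l

section PairProd

variable {ι M : Type*} [Fintype ι] [LinearOrder ι] [CommMonoid M]

/-- The product of `w i j` over the pairs `i < j`; Koszul signs and signatures are of this form. -/
def pairProd (w : ι → ι → M) : M :=
  ∏ i, ∏ j, if i < j then w i j else 1

theorem pairProd_mul (v w : ι → ι → M) :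
    pairProd (fun i j => v i j * w i j) = pairProd v * pairProd w := by
  simp only [pairProd, ← Finset.prod_mul_distrib]
  refine Finset.prod_congr rfl fun i _ => Finset.prod_congr rfl fun j _ => ?_
  split_ifs <;> simp

theorem pairProd_congr {v w : ι → ι → M} (h : ∀ i j, i < j → v i j = w i j) :
    pairProd v = pairProd w := by
  refine Finset.prod_congr rfl fun i _ => Finset.prod_congr rfl fun j _ => ?_
  split_ifs with hij
  · exact h i j hij
  · rfl

theorem pairProd_eq_prod_filter (w : ι → ι → M) :
    pairProd w = ∏ p : ι × ι with p.1 < p.2, w p.1 p.2 := by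
  rw [Finset.prod_filter, Fintype.prod_prod_type]
  rfl

/-- Permuting the indices permutes the unordered pairs, represented by their sorted members. -/
theorem pairProd_comp_perm {w : ι → ι → M} (hw : ∀ i j, w i j = w j i) (τ : Equiv.Perm ι) :
    pairProd (fun i j => w (τ i) (τ j)) = pairProd w := by
  let sorted (ρ : Equiv.Perm ι) (p : ι × ι) : ι × ι :=
    (min (ρ p.1) (ρ p.2), max (ρ p.1) (ρ p.2))
  have sorted_lt : ∀ (ρ : Equiv.Perm ι) (p : ι × ι), p.1 < p.2 →
      (sorted ρ p).1 < (sorted ρ p).2 := fun ρ p hp =>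
    min_lt_max.2 fun h => hp.ne (ρ.injective h)
  have sorted_inv : ∀ (ρ : Equiv.Perm ι) (p : ι × ι), p.1 < p.2 →
      sorted ρ⁻¹ (sorted ρ p) = p := by
    intro ρ p hp
    rcases le_total (ρ p.1) (ρ p.2) with h | h <;> simp [sorted, h, hp.le]
  rw [pairProd_eq_prod_filter, pairProd_eq_prod_filter]
  refine Finset.prod_nbij' (sorted τ) (sorted τ⁻¹) ?_ ?_ ?_ ?_ ?_ <;>
    simp only [Finset.mem_filter, Finset.mem_univ, true_and]
  · exact sorted_lt τ
  · exact sorted_lt τ⁻¹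
  · exact sorted_inv τ
  · simpa only [inv_inv] using sorted_inv τ⁻¹
  · intro p _
    rcases le_total (τ p.1) (τ p.2) with h | h <;> simp [sorted, h, hw (τ p.1)]

theorem pairProd_left {N : ℕ} (u : Fin N → M) :
    pairProd (fun i _ => u i) = ∏ i, u i ^ (N - 1 - i.1) := by
  refine Finset.prod_congr rfl fun i _ => ?_
  rw [Finset.prod_ite, Finset.prod_const_one, mul_one, Finset.prod_const, ← Fin.card_Ioi]
  congr 2
  ext j; simp

end PairProd

theorem sign_eq_pairProd {N : ℕ} (τ : Equiv.Perm (Fin N)) :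
    Equiv.Perm.sign τ = pairProd fun i j => if τ j < τ i then -1 else 1 := by
  rw [Equiv.Perm.sign_eq_prod_prod_Ioi]
  refine Finset.prod_congr rfl fun i _ => ?_
  rw [← Finset.prod_filter]
  refine Finset.prod_congr (by ext j; simp) fun j hj => ?_
  have hij : i < j := by simpa using hj
  rcases lt_or_gt_of_ne (τ.injective.ne hij.ne) with h | h <;> simp [h, h.not_gt]

/-- The factor of the Koszul sign of the degrees `x` contributed by elements of indices `a` and `b`
occurring in this order. -/
def inversionSign {ι : Type*} [LinearOrder ι] (x : ι → ℤ) (a b : ι) : ℤˣ :=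
  if b < a then (-1) ^ (x a * x b) else 1

theorem koszul_eq_pairProd {N : ℕ} (τ : Equiv.Perm (Fin N)) (x : Fin N → ℤ) :
    koszul τ x = pairProd fun i j => inversionSign x (τ i) (τ j) := by
  refine Finset.prod_congr rfl fun i _ => Finset.prod_congr rfl fun j _ => ?_
  by_cases h : i < j <;> simp [inversionSign, h]

theorem koszul_one {N : ℕ} (x : Fin N → ℤ) : koszul (1 : Equiv.Perm (Fin N)) x = 1 :=
  Finset.prod_eq_one fun _ _ => Finset.prod_eq_one fun _ _ => if_neg fun h => lt_asymm h.1 h.2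

/-- The quotient of the two inversion signs attached to a pair is symmetric, so that its product
over all pairs is the same before and after applying `ρ`. -/
theorem koszul_mul {N : ℕ} (τ ρ : Equiv.Perm (Fin N)) (x : Fin N → ℤ) :
    koszul (τ * ρ) x = koszul ρ (x ∘ τ) * koszul τ x := by
  have hw : ∀ i j : Fin N,
      inversionSign x (τ i) (τ j) * inversionSign (x ∘ τ) i j =
        inversionSign x (τ j) (τ i) * inversionSign (x ∘ τ) j i := by
    intro i j
    rcases lt_trichotomy i j with h | rfl | h
    · rcases lt_or_gt_of_ne (τ.injective.ne h.ne) with h' | h' <;>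
        simp [inversionSign, h, h', h.not_gt, h'.not_gt, mul_comm (x (τ i))]
    · rfl
    · rcases lt_or_gt_of_ne (τ.injective.ne h.ne) with h' | h' <;>
        simp [inversionSign, h, h', h.not_gt, h'.not_gt, mul_comm (x (τ i))]
  have hτρ : koszul (τ * ρ) x = pairProd fun i j => inversionSign x (τ (ρ i)) (τ (ρ j)) :=
    koszul_eq_pairProd _ _
  have hone : pairProd (inversionSign (x ∘ τ)) = 1 :=
    (koszul_eq_pairProd 1 (x ∘ τ)).symm.trans (koszul_one _)
  have h := pairProd_comp_perm hw ρ
  rw [pairProd_mul, pairProd_mul, ← hτρ, ← koszul_eq_pairProd, ← koszul_eq_pairProd, hone,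
    mul_one] at h
  rw [← h, mul_comm (koszul ρ _), mul_assoc, Int.units_mul_self, mul_one]

theorem koszul_congr {N : ℕ} (τ : Equiv.Perm (Fin N)) {x y : Fin N → ℤ}
    (h : ∀ i, Even (x i - y i)) : koszul τ x = koszul τ y := by
  refine Finset.prod_congr rfl fun i _ => Finset.prod_congr rfl fun j _ => ?_
  congr 1
  obtain ⟨s, hs⟩ := h (τ i)
  obtain ⟨t, ht⟩ := h (τ j)
  refine (Int.negOnePow_eq_iff _ _).2 ⟨2 * s * t + s * y (τ j) + t * y (τ i), ?_⟩
  rw [sub_eq_iff_eq_add.1 hs, sub_eq_iff_eq_add.1 ht]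
  ring

theorem koszul_add_one {N : ℕ} (τ : Equiv.Perm (Fin N)) (x : Fin N → ℤ) :
    koszul τ (fun i => x i + 1) = Equiv.Perm.sign τ * koszul τ x *
      ((∏ i, ((-1 : ℤˣ) ^ x i) ^ (N - 1 - i.1)) * ∏ i, ((-1 : ℤˣ) ^ x (τ i)) ^ (N - 1 - i.1)) := by
  let u : Fin N → ℤˣ := fun i => (-1) ^ x i
  let w : Fin N → Fin N → ℤˣ := fun a b => u (min a b)
  have hleft : (∏ i, u i ^ (N - 1 - i.1)) = pairProd fun i j => w (τ i) (τ j) := by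
    rw [pairProd_comp_perm (fun a b => congrArg u (min_comm a b)) τ, ← pairProd_left]
    exact pairProd_congr fun i j hij => by simp only [min_eq_left hij.le]
  have hright : (∏ i, u (τ i) ^ (N - 1 - i.1)) = pairProd fun i _ => u (τ i) :=
    (pairProd_left fun i => u (τ i)).symm
  change _ = _ * ((∏ i, u i ^ (N - 1 - i.1)) * ∏ i, u (τ i) ^ (N - 1 - i.1))
  rw [hleft, hright, sign_eq_pairProd, koszul_eq_pairProd, koszul_eq_pairProd, ← pairProd_mul,
    ← pairProd_mul, ← pairProd_mul]
  refine pairProd_congr fun i j hij => ?_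
  rcases lt_or_gt_of_ne (τ.injective.ne hij.ne) with h | h
  · simp [inversionSign, h.not_gt, w, h.le, Int.units_mul_self]
  · have e : (x (τ i) + 1) * (x (τ j) + 1) = 1 + x (τ i) * x (τ j) + (x (τ j) + x (τ i)) := by ring
    simp only [inversionSign, h, w, min_eq_right h.le, if_true, u, e, zpow_add, zpow_one]

theorem koszul_swap {N : ℕ} (i : Fin N) (x : Fin (N + 1) → ℤ) :
    koszul (Equiv.swap i.castSucc i.succ) x = (-1) ^ (x i.castSucc * x i.succ) := by
  have inversion_iff : ∀ a b : Fin (N + 1), (a < b ∧ Equiv.swap i.castSucc i.succ b <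
      Equiv.swap i.castSucc i.succ a) ↔ (a = i.castSucc ∧ b = i.succ) := by
    intro a b
    constructor
    · rintro ⟨h1, h2⟩
      rw [Equiv.swap_apply_def, Equiv.swap_apply_def] at h2
      split_ifs at h2 <;>
        simp only [Fin.lt_def, Fin.ext_iff, Fin.val_castSucc, Fin.val_succ] at * <;> omega
    · rintro ⟨rfl, rfl⟩
      simp
  simp only [koszul, inversion_iff]
  rw [Finset.prod_eq_single i.castSucc, Finset.prod_eq_single i.succ]
  · simp [mul_comm]
  · intro b _ hb; simp [hb]
  · simp
  · intro b _ hb; simp [hb]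
  · simp

theorem koszul_update_sub {N : ℕ} (τ : Equiv.Perm (Fin N)) (y : Fin N → ℤ) (w : Fin N) (a : ℤ) :
    koszul τ (Function.update y (τ w) (y (τ w) - a)) = koszul τ y *
      ((∏ j, if w < j ∧ τ j < τ w then (-1 : ℤˣ) ^ (a * y (τ j)) else 1) *
        ∏ j, if j < w ∧ τ w < τ j then (-1 : ℤˣ) ^ (a * y (τ j)) else 1) := by
  set y' := Function.update y (τ w) (y (τ w) - a) with hy'
  have hne : ∀ j, j ≠ w → y' (τ j) = y (τ j) := fun j hj => by
    rw [hy', Function.update_of_ne (τ.injective.ne hj)]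
  have hself : y' (τ w) = y (τ w) - a := by rw [hy', Function.update_self]
  have hfactor : ∀ i j, (if i < j ∧ τ j < τ i then (-1 : ℤˣ) ^ (y' (τ i) * y' (τ j)) else 1) =
      (if i < j ∧ τ j < τ i then (-1 : ℤˣ) ^ (y (τ i) * y (τ j)) else 1) *
      ((if i = w then (if w < j ∧ τ j < τ w then (-1 : ℤˣ) ^ (a * y (τ j)) else 1) else 1) *
      (if j = w then (if i < w ∧ τ w < τ i then (-1 : ℤˣ) ^ (a * y (τ i)) else 1) else 1)) := by
    intro i j
    by_cases hi : i = w
    · subst hi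
      by_cases hj : j = i
      · subst hj; simp
      · rw [hself, hne j hj, if_pos rfl, if_neg hj, mul_one, sub_mul, neg_one_zpow_sub]
        by_cases h : i < j ∧ τ j < τ i <;> simp [h]
    · by_cases hj : j = w
      · subst hj
        rw [hself, hne i hi, if_pos rfl, if_neg hi, one_mul, mul_sub, neg_one_zpow_sub,
          mul_comm _ a]
        by_cases h : i < j ∧ τ j < τ i <;> simp [h]
      · simp [hi, hj, hne]
  simp only [koszul, hfactor, Finset.prod_mul_distrib]
  congr 2
  · rw [Finset.prod_eq_single w]
    · simp
    · intro b _ hb; simp [hb]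
    · simp
  · refine Finset.prod_congr rfl fun i _ => ?_
    rw [Finset.prod_ite_eq' Finset.univ w, if_pos (Finset.mem_univ _)]

/-- An operator of degree `-a` may be applied to the argument `τ w` before or after the
permutation `τ`; the two extra factors are the signs for moving it past the arguments before. -/
theorem koszul_update_sub_mul {N : ℕ} (τ : Equiv.Perm (Fin N)) (y : Fin N → ℤ) (w : Fin N)
    (a : ℤ) :
    koszul τ (Function.update y (τ w) (y (τ w) - a)) *
        (∏ u, if u < τ w then (-1 : ℤˣ) ^ (a * y u) else 1) =
      (∏ j, if j < w then (-1 : ℤˣ) ^ (a * y (τ j)) else 1) * koszul τ y := by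
  rw [koszul_update_sub, mul_assoc, mul_comm (koszul τ y)]
  congr 1
  rw [← Equiv.prod_comp τ (fun u => if u < τ w then (-1 : ℤˣ) ^ (a * y u) else 1),
    ← Finset.prod_mul_distrib, ← Finset.prod_mul_distrib]
  refine Finset.prod_congr rfl fun j _ => ?_
  rcases lt_trichotomy j w with h | rfl | h
  · rcases lt_or_gt_of_ne (τ.injective.ne h.ne) with h' | h' <;> simp [h, h', h.not_gt, h'.not_gt]
  · simp
  · rcases lt_or_gt_of_ne (τ.injective.ne h.ne) with h' | h' <;>
      simp [h, h', h.not_gt, h'.not_gt]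

/-! ### The graded algebra of functions -/

namespace NPDomain

variable {n : ℕ} (D : NPDomain n)

theorem tmul_mul_tmul (f f' : SmoothFun D.base) (y y' : MvPolynomial D.EvenCrd ℝ)
    (θ θ' : ExteriorAlgebra ℝ (D.OddCrd → ℝ)) :
    D.tmul f y θ * D.tmul f' y' θ' = D.tmul (f * f') (y * y') (θ * θ') :=
  (Algebra.TensorProduct.tmul_mul_tmul _ _ _ _).trans
    (congrArg (TensorProduct.tmul ℝ (f * f')) (Algebra.TensorProduct.tmul_mul_tmul _ _ _ _))

theorem one_eq_tmul : (1 : D.Fun) = D.tmul 1 1 1 := rfl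

@[elab_as_elim]
theorem fun_induction {motive : D.Fun → Prop} (F : D.Fun)
    (tmul : ∀ f y θ, motive (D.tmul f y θ)) (add : ∀ F G, motive F → motive G → motive (F + G)) :
    motive F := by
  have zero : motive 0 := by
    have h := tmul 0 0 0
    have h0 : D.tmul 0 0 0 = 0 := TensorProduct.zero_tmul _ _
    rwa [h0] at h
  refine TensorProduct.induction_on F zero (fun f z => ?_) (fun F G hF hG => add F G hF hG)
  refine TensorProduct.induction_on z ?_ (fun y θ => tmul f y θ) (fun z z' hz hz' => ?_)
  · rw [TensorProduct.tmul_zero]; exact zero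
  · rw [TensorProduct.tmul_add]; exact add _ _ hz hz'

theorem onBase_tmul (φ : Module.End ℝ (SmoothFun D.base)) (f y θ) :
    D.onBase φ (D.tmul f y θ) = D.tmul (φ f) y θ := rfl

theorem onEven_tmul (φ : Module.End ℝ (MvPolynomial D.EvenCrd ℝ)) (f y θ) :
    D.onEven φ (D.tmul f y θ) = D.tmul f (φ y) θ := rfl

theorem onOdd_tmul (φ : Module.End ℝ (ExteriorAlgebra ℝ (D.OddCrd → ℝ))) (f y θ) :
    D.onOdd φ (D.tmul f y θ) = D.tmul f y (φ θ) := rfl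

/-- `D.tmul` as a trilinear map. -/
def tmulHom : SmoothFun D.base →ₗ[ℝ] MvPolynomial D.EvenCrd ℝ →ₗ[ℝ]
    ExteriorAlgebra ℝ (D.OddCrd → ℝ) →ₗ[ℝ] D.Fun :=
  (LinearMap.llcomp ℝ _ _ _ ∘ₗ TensorProduct.mk ℝ _ _).compl₂ (TensorProduct.mk ℝ _ _)

theorem tmulHom_apply (f y θ) : D.tmulHom f y θ = D.tmul f y θ := rfl

theorem tmul_add_base (f f' y θ) : D.tmul (f + f') y θ = D.tmul f y θ + D.tmul f' y θ := by
  simp only [← tmulHom_apply, map_add, LinearMap.add_apply]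

theorem tmul_add_even (f y y' θ) : D.tmul f (y + y') θ = D.tmul f y θ + D.tmul f y' θ := by
  simp only [← tmulHom_apply, map_add, LinearMap.add_apply]

theorem tmul_add_odd (f y θ θ') : D.tmul f y (θ + θ') = D.tmul f y θ + D.tmul f y θ' :=
  map_add (D.tmulHom f y) θ θ'

theorem tmul_smul_even (c : ℝ) (f y θ) : D.tmul f (c • y) θ = c • D.tmul f y θ := by
  simp only [← tmulHom_apply, map_smul, LinearMap.smul_apply]

theorem tmul_smul_odd (c : ℝ) (f y θ) : D.tmul f y (c • θ) = c • D.tmul f y θ :=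
  map_smul (D.tmulHom f y) c θ

theorem parity_one : D.parity 1 = 1 := by
  rw [one_eq_tmul, parity, onOdd_tmul]
  simp

theorem parity_mul (F G : D.Fun) : D.parity (F * G) = D.parity F * D.parity G := by
  induction F using fun_induction with
  | add F F' h h' => simp only [add_mul, map_add, h, h']
  | tmul f y θ =>
    induction G using fun_induction with
    | add G G' h h' => simp only [mul_add, map_add, h, h']
    | tmul f' y' θ' =>
      rw [tmul_mul_tmul, parity, onOdd_tmul, onOdd_tmul, onOdd_tmul, tmul_mul_tmul]
      simp

theorem parity_mul_parity : D.parity * D.parity = 1 := by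
  refine LinearMap.ext fun F => ?_
  induction F using fun_induction with
  | add F F' h h' => rw [map_add, map_add, h, h']
  | tmul f y θ =>
    rw [Module.End.mul_apply, parity, onOdd_tmul, onOdd_tmul]
    simp

theorem parity_pow_even {k : ℕ} (hk : Even k) : D.parity ^ k = 1 := by
  obtain ⟨t, rfl⟩ := hk
  rw [← two_mul, pow_mul, pow_two, parity_mul_parity, one_pow]

theorem parity_pow_odd {k : ℕ} (hk : Odd k) : D.parity ^ k = D.parity := by
  obtain ⟨t, rfl⟩ := hk
  rw [pow_succ, parity_pow_even D (even_two_mul t), one_mul]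

theorem parity_pow_mul (k : ℕ) (F G : D.Fun) :
    (D.parity ^ k) (F * G) = (D.parity ^ k) F * (D.parity ^ k) G := by
  induction k with
  | zero => simp
  | succ k ih => simp only [pow_succ', Module.End.mul_apply, ih, parity_mul]

theorem parity_pow_one (k : ℕ) : (D.parity ^ k) 1 = 1 := by
  induction k with
  | zero => simp
  | succ k ih => rw [pow_succ', Module.End.mul_apply, ih, parity_one]

theorem deriv_mul (c : D.Crd) (F G : D.Fun) :
    D.deriv c (F * G) = D.deriv c F * G + (D.parity ^ c.deg) F * D.deriv c G := by
  induction F using fun_induction with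
  | add F F' h h' => simp only [add_mul, map_add, h, h']; abel
  | tmul f y θ =>
    induction G using fun_induction with
    | add G G' h h' => simp only [mul_add, map_add, h, h']; abel
    | tmul f' y' θ' =>
      rw [tmul_mul_tmul]
      unfold deriv
      split_ifs with h0 h
      · rw [h0, pow_zero, Module.End.one_apply, onBase_tmul, onBase_tmul, onBase_tmul,
          partialDeriv_mul, tmul_add_base, tmul_mul_tmul, tmul_mul_tmul]
      · rw [parity_pow_even D h, Module.End.one_apply, onEven_tmul, onEven_tmul, onEven_tmul,
          Derivation.coeFn_coe, Derivation.leibniz, add_comm, tmul_add_even, smul_eq_mul,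
          smul_eq_mul, mul_comm y', tmul_mul_tmul, tmul_mul_tmul]
      · rw [parity_pow_odd D (Nat.not_even_iff_odd.1 h), onOdd_tmul, onOdd_tmul, onOdd_tmul,
          contractLeft_mul, tmul_add_odd, parity, onOdd_tmul, tmul_mul_tmul, tmul_mul_tmul]
        rfl

theorem deriv_one (c : D.Crd) : D.deriv c 1 = 0 := by
  have h := D.deriv_mul c 1 1
  rw [parity_pow_one, mul_one, mul_one, one_mul] at h
  simpa using h

/-- The function `f(x) · y^a · θ_{l_1} ⋯ θ_{l_r}`; these functions span the homogeneous ones. -/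
def gen (f : SmoothFun D.base) (a : D.EvenCrd →₀ ℕ) (l : List D.OddCrd) : D.Fun :=
  D.tmul f (MvPolynomial.monomial a 1)
    (l.map fun c => ExteriorAlgebra.ι ℝ (Pi.single c (1 : ℝ))).prod

/-- The degree of `gen f a l`. -/
def genDeg (a : D.EvenCrd →₀ ℕ) (l : List D.OddCrd) : ℤ :=
  ((a.sum fun c e => e * c.1.deg : ℕ) + ((l.map fun c => c.1.deg).sum : ℕ) : ℤ)

theorem gen_mem (f a l) : D.gen f a l ∈ D.funGrading (D.genDeg a l) :=
  Submodule.subset_span ⟨f, a, l, rfl, rfl⟩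

@[elab_as_elim]
theorem funGrading_induction {k : ℤ} {motive : (F : D.Fun) → F ∈ D.funGrading k → Prop}
    (gen : ∀ f a l (h : D.genDeg a l = k), motive (D.gen f a l) (h ▸ D.gen_mem f a l))
    (zero : motive 0 (zero_mem _))
    (add : ∀ F G hF hG, motive F hF → motive G hG → motive (F + G) (add_mem hF hG))
    (smul : ∀ (c : ℝ) F hF, motive F hF → motive (c • F) (Submodule.smul_mem _ c hF))
    {F : D.Fun} (hF : F ∈ D.funGrading k) : motive F hF := by
  refine Submodule.span_induction ?_ zero add smul hF
  rintro _ ⟨f, a, l, h, rfl⟩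
  exact gen f a l h

theorem gen_mul_gen (f f' a a' l l') :
    D.gen f a l * D.gen f' a' l' = D.gen (f * f') (a + a') (l ++ l') := by
  rw [gen, gen, tmul_mul_tmul, gen, MvPolynomial.monomial_mul, one_mul, List.map_append,
    List.prod_append]

theorem genDeg_add (a a' l l') :
    D.genDeg (a + a') (l ++ l') = D.genDeg a l + D.genDeg a' l' := by
  classical
  simp only [genDeg, List.map_append, List.sum_append]
  rw [Finsupp.sum_add_index' (by simp) (by intros; ring)]
  push_cast
  ring

instance : SetLike.GradedMonoid D.funGrading where
  one_mem := by simpa [gen, genDeg, one_eq_tmul] using D.gen_mem 1 0 []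
  mul_mem {k k' F G} hF hG := by
    induction hF using funGrading_induction with
    | zero => simp
    | add F F' _ _ h h' => rw [add_mul]; exact add_mem h h'
    | smul c F _ h => rw [smul_mul_assoc]; exact Submodule.smul_mem _ _ h
    | gen f a l h =>
      induction hG using funGrading_induction with
      | zero => simp
      | add G G' _ _ h h' => rw [mul_add]; exact add_mem h h'
      | smul c G _ h => rw [mul_smul_comm]; exact Submodule.smul_mem _ _ h
      | gen f' a' l' h' =>
        rw [gen_mul_gen, ← h, ← h', ← genDeg_add]
        exact D.gen_mem _ _ _

theorem genDeg_cons (a : D.EvenCrd →₀ ℕ) (c : D.OddCrd) (l : List D.OddCrd) :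
    D.genDeg a (c :: l) = c.1.deg + D.genDeg a l := by
  simp only [genDeg, List.map_cons, List.sum_cons]
  push_cast
  ring

theorem even_genDeg_sub (a : D.EvenCrd →₀ ℕ) (l : List D.OddCrd) :
    Even (D.genDeg a l - l.length) := by
  induction l with
  | nil =>
    have h : Even (a.sum fun c e => e * c.1.deg) :=
      Finset.even_sum _ fun c _ => c.2.2.mul_left (a c)
    simpa only [genDeg, List.map_nil, List.sum_nil, List.length_nil, Nat.cast_zero, add_zero,
      sub_zero] using (Int.even_coe_nat _).2 h
  | cons c l ih =>
    have hc : Even ((c.1.deg : ℤ) - 1) := ((Int.odd_coe_nat _).2 c.2).sub_odd odd_one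
    have e : D.genDeg a (c :: l) - (c :: l).length =
        (c.1.deg - 1) + (D.genDeg a l - l.length) := by
      rw [genDeg_cons, List.length_cons]
      push_cast
      ring
    exact e ▸ hc.add ih

theorem neg_one_zpow_genDeg (a l) : (-1 : ℤˣ) ^ D.genDeg a l = (-1) ^ l.length :=
  (Int.negOnePow_eq_iff _ _).2 (D.even_genDeg_sub a l)

theorem parity_of_mem {k : ℤ} {F : D.Fun} (hF : F ∈ D.funGrading k) :
    D.parity F = ((-1 : ℤˣ) ^ k) • F := by
  induction hF using funGrading_induction with
  | zero => simp
  | add F F' _ _ h h' => rw [map_add, h, h', smul_add]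
  | smul c F _ h => rw [map_smul, h, smul_comm]
  | gen f a l h =>
    rw [← h, neg_one_zpow_genDeg, gen, parity, onOdd_tmul]
    have := CliffordAlgebra.involute_prod_map_ι (Q := (0 : QuadraticForm ℝ (D.OddCrd → ℝ)))
      (l.map fun c => Pi.single c (1 : ℝ))
    rw [List.map_map, List.length_map] at this
    refine (congrArg (D.tmul f _) this).trans ?_
    rw [tmul_smul_odd, ← neg_one_zpow_smul, zpow_natCast]
    rfl

theorem gen_mul_gen_comm (f f' a a' l l') :
    D.gen f a l * D.gen f' a' l' =
      (-1 : ℤˣ) ^ (D.genDeg a l * D.genDeg a' l') • (D.gen f' a' l' * D.gen f a l) := by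
  have hsign : (-1 : ℤˣ) ^ (D.genDeg a l * D.genDeg a' l') = (-1) ^ (l.length * l'.length) := by
    rw [zpow_mul, neg_one_zpow_genDeg, ← zpow_natCast, ← zpow_mul, mul_comm (l.length : ℤ),
      zpow_mul, neg_one_zpow_genDeg, zpow_natCast, ← pow_mul, mul_comm l'.length]
  have hι := prod_map_ι_mul_prod_map_ι (R := ℝ)
    (l.map fun c => (Pi.single c (1 : ℝ) : D.OddCrd → ℝ))
    (l'.map fun c => (Pi.single c (1 : ℝ) : D.OddCrd → ℝ))
  simp only [List.map_map, List.length_map, Function.comp_def] at hι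
  rw [hsign, gen, gen, tmul_mul_tmul, tmul_mul_tmul, mul_comm f',
    mul_comm (MvPolynomial.monomial a' _), hι, tmul_smul_odd, ← neg_one_zpow_smul, zpow_natCast]

theorem mul_comm_of_mem {k k' : ℤ} {F G : D.Fun} (hF : F ∈ D.funGrading k)
    (hG : G ∈ D.funGrading k') : F * G = ((-1 : ℤˣ) ^ (k * k')) • (G * F) := by
  induction hF using funGrading_induction with
  | zero => simp
  | add F F' _ _ h h' => rw [add_mul, mul_add, h, h', smul_add]
  | smul c F _ h => rw [smul_mul_assoc, mul_smul_comm, h, smul_comm]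
  | gen f a l h =>
    induction hG using funGrading_induction with
    | zero => simp
    | add G G' _ _ h h' => rw [add_mul, mul_add, h, h', smul_add]
    | smul c G _ h => rw [smul_mul_assoc, mul_smul_comm, h, smul_comm]
    | gen f' a' l' h' => rw [← h, ← h', gen_mul_gen_comm]

theorem onEven_pderiv_gen_mem (f : SmoothFun D.base) (a : D.EvenCrd →₀ ℕ) (l : List D.OddCrd)
    (c : D.EvenCrd) :
    D.onEven (MvPolynomial.pderiv (R := ℝ) c).toLinearMap (D.gen f a l) ∈
      D.funGrading (D.genDeg a l - c.1.deg) := by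
  rw [gen, onEven_tmul, Derivation.coeFn_coe, MvPolynomial.pderiv_monomial, one_mul]
  have hm : MvPolynomial.monomial (a - Finsupp.single c 1) ((a c : ℕ) : ℝ) =
      (a c : ℝ) • MvPolynomial.monomial (a - Finsupp.single c 1) (1 : ℝ) := by
    rw [MvPolynomial.smul_monomial, smul_eq_mul, mul_one]
  rw [hm, tmul_smul_even]
  by_cases hc : a c = 0
  · rw [hc, Nat.cast_zero, zero_smul]
    exact zero_mem _
  · have ha : a - Finsupp.single c 1 + Finsupp.single c 1 = a :=
      tsub_add_cancel_of_le (Finsupp.single_le_iff.2 (Nat.one_le_iff_ne_zero.2 hc))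
    have hd : D.genDeg a l - c.1.deg = D.genDeg (a - Finsupp.single c 1) l := by
      have h := D.genDeg_add (a - Finsupp.single c 1) (Finsupp.single c 1) l []
      rw [ha, List.append_nil] at h
      rw [h]
      simp [genDeg]
    rw [hd]
    exact Submodule.smul_mem _ _ (D.gen_mem _ _ _)

theorem onOdd_contractLeft_gen_cons (f : SmoothFun D.base) (a : D.EvenCrd →₀ ℕ)
    (φ : Module.Dual ℝ (D.OddCrd → ℝ)) (v : D.OddCrd) (l : List D.OddCrd) :
    D.onOdd (CliffordAlgebra.contractLeft (Q := (0 : QuadraticForm ℝ (D.OddCrd → ℝ))) φ)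
        (D.gen f a (v :: l)) =
      φ (Pi.single v 1) • D.gen f a l -
        D.gen 1 0 [v] * D.onOdd (CliffordAlgebra.contractLeft
          (Q := (0 : QuadraticForm ℝ (D.OddCrd → ℝ))) φ) (D.gen f a l) := by
  have h := CliffordAlgebra.contractLeft_ι_mul (Q := (0 : QuadraticForm ℝ (D.OddCrd → ℝ)))
    φ (Pi.single v (1 : ℝ)) (l.map fun c => ExteriorAlgebra.ι ℝ (Pi.single c (1 : ℝ))).prod
  have hv : D.gen 1 0 [v] = D.tmul 1 1 (ExteriorAlgebra.ι ℝ (Pi.single v (1 : ℝ))) := by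
    simp [gen]
  rw [hv, gen, gen, onOdd_tmul, onOdd_tmul, tmul_mul_tmul, one_mul, one_mul, ← tmul_smul_odd]
  exact (congrArg (D.tmulHom f _) h).trans (map_sub (D.tmulHom f _) _ _)

theorem onOdd_contractLeft_gen_mem (f : SmoothFun D.base) (a : D.EvenCrd →₀ ℕ)
    (l : List D.OddCrd) (c : D.OddCrd) :
    D.onOdd (CliffordAlgebra.contractLeft (Q := (0 : QuadraticForm ℝ (D.OddCrd → ℝ)))
        (LinearMap.proj c)) (D.gen f a l) ∈ D.funGrading (D.genDeg a l - c.1.deg) := by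
  induction l with
  | nil =>
    have h := CliffordAlgebra.contractLeft_one (Q := (0 : QuadraticForm ℝ (D.OddCrd → ℝ)))
      (LinearMap.proj c)
    have hzero : D.onOdd (CliffordAlgebra.contractLeft
        (Q := (0 : QuadraticForm ℝ (D.OddCrd → ℝ))) (LinearMap.proj c)) (D.gen f a []) = 0 :=
      (congrArg (D.tmulHom f _) h).trans (map_zero (D.tmulHom f _))
    rw [hzero]
    exact zero_mem _
  | cons v l ih =>
    rw [onOdd_contractLeft_gen_cons]
    refine sub_mem ?_ ?_
    · by_cases hvc : c = v
      · subst hvc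
        rw [genDeg_cons, add_sub_cancel_left]
        exact Submodule.smul_mem _ _ (D.gen_mem f a l)
      · rw [LinearMap.proj_apply, Pi.single_eq_of_ne hvc, zero_smul]
        exact zero_mem _
    · have hv : D.genDeg 0 [v] = v.1.deg := by simp [genDeg]
      rw [genDeg_cons, ← hv, add_sub_assoc]
      exact SetLike.mul_mem_graded (D.gen_mem 1 0 [v]) ih

theorem deriv_mem {k : ℤ} {F : D.Fun} (hF : F ∈ D.funGrading k) (c : D.Crd) :
    D.deriv c F ∈ D.funGrading (k - c.deg) := by
  induction hF using funGrading_induction with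
  | zero => simp
  | add F F' _ _ h h' => rw [map_add]; exact add_mem h h'
  | smul r F _ h => rw [map_smul]; exact Submodule.smul_mem _ _ h
  | gen f a l h =>
    subst h
    unfold deriv
    split_ifs with h0 h
    · rw [gen, onBase_tmul, h0, Nat.cast_zero, sub_zero]
      exact D.gen_mem _ _ _
    · exact D.onEven_pderiv_gen_mem f a l ⟨c, h0, h⟩
    · exact D.onOdd_contractLeft_gen_mem f a l ⟨c, Nat.not_even_iff_odd.1 h⟩

end NPDomain

/-! ### Tensor operators and the action of graphs -/

namespace NPDomain

variable {n : ℕ} (D : NPDomain n)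

theorem parity_pow_of_mem {k : ℤ} {F : D.Fun} (hF : F ∈ D.funGrading k) (a : ℕ) :
    (D.parity ^ a) F = ((-1 : ℤˣ) ^ (a * k)) • F := by
  induction a with
  | zero => simp
  | succ a ih =>
    rw [pow_succ', Module.End.mul_apply, ih, LinearMap.map_smul_of_tower, D.parity_of_mem hF,
      smul_smul, ← zpow_add]
    congr 2
    push_cast
    ring

theorem slotDeriv_tprod {N : ℕ} (a : D.Crd) (i : Fin N) (y : Fin N → ℤ) (f : Fin N → D.Fun)
    (hf : ∀ u, f u ∈ D.funGrading (y u)) :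
    D.slotDeriv a i (PiTensorProduct.tprod ℝ f) =
      (∏ u, if u < i then (-1 : ℤˣ) ^ (a.deg * y u) else 1) •
        PiTensorProduct.tprod ℝ (Function.update f i (D.deriv a (f i))) := by
  rw [slotDeriv, PiTensorProduct.map_tprod, ← multilinearMap_units_smul]
  congr 1
  funext u
  rcases lt_trichotomy u i with h | rfl | h
  · simp only [h, if_true, Function.update_of_ne h.ne]
    exact D.parity_pow_of_mem (hf u) a.deg
  · simp
  · simp [h.not_gt, h.ne']

theorem update_deriv_mem {N : ℕ} (a : D.Crd) (i : Fin N) (y : Fin N → ℤ) (f : Fin N → D.Fun)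
    (hf : ∀ u, f u ∈ D.funGrading (y u)) (u : Fin N) :
    Function.update f i (D.deriv a (f i)) u ∈
      D.funGrading (Function.update y i (y i - a.deg) u) := by
  by_cases h : u = i
  · subst h
    simpa using D.deriv_mem (hf u) a
  · simpa [h] using hf u

/-- The tensors of total degree `e`. -/
def tensorGrading (N : ℕ) (e : ℤ) : Submodule ℝ (⨂[ℝ] _ : Fin N, D.Fun) :=
  Submodule.span ℝ {t | ∃ (y : Fin N → ℤ) (f : Fin N → D.Fun),
    (∀ u, f u ∈ D.funGrading (y u)) ∧ ∑ u, y u = e ∧ t = PiTensorProduct.tprod ℝ f}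

theorem tprod_mem_tensorGrading {N : ℕ} (y : Fin N → ℤ) (f : Fin N → D.Fun)
    (hf : ∀ u, f u ∈ D.funGrading (y u)) :
    PiTensorProduct.tprod ℝ f ∈ D.tensorGrading N (∑ u, y u) :=
  Submodule.subset_span ⟨y, f, hf, rfl, rfl⟩

theorem slotDeriv_mem {N : ℕ} {e : ℤ} {t : ⨂[ℝ] _ : Fin N, D.Fun} (ht : t ∈ D.tensorGrading N e)
    (a : D.Crd) (i : Fin N) : D.slotDeriv a i t ∈ D.tensorGrading N (e - a.deg) := by
  revert t
  change D.tensorGrading N e ≤ (D.tensorGrading N (e - a.deg)).comap (D.slotDeriv a i)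
  refine Submodule.span_le.2 ?_
  rintro _ ⟨y, f, hf, rfl, rfl⟩
  change D.slotDeriv a i _ ∈ D.tensorGrading N _
  rw [D.slotDeriv_tprod a i y f hf, Units.smul_def]
  have hsum : ∑ u, Function.update y i (y i - a.deg) u = ∑ u, y u - a.deg := by
    rw [Finset.sum_update_of_mem (Finset.mem_univ _),
      ← Finset.add_sum_erase Finset.univ y (Finset.mem_univ i), Finset.sdiff_singleton_eq_erase]
    ring
  rw [← hsum]
  exact zsmul_mem (D.tprod_mem_tensorGrading _ _ (D.update_deriv_mem a i y f hf)) _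

theorem edgeOp_mem {N : ℕ} {e : ℤ} {t : ⨂[ℝ] _ : Fin N, D.Fun} (ht : t ∈ D.tensorGrading N e)
    (i j : Fin N) : D.edgeOp i j t ∈ D.tensorGrading N (e - n) := by
  simp only [edgeOp, LinearMap.sum_apply, LinearMap.smul_apply, Module.End.mul_apply]
  refine sum_mem fun a _ => sum_mem fun b _ => ?_
  by_cases h : D.pairing a b = 0
  · rw [h, zero_smul]; exact zero_mem _
  · have := D.slotDeriv_mem (D.slotDeriv_mem ht b j) a i
    have hd : (n : ℤ) = b.deg + a.deg := by
      rw [← Nat.cast_add, add_comm, D.pairing_deg a b h]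
    rw [hd, ← sub_sub]
    exact Submodule.smul_mem _ _ this

theorem mulMap_tprod {N : ℕ} (f : Fin N → D.Fun) :
    D.mulMap N (PiTensorProduct.tprod ℝ f) = (List.ofFn f).prod := by
  simp [mulMap]

theorem mulMap_mem {N : ℕ} {e : ℤ} {t : ⨂[ℝ] _ : Fin N, D.Fun} (ht : t ∈ D.tensorGrading N e) :
    D.mulMap N t ∈ D.funGrading e := by
  revert t
  change D.tensorGrading N e ≤ (D.funGrading e).comap (D.mulMap N)
  refine Submodule.span_le.2 ?_
  rintro _ ⟨y, f, hf, rfl, rfl⟩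
  change D.mulMap N _ ∈ D.funGrading _
  rw [mulMap_tprod]
  rw [← List.sum_ofFn]
  exact SetLike.list_prod_ofFn_mem_graded y f hf

theorem prod_edgeOp_mem {N k : ℕ} (G : Multidigraph N k) {e : ℤ} {t : ⨂[ℝ] _ : Fin N, D.Fun}
    (ht : t ∈ D.tensorGrading N e) :
    (List.ofFn fun e => D.edgeOp (G e).1 (G e).2).prod t ∈ D.tensorGrading N (e - n * k) := by
  induction k with
  | zero => simpa using ht
  | succ k ih =>
    rw [List.ofFn_succ, List.prod_cons, Module.End.mul_apply]
    have := D.edgeOp_mem (ih (fun i => G i.succ)) (G 0).1 (G 0).2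
    convert this using 2
    push_cast; ring

theorem rep_mk {N k : ℕ} (G : Multidigraph N k) : D.rep (Gra.mk _ G) = D.repGraph G := by
  simp [rep, Gra.lift, Gra.mk]

theorem repGraph_apply {N k : ℕ} (G : Multidigraph N k) (f : Fin N → D.Fun) :
    D.repGraph G f = D.mulMap N
      ((List.ofFn fun e => D.edgeOp (G e).1 (G e).2).prod (PiTensorProduct.tprod ℝ f)) := rfl

end NPDomain

@[elab_as_elim]
theorem Gra.induction {d : ℤ} {N k : ℕ} {motive : Gra d N k → Prop} (γ : Gra d N k)
    (mk : ∀ G, motive (Gra.mk d G)) (add : ∀ a b, motive a → motive b → motive (a + b))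
    (smul : ∀ (c : ℝ) a, motive a → motive (c • a)) (zero : motive 0) : motive γ := by
  obtain ⟨w, rfl⟩ := Submodule.mkQ_surjective _ γ
  induction w using Finsupp.induction_linear with
  | zero => rw [map_zero]; exact zero
  | add a b ha hb => rw [map_add]; exact add _ _ ha hb
  | single G c =>
    rw [← mul_one c, ← smul_eq_mul, ← Finsupp.smul_single, map_smul]
    exact smul _ _ (mk G)

theorem Gra.act_mk (d : ℤ) {N k : ℕ} (σ : Equiv.Perm (Fin N)) (G : Multidigraph N k) :
    Gra.act d σ (Gra.mk d G) = Gra.mk d (relabel σ G) := by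
  simp [act, Gra.lift, Gra.mk]

namespace NPDomain

variable {n : ℕ} (D : NPDomain n)

theorem rep_mem {N k : ℕ} (γ : Gra ((n : ℤ) + 1) N k) (y : Fin N → ℤ) (f : Fin N → D.Fun)
    (hf : ∀ u, f u ∈ D.funGrading (y u)) : D.rep γ f ∈ D.funGrading (∑ u, y u - n * k) := by
  induction γ using Gra.induction with
  | zero => simp
  | add a b ha hb => rw [map_add, add_apply]; exact add_mem ha hb
  | smul c a ha => rw [map_smul, smul_apply]; exact Submodule.smul_mem _ _ ha
  | mk G =>
    rw [rep_mk, repGraph_apply]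
    exact D.mulMap_mem (D.prod_edgeOp_mem G (D.tprod_mem_tensorGrading y f hf))

/-- Pairs of tensors that are related by the graded permutation `τ` of the factors. -/
def permRel {N : ℕ} (τ : Equiv.Perm (Fin N)) :
    Submodule ℝ ((⨂[ℝ] _ : Fin N, D.Fun) × (⨂[ℝ] _ : Fin N, D.Fun)) :=
  Submodule.span ℝ {t | ∃ (y : Fin N → ℤ) (f : Fin N → D.Fun),
    (∀ u, f u ∈ D.funGrading (y u)) ∧
      t = (PiTensorProduct.tprod ℝ f, koszul τ y • PiTensorProduct.tprod ℝ (f ∘ τ))}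

theorem tprod_mem_permRel {N : ℕ} (τ : Equiv.Perm (Fin N)) (y : Fin N → ℤ) (f : Fin N → D.Fun)
    (hf : ∀ u, f u ∈ D.funGrading (y u)) :
    (PiTensorProduct.tprod ℝ f, koszul τ y • PiTensorProduct.tprod ℝ (f ∘ τ)) ∈ D.permRel τ :=
  Submodule.subset_span ⟨y, f, hf, rfl⟩

theorem slotDeriv_permRel {N : ℕ} (τ : Equiv.Perm (Fin N)) (a : D.Crd) (w : Fin N)
    {t : (⨂[ℝ] _ : Fin N, D.Fun) × (⨂[ℝ] _ : Fin N, D.Fun)} (ht : t ∈ D.permRel τ) :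
    (D.slotDeriv a (τ w) t.1, D.slotDeriv a w t.2) ∈ D.permRel τ := by
  revert t
  change D.permRel τ ≤ (D.permRel τ).comap
    (LinearMap.prodMap (D.slotDeriv a (τ w)) (D.slotDeriv a w))
  refine Submodule.span_le.2 ?_
  rintro _ ⟨y, f, hf, rfl⟩
  change (D.slotDeriv a (τ w) (PiTensorProduct.tprod ℝ f),
    D.slotDeriv a w (koszul τ y • PiTensorProduct.tprod ℝ (f ∘ τ))) ∈ D.permRel τ
  have hupdate : Function.update (f ∘ τ) w (D.deriv a ((f ∘ τ) w)) =
      Function.update f (τ w) (D.deriv a (f (τ w))) ∘ τ :=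
    (Function.update_comp_eq_of_injective f τ.injective w _).symm
  rw [LinearMap.map_smul_of_tower, D.slotDeriv_tprod a (τ w) y f hf,
    D.slotDeriv_tprod a w (y ∘ τ) (f ∘ τ) (fun u => hf (τ u)), smul_smul, hupdate,
    mul_comm (koszul τ y)]
  simp only [Function.comp_apply]
  rw [← koszul_update_sub_mul τ y w a.deg, mul_comm (koszul τ _), mul_smul]
  exact zsmul_mem (D.tprod_mem_permRel τ _ _ (D.update_deriv_mem a (τ w) y f hf))
    ((∏ u, if u < τ w then (-1 : ℤˣ) ^ (a.deg * y u) else 1 : ℤˣ) : ℤ)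

theorem edgeOp_permRel {N : ℕ} (τ : Equiv.Perm (Fin N)) (v w : Fin N)
    {t : (⨂[ℝ] _ : Fin N, D.Fun) × (⨂[ℝ] _ : Fin N, D.Fun)} (ht : t ∈ D.permRel τ) :
    (D.edgeOp (τ v) (τ w) t.1, D.edgeOp v w t.2) ∈ D.permRel τ := by
  have h : (D.edgeOp (τ v) (τ w) t.1, D.edgeOp v w t.2) = ∑ a : D.Crd, ∑ b : D.Crd,
      D.pairing a b • (D.slotDeriv a (τ v) (D.slotDeriv b (τ w) t.1),
        D.slotDeriv a v (D.slotDeriv b w t.2)) := by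
    ext1 <;> simp [edgeOp, LinearMap.sum_apply, Prod.fst_sum, Prod.snd_sum]
  rw [h]
  exact sum_mem fun a _ => sum_mem fun b _ => Submodule.smul_mem _ _
    (D.slotDeriv_permRel τ a v (D.slotDeriv_permRel τ b w ht))

theorem prod_edgeOp_permRel {N k : ℕ} (τ : Equiv.Perm (Fin N)) (G : Multidigraph N k)
    {t : (⨂[ℝ] _ : Fin N, D.Fun) × (⨂[ℝ] _ : Fin N, D.Fun)} (ht : t ∈ D.permRel τ) :
    ((List.ofFn fun e => D.edgeOp (τ (G e).1) (τ (G e).2)).prod t.1,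
      (List.ofFn fun e => D.edgeOp (G e).1 (G e).2).prod t.2) ∈ D.permRel τ := by
  induction k with
  | zero => simpa using ht
  | succ k ih =>
    rw [List.ofFn_succ, List.prod_cons, List.ofFn_succ, List.prod_cons]
    exact D.edgeOp_permRel τ _ _ (ih fun i => G i.succ)

end NPDomain

theorem prod_ofFn_comp_swap {R A : Type*} [Monoid A] [SMul R A] [IsScalarTower R A A]
    [SMulCommClass R A A] (ε : R) {k : ℕ} (i : Fin k) (g : Fin (k + 1) → A)
    (hg : g i.succ * g i.castSucc = ε • (g i.castSucc * g i.succ)) :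
    (List.ofFn (g ∘ Equiv.swap i.castSucc i.succ)).prod = ε • (List.ofFn g).prod := by
  induction k with
  | zero => exact i.elim0
  | succ k ih =>
    induction i using Fin.cases with
    | zero =>
      have h2 : ∀ x : Fin k, Equiv.swap (0 : Fin (k + 2)) 1 x.succ.succ = x.succ.succ := by
        intro x
        refine Equiv.swap_apply_of_ne_of_ne (Fin.succ_ne_zero _) ?_
        intro h
        exact Fin.succ_ne_zero x (Fin.succ_injective _ (by simpa using h))
      simp only [Fin.castSucc_zero, Fin.succ_zero_eq_one] at hg
      simp only [List.ofFn_succ, List.prod_cons, Function.comp_apply, Fin.castSucc_zero,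
        Fin.succ_zero_eq_one, Equiv.swap_apply_left, Equiv.swap_apply_right, h2]
      rw [← mul_assoc, hg, smul_mul_assoc, mul_assoc]
    | succ i =>
      have h0 : Equiv.swap i.succ.castSucc i.succ.succ (0 : Fin (k + 2)) = 0 := by
        refine Equiv.swap_apply_of_ne_of_ne ?_ (Fin.succ_ne_zero _).symm
        rw [Fin.castSucc_succ]
        exact (Fin.succ_ne_zero _).symm
      have h1 : ∀ x : Fin (k + 1), Equiv.swap i.succ.castSucc i.succ.succ x.succ =
          (Equiv.swap i.castSucc i.succ x).succ := by
        intro x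
        rw [Fin.castSucc_succ]
        exact (Fin.succ_injective _).swap_apply _ _ _
      have := ih i (fun x => g x.succ) hg
      rw [List.ofFn_succ, List.prod_cons, List.ofFn_succ (f := g), List.prod_cons]
      simp only [Function.comp_apply, h0, h1]
      simp only [Function.comp_def] at this
      rw [this, mul_smul_comm]

namespace NPDomain

variable {n : ℕ} (D : NPDomain n)

theorem prod_ofFn_comp_perm {N : ℕ} (τ : Equiv.Perm (Fin N)) (y : Fin N → ℤ) (f : Fin N → D.Fun)
    (hf : ∀ u, f u ∈ D.funGrading (y u)) :
    (List.ofFn (f ∘ τ)).prod = koszul τ y • (List.ofFn f).prod := by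
  rcases N with _ | N
  · have : τ = 1 := Subsingleton.elim _ _
    subst this
    simp [koszul_one]
  · have hτ : τ ∈ Submonoid.closure
        (Set.range fun i : Fin N => Equiv.swap i.castSucc i.succ) := by
      rw [Equiv.Perm.mclosure_swap_castSucc_succ]; trivial
    induction hτ using Submonoid.closure_induction_right with
    | one => simp [koszul_one]
    | mul_right τ _ s hs ih =>
      obtain ⟨i, rfl⟩ := hs
      rw [Equiv.Perm.coe_mul, ← Function.comp_assoc,
        prod_ofFn_comp_swap ((-1 : ℤˣ) ^ (y (τ i.castSucc) * y (τ i.succ))), ih, koszul_mul,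
        koszul_swap, smul_smul]
      · rfl
      · rw [mul_comm (y _)]
        exact D.mul_comm_of_mem (hf _) (hf _)

theorem mulMap_permRel {N : ℕ} (τ : Equiv.Perm (Fin N))
    {t : (⨂[ℝ] _ : Fin N, D.Fun) × (⨂[ℝ] _ : Fin N, D.Fun)} (ht : t ∈ D.permRel τ) :
    D.mulMap N t.1 = D.mulMap N t.2 := by
  revert t
  change D.permRel τ ≤ LinearMap.eqLocus (D.mulMap N ∘ₗ LinearMap.fst ℝ _ _)
    (D.mulMap N ∘ₗ LinearMap.snd ℝ _ _)
  refine Submodule.span_le.2 ?_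
  rintro _ ⟨y, f, hf, rfl⟩
  change D.mulMap N (PiTensorProduct.tprod ℝ f) =
    D.mulMap N (koszul τ y • PiTensorProduct.tprod ℝ (f ∘ τ))
  rw [LinearMap.map_smul_of_tower, mulMap_tprod, mulMap_tprod, D.prod_ofFn_comp_perm τ y f hf,
    smul_smul, Int.units_mul_self, one_smul]

theorem rep_act {N k : ℕ} (σ : Equiv.Perm (Fin N)) (γ : Gra ((n : ℤ) + 1) N k) (y : Fin N → ℤ)
    (f : Fin N → D.Fun) (hf : ∀ u, f u ∈ D.funGrading (y u)) :
    D.rep (Gra.act _ σ γ) f = koszul σ⁻¹ y • D.rep γ (f ∘ ⇑σ⁻¹) := by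
  induction γ using Gra.induction with
  | zero => simp
  | add a b ha hb => simp only [map_add, add_apply, ha, hb, smul_add]
  | smul c a ha => simp only [map_smul, smul_apply, ha, smul_comm c]
  | mk G =>
    rw [Gra.act_mk, rep_mk, rep_mk, repGraph_apply, repGraph_apply, ← LinearMap.map_smul_of_tower,
      ← LinearMap.map_smul_of_tower]
    exact D.mulMap_permRel σ⁻¹
      (D.prod_edgeOp_permRel σ⁻¹ G (D.tprod_mem_permRel σ⁻¹ y f hf))

end NPDomain

/-! ### Graph insertion -/

theorem apply_prod_ofFn_of_leibniz {A : Type*} [Semiring A] (D P : A → A) (Q : A →* A)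
    (hD : ∀ x y, D (x * y) = D x * Q y + P x * D y) (hD1 : D 1 = 0) {N : ℕ} (t : Fin N → A) :
    D (List.ofFn t).prod = ∑ v, (List.ofFn fun w =>
      if w < v then P (t w) else if w = v then D (t w) else Q (t w)).prod := by
  induction N with
  | zero => simpa using hD1
  | succ N ih =>
    rw [List.ofFn_succ, List.prod_cons, hD, ih, map_list_prod, List.map_ofFn, Fin.sum_univ_succ,
      Finset.mul_sum]
    congr 1
    · simp [List.ofFn_succ, Fin.succ_ne_zero, Function.comp_def]
    · refine Finset.sum_congr rfl fun v _ => ?_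
      rw [List.ofFn_succ, List.prod_cons]
      simp [Fin.succ_pos]

theorem prod_ofFn_eq_single {A : Type*} [Monoid A] {N : ℕ} (x : Fin N → A) (t : Fin N)
    (h : ∀ v, v ≠ t → x v = 1) : (List.ofFn x).prod = x t := by
  induction N with
  | zero => exact t.elim0
  | succ N ih =>
    rw [List.ofFn_succ, List.prod_cons]
    induction t using Fin.cases with
    | zero =>
      have : (fun i : Fin N => x i.succ) = fun _ => 1 := funext fun i => h _ (Fin.succ_ne_zero i)
      simp [this]
    | succ t =>
      rw [h 0 (Fin.succ_ne_zero t).symm, one_mul]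
      exact ih (fun i => x i.succ) t fun v hv => h _ fun hh => hv (Fin.succ_injective _ hh)

theorem prod_ofFn_eq_one {A : Type*} [Monoid A] {N : ℕ} {x : Fin N → A} (h : ∀ v, x v = 1) :
    (List.ofFn x).prod = 1 :=
  List.prod_eq_one (List.forall_mem_ofFn_iff.2 h)

theorem prod_ofFn_split {A : Type*} [Monoid A] {a b c : ℕ} (h : a + b = c) (x : Fin c → A) :
    (List.ofFn x).prod = (List.ofFn fun i : Fin a => x ⟨i.1, by omega⟩).prod *
      (List.ofFn fun i : Fin b => x ⟨a + i.1, by omega⟩).prod := by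
  subst h
  rw [List.ofFn_add, List.prod_append]
  rfl

namespace NPDomain

variable {n : ℕ} (D : NPDomain n)

/-- The linear map `f_1 ⊗ ⋯ ⊗ f_N ↦ g_1 ⊗ ⋯ ⊗ g_M`, where `g_i` is the product of the `f_v` with
`c v = i`. -/
def spread {N M : ℕ} (c : Fin N → Fin M) :
    (⨂[ℝ] _ : Fin N, D.Fun) →ₗ[ℝ] ⨂[ℝ] _ : Fin M, D.Fun :=
  PiTensorProduct.lift ((MultilinearMap.mkPiAlgebraFin ℝ N (⨂[ℝ] _ : Fin M, D.Fun)).compLinearMap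
    fun v => (PiTensorProduct.singleAlgHom (A := fun _ : Fin M => D.Fun) (c v)).toLinearMap)

/-- The tensor with `x` in the slot `i` and `1` in the other slots. -/
abbrev single {M : ℕ} (i : Fin M) (x : D.Fun) : ⨂[ℝ] _ : Fin M, D.Fun :=
  PiTensorProduct.tprod ℝ (Pi.mulSingle i x)

theorem spread_tprod {N M : ℕ} (c : Fin N → Fin M) (f : Fin N → D.Fun) :
    D.spread c (PiTensorProduct.tprod ℝ f) = (List.ofFn fun v => D.single (c v) (f v)).prod := by
  rw [spread, PiTensorProduct.lift.tprod, MultilinearMap.compLinearMap_apply,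
    MultilinearMap.mkPiAlgebraFin_apply]
  rfl

theorem spread_tprod_eq_tprod {N M : ℕ} (c : Fin N → Fin M) (f : Fin N → D.Fun) :
    D.spread c (PiTensorProduct.tprod ℝ f) = PiTensorProduct.tprod ℝ fun i =>
      (List.ofFn fun v => (Pi.mulSingle (c v) (f v) : Fin M → D.Fun) i).prod := by
  rw [spread_tprod]
  have h := map_list_prod (PiTensorProduct.tprodMonoidHom ℝ (A := fun _ : Fin M => D.Fun))
    (List.ofFn fun v => (Pi.mulSingle (c v) (f v) : Fin M → D.Fun))
  rw [List.map_ofFn] at h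
  refine h.symm.trans ?_
  change PiTensorProduct.tprod ℝ _ = _
  congr 1
  funext i
  have h' := map_list_prod (Pi.evalMonoidHom (fun _ : Fin M => D.Fun) i)
    (List.ofFn fun v => (Pi.mulSingle (c v) (f v) : Fin M → D.Fun))
  rw [List.map_ofFn] at h'
  exact h'

theorem map_single {M : ℕ} (φ : Fin M → Module.End ℝ D.Fun) (i : Fin M) (x : D.Fun)
    (h : ∀ j, j ≠ i → φ j 1 = 1) : PiTensorProduct.map φ (D.single i x) = D.single i (φ i x) := by
  rw [single, PiTensorProduct.map_tprod]
  congr 1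
  funext j
  by_cases hj : j = i
  · subst hj; simp
  · simp [hj, h j hj]

/-- The operators by which `slotDeriv a i` is a twisted derivation. -/
def slotParity {M : ℕ} (a : ℕ) (s : Fin M → Prop) [DecidablePred s] :
    Module.End ℝ (⨂[ℝ] _ : Fin M, D.Fun) :=
  PiTensorProduct.map fun j => if s j then D.parity ^ a else 1

theorem slotParity_mul {M : ℕ} (a : ℕ) (s : Fin M → Prop) [DecidablePred s]
    (t u : ⨂[ℝ] _ : Fin M, D.Fun) :
    D.slotParity a s (t * u) = D.slotParity a s t * D.slotParity a s u := by
  induction t using PiTensorProduct.induction_on with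
  | add t t' h h' => simp only [add_mul, map_add, h, h']
  | smul_tprod r f =>
    induction u using PiTensorProduct.induction_on with
    | add t t' h h' => simp only [mul_add, map_add, h, h']
    | smul_tprod r' f' =>
      simp only [smul_mul_assoc, mul_smul_comm, map_smul, PiTensorProduct.tprod_mul_tprod,
        slotParity, PiTensorProduct.map_tprod]
      congr 3
      funext j
      by_cases h : s j <;> simp [h, parity_pow_mul]

theorem slotParity_one {M : ℕ} (a : ℕ) (s : Fin M → Prop) [DecidablePred s] :
    D.slotParity a s 1 = 1 := by
  rw [PiTensorProduct.one_def, slotParity, PiTensorProduct.map_tprod]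
  congr 1
  funext j
  by_cases h : s j <;> simp [h, parity_pow_one]

theorem slotDeriv_mul {M : ℕ} (a : D.Crd) (i : Fin M) (t u : ⨂[ℝ] _ : Fin M, D.Fun) :
    D.slotDeriv a i (t * u) = D.slotDeriv a i t * D.slotParity a.deg (· < i) u +
      D.slotParity a.deg (· ≤ i) t * D.slotDeriv a i u := by
  induction t using PiTensorProduct.induction_on with
  | add t t' h h' => simp only [add_mul, map_add, h, h']; abel
  | smul_tprod r f =>
    induction u using PiTensorProduct.induction_on with
    | add t t' h h' => simp only [mul_add, map_add, h, h']; abel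
    | smul_tprod r' f' =>
      simp only [smul_mul_assoc, mul_smul_comm, map_smul, ← smul_add]
      congr 2
      simp only [slotDeriv, slotParity, PiTensorProduct.map_tprod, PiTensorProduct.tprod_mul_tprod]
      set g : Fin M → D.Fun := fun j =>
        (if j < i then D.parity ^ a.deg else if j = i then D.deriv a else 1) ((f * f') j) with hg
      have e1 : g = Function.update g i (D.deriv a (f i) * f' i +
          (D.parity ^ a.deg) (f i) * D.deriv a (f' i)) := by
        rw [← deriv_mul, eq_comm, Function.update_eq_self_iff]
        simp [hg]
      rw [e1, MultilinearMap.map_update_add]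
      congr 2
      · funext j
        rcases lt_trichotomy j i with h | rfl | h
        · simp [hg, h, h.ne, parity_pow_mul]
        · simp
        · simp [hg, h.not_gt, h.ne']
      · funext j
        rcases lt_trichotomy j i with h | rfl | h
        · simp [hg, h, h.ne, h.le, parity_pow_mul]
        · simp
        · simp [hg, h.not_gt, h.ne', h.not_ge]

theorem slotDeriv_one {M : ℕ} (a : D.Crd) (i : Fin M) :
    D.slotDeriv a i (1 : ⨂[ℝ] _ : Fin M, D.Fun) = 0 := by
  have h := D.slotDeriv_mul a i 1 1
  rw [slotParity_one, slotParity_one, mul_one, mul_one, one_mul] at h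
  simpa using h

theorem slotDeriv_single_of_ne {M : ℕ} (a : D.Crd) {i j : Fin M} (h : i ≠ j) (x : D.Fun) :
    D.slotDeriv a i (D.single j x) = 0 := by
  rw [slotDeriv, single, PiTensorProduct.map_tprod]
  exact (PiTensorProduct.tprod ℝ).map_coord_zero i (by simp [h, deriv_one])

theorem ite_parity_pow_one (s : Prop) [Decidable s] (a : ℕ) :
    (if s then D.parity ^ a else 1) (1 : D.Fun) = 1 := by
  split_ifs <;> simp [parity_pow_one]

theorem slotDeriv_single {M : ℕ} (a : D.Crd) (i : Fin M) (x : D.Fun) :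
    D.slotDeriv a i (D.single i x) = D.single i (D.deriv a x) := by
  refine (D.map_single _ _ _ fun j hj => ?_).trans (by simp)
  simp only [hj, if_false]
  exact D.ite_parity_pow_one _ _

theorem slotParity_single {M : ℕ} (a : ℕ) (s : Fin M → Prop) [DecidablePred s] (i : Fin M)
    (x : D.Fun) :
    D.slotParity a s (D.single i x) = D.single i ((if s i then D.parity ^ a else 1) x) :=
  D.map_single _ _ _ fun _ _ => D.ite_parity_pow_one _ _

theorem slotDeriv_prod_single {N M : ℕ} (c : Fin N → Fin M) (a : D.Crd) (i : Fin M)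
    (f : Fin N → D.Fun) :
    D.slotDeriv a i (List.ofFn fun v => D.single (c v) (f v)).prod =
      ∑ v, (List.ofFn fun w =>
        if w < v then D.slotParity a.deg (· ≤ i) (D.single (c w) (f w))
        else if w = v then D.slotDeriv a i (D.single (c w) (f w))
        else D.slotParity a.deg (· < i) (D.single (c w) (f w))).prod :=
  apply_prod_ofFn_of_leibniz (D.slotDeriv a i) (D.slotParity a.deg (· ≤ i))
    { toFun := D.slotParity a.deg (· < i)
      map_one' := D.slotParity_one _ _
      map_mul' := D.slotParity_mul _ _ }
    (D.slotDeriv_mul a i) (D.slotDeriv_one a i) _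

theorem slotDeriv_spread_tprod {N M : ℕ} (c : Fin N → Fin M) (hc : Monotone c) (a : D.Crd)
    (i : Fin M) (f : Fin N → D.Fun) :
    D.slotDeriv a i (D.spread c (PiTensorProduct.tprod ℝ f)) =
      ∑ v, if c v = i then D.spread c (D.slotDeriv a v (PiTensorProduct.tprod ℝ f)) else 0 := by
  rw [spread_tprod, slotDeriv_prod_single]
  refine Finset.sum_congr rfl fun v _ => ?_
  split_ifs with hv
  · rw [show D.slotDeriv a v (PiTensorProduct.tprod ℝ f) = _ from PiTensorProduct.map_tprod _ _,
      spread_tprod]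
    congr 2
    funext w
    rcases lt_trichotomy w v with h | rfl | h
    · rw [if_pos h, if_pos h, slotParity_single, if_pos (hv ▸ hc h.le)]
    · subst hv
      simp only [lt_irrefl, if_false, if_true, slotDeriv_single]
    · rw [if_neg h.not_gt, if_neg h.ne', if_neg h.not_gt, if_neg h.ne', slotParity_single,
        if_neg (not_lt.2 (hv ▸ hc h.le))]
  · refine List.prod_eq_zero (List.mem_ofFn.2 ⟨v, ?_⟩)
    simp only [lt_irrefl, if_false, if_true]
    exact D.slotDeriv_single_of_ne a (Ne.symm hv) _

theorem slotDeriv_spread {N M : ℕ} (c : Fin N → Fin M) (hc : Monotone c) (a : D.Crd) (i : Fin M)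
    (t : ⨂[ℝ] _ : Fin N, D.Fun) :
    D.slotDeriv a i (D.spread c t) =
      ∑ v, if c v = i then D.spread c (D.slotDeriv a v t) else 0 := by
  induction t using PiTensorProduct.induction_on with
  | add t t' h h' =>
    simp only [map_add, h, h', ← Finset.sum_add_distrib]
    refine Finset.sum_congr rfl fun v _ => ?_
    split_ifs <;> simp
  | smul_tprod r f =>
    simp only [map_smul, D.slotDeriv_spread_tprod c hc, Finset.smul_sum]
    refine Finset.sum_congr rfl fun v _ => ?_
    split_ifs <;> simp

theorem edgeOp_spread {N M : ℕ} (c : Fin N → Fin M) (hc : Monotone c) (i j : Fin M)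
    (t : ⨂[ℝ] _ : Fin N, D.Fun) :
    D.edgeOp i j (D.spread c t) =
      ∑ v : Fin N × Fin N,
        if (c v.1, c v.2) = (i, j) then D.spread c (D.edgeOp v.1 v.2 t) else 0 := by
  rw [Fintype.sum_prod_type]
  simp only [edgeOp, LinearMap.sum_apply, LinearMap.smul_apply, Module.End.mul_apply]
  have h : ∀ a b, D.slotDeriv a i (D.slotDeriv b j (D.spread c t)) = ∑ v, ∑ w,
      if (c v, c w) = (i, j) then D.spread c (D.slotDeriv a v (D.slotDeriv b w t)) else 0 := by
    intro a b
    rw [D.slotDeriv_spread c hc, map_sum, Finset.sum_comm]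
    refine Finset.sum_congr rfl fun w _ => ?_
    by_cases hw : c w = j
    · rw [if_pos hw, D.slotDeriv_spread c hc]
      simp [hw]
    · simp [hw]
  simp only [h, map_sum, map_smul, Finset.smul_sum, Prod.mk.injEq]
  rw [Finset.sum_congr rfl fun a _ => Finset.sum_comm, Finset.sum_comm]
  refine Finset.sum_congr rfl fun v _ => ?_
  rw [Finset.sum_congr rfl fun a _ => Finset.sum_comm, Finset.sum_comm]
  refine Finset.sum_congr rfl fun w _ => ?_
  split_ifs <;> simp

open Classical in
theorem prod_edgeOp_spread {N M k : ℕ} (c : Fin N → Fin M) (hc : Monotone c)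
    (G : Multidigraph M k) (t : ⨂[ℝ] _ : Fin N, D.Fun) :
    (List.ofFn fun e => D.edgeOp (G e).1 (G e).2).prod (D.spread c t) =
      ∑ E : Multidigraph N k, if ∀ e, (c (E e).1, c (E e).2) = G e then
        D.spread c ((List.ofFn fun e => D.edgeOp (E e).1 (E e).2).prod t) else 0 := by
  induction k with
  | zero => simp
  | succ k ih =>
    rw [List.ofFn_succ, List.prod_cons, Module.End.mul_apply, ih fun i => G i.succ, map_sum]
    rw [← (Fin.consEquiv fun _ => Fin N × Fin N).sum_comp, Fintype.sum_prod_type, Finset.sum_comm]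
    refine Finset.sum_congr rfl fun E _ => ?_
    by_cases hE : ∀ e, (c (E e).1, c (E e).2) = G e.succ
    · rw [if_pos hE, D.edgeOp_spread c hc]
      refine Finset.sum_congr rfl fun v _ => ?_
      simp [Fin.consEquiv, Fin.forall_fin_succ, hE, List.ofFn_succ]
    · rw [if_neg hE, map_zero]
      symm
      refine Finset.sum_eq_zero fun v _ => if_neg fun h => hE fun e => ?_
      simpa [Fin.consEquiv] using h e.succ

end NPDomain

theorem monotone_collapse {p q P : ℕ} (h : p + q = P) : Monotone (collapse h) := by
  intro v w hvw
  simp only [collapse, Fin.le_def] at hvw ⊢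
  omega

theorem monotone_embed {p q P : ℕ} (h : p + q = P) : Monotone (embed h) := fun _ _ hvw => hvw

theorem embed_injective {p q P : ℕ} (h : p + q = P) : Function.Injective (embed h) := by
  intro v w hvw
  simpa [embed, Fin.ext_iff] using hvw

/-- The last `p` entries of a tuple. -/
def tailArgs {p q P : ℕ} (h : p + q = P) {A : Type*} (f : Fin (P + 1) → A) : Fin p → A :=
  fun i => f ⟨q + 1 + i.1, by omega⟩

namespace NPDomain

variable {n : ℕ} (D : NPDomain n)

/-- The tensor `1 ⊗ ⋯ ⊗ 1 ⊗ f_{q + 1} ⊗ ⋯ ⊗ f_P`. -/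
def tailTensor {P : ℕ} (q : ℕ) (f : Fin (P + 1) → D.Fun) : ⨂[ℝ] _ : Fin (P + 1), D.Fun :=
  PiTensorProduct.tprod ℝ fun j => if j.1 < q + 1 then 1 else f j

theorem spread_embed_mul {p q P : ℕ} (h : p + q = P) (g : Fin (q + 1) → D.Fun)
    (f : Fin (P + 1) → D.Fun) :
    D.spread (embed h) (PiTensorProduct.tprod ℝ g) * D.tailTensor q f =
      PiTensorProduct.tprod ℝ fun j => if hj : j.1 < q + 1 then g ⟨j.1, hj⟩ else f j := by
  rw [spread_tprod_eq_tprod, tailTensor, PiTensorProduct.tprod_mul_tprod]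
  congr 1
  funext j
  by_cases hj : j.1 < q + 1
  · simp only [Pi.mul_apply, hj, if_true, dif_pos, mul_one]
    have e : j = embed h ⟨j.1, hj⟩ := rfl
    rw [prod_ofFn_eq_single _ ⟨j.1, hj⟩]
    · rw [← e, Pi.mulSingle_eq_same]
    · intro v hv
      rw [e]
      exact Pi.mulSingle_eq_of_ne (fun hh => hv (embed_injective h hh).symm) _
  · simp only [Pi.mul_apply, hj, if_false, dif_neg, not_false_eq_true]
    rw [prod_ofFn_eq_one, one_mul]
    intro v
    refine Pi.mulSingle_eq_of_ne (fun hh => hj ?_) _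
    rw [hh]
    exact v.2

theorem spread_collapse_tprod {p q P : ℕ} (h : p + q = P) (f : Fin (P + 1) → D.Fun) :
    D.spread (collapse h) (PiTensorProduct.tprod ℝ f) =
      PiTensorProduct.tprod ℝ (Fin.cons (List.ofFn fun v => f (embed h v)).prod (tailArgs h f) :
        Fin (p + 1) → D.Fun) := by
  rw [spread_tprod_eq_tprod]
  congr 1
  funext i
  have hP : (q + 1) + p = P + 1 := by omega
  rw [prod_ofFn_split hP]
  induction i using Fin.cases with
  | zero =>
    rw [Fin.cons_zero, prod_ofFn_eq_one (N := p), mul_one]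
    · congr 2
      funext v
      have e : (collapse h ⟨v.1, by omega⟩ : Fin (p + 1)) = 0 := by
        simp only [collapse, Fin.ext_iff, Fin.val_zero]; omega
      rw [e, Pi.mulSingle_eq_same]
      rfl
    · intro v
      refine Pi.mulSingle_eq_of_ne (fun hh => ?_) _
      simp only [collapse, Fin.ext_iff, Fin.val_zero] at hh
      omega
  | succ s =>
    rw [Fin.cons_succ, prod_ofFn_eq_one (N := q + 1), one_mul,
      prod_ofFn_eq_single _ s]
    · have e : (collapse h ⟨q + 1 + s.1, by omega⟩ : Fin (p + 1)) = s.succ := by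
        simp only [collapse, Fin.ext_iff, Fin.val_succ]; omega
      rw [e, Pi.mulSingle_eq_same]
      rfl
    · intro v hv
      refine Pi.mulSingle_eq_of_ne (fun hh => hv ?_) _
      simp only [collapse, Fin.ext_iff, Fin.val_succ] at hh ⊢
      omega
    · intro v
      refine Pi.mulSingle_eq_of_ne (fun hh => ?_) _
      simp only [collapse, Fin.ext_iff, Fin.val_succ] at hh
      omega

theorem mulMap_spread_collapse {p q P : ℕ} (h : p + q = P) (t : ⨂[ℝ] _ : Fin (P + 1), D.Fun) :
    D.mulMap (p + 1) (D.spread (collapse h) t) = D.mulMap (P + 1) t := by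
  induction t using PiTensorProduct.induction_on with
  | add t t' h h' => simp only [map_add, h, h']
  | smul_tprod r f =>
    have hP : (q + 1) + p = P + 1 := by omega
    rw [map_smul, map_smul, map_smul, spread_collapse_tprod, mulMap_tprod, mulMap_tprod,
      prod_ofFn_split hP, List.ofFn_succ, List.prod_cons]
    rfl

theorem slotDeriv_tailTensor {P q : ℕ} (a : D.Crd) (i : Fin (P + 1)) (hi : i.1 < q + 1)
    (f : Fin (P + 1) → D.Fun) : D.slotDeriv a i (D.tailTensor q f) = 0 := by
  rw [slotDeriv, tailTensor, PiTensorProduct.map_tprod]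
  exact (PiTensorProduct.tprod ℝ).map_coord_zero i (by simp [hi, deriv_one])

theorem slotParity_tailTensor {P q : ℕ} (a : ℕ) (i : Fin (P + 1)) (hi : i.1 < q + 1)
    (f : Fin (P + 1) → D.Fun) : D.slotParity a (· < i) (D.tailTensor q f) = D.tailTensor q f := by
  rw [slotParity, tailTensor, PiTensorProduct.map_tprod]
  congr 1
  funext j
  by_cases hj : j < i
  · have : j.1 < q + 1 := lt_trans hj hi
    simp [hj, this, parity_pow_one]
  · simp [hj]

theorem slotDeriv_embed {p q P : ℕ} (h : p + q = P) (a : D.Crd) (v : Fin (q + 1))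
    (t : ⨂[ℝ] _ : Fin (q + 1), D.Fun) (f : Fin (P + 1) → D.Fun) :
    D.slotDeriv a (embed h v) (D.spread (embed h) t * D.tailTensor q f) =
      D.spread (embed h) (D.slotDeriv a v t) * D.tailTensor q f := by
  have hv : (embed h v).1 < q + 1 := v.2
  rw [slotDeriv_mul, D.slotDeriv_tailTensor _ _ hv, D.slotParity_tailTensor _ _ hv, mul_zero,
    add_zero, D.slotDeriv_spread _ (monotone_embed h)]
  simp [(embed_injective h).eq_iff]

theorem edgeOp_embed {p q P : ℕ} (h : p + q = P) (v w : Fin (q + 1))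
    (t : ⨂[ℝ] _ : Fin (q + 1), D.Fun) (f : Fin (P + 1) → D.Fun) :
    D.edgeOp (embed h v) (embed h w) (D.spread (embed h) t * D.tailTensor q f) =
      D.spread (embed h) (D.edgeOp v w t) * D.tailTensor q f := by
  simp [edgeOp, LinearMap.sum_apply, slotDeriv_embed, Finset.sum_mul]

theorem prod_edgeOp_embed {p q P k : ℕ} (h : p + q = P) (H : Multidigraph (q + 1) k)
    (t : ⨂[ℝ] _ : Fin (q + 1), D.Fun) (f : Fin (P + 1) → D.Fun) :
    (List.ofFn fun e => D.edgeOp (embed h (H e).1) (embed h (H e).2)).prod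
        (D.spread (embed h) t * D.tailTensor q f) =
      D.spread (embed h) ((List.ofFn fun e => D.edgeOp (H e).1 (H e).2).prod t) *
        D.tailTensor q f := by
  induction k with
  | zero => simp
  | succ k ih =>
    rw [List.ofFn_succ, List.prod_cons, Module.End.mul_apply, ih fun i => H i.succ, edgeOp_embed,
      List.ofFn_succ, List.prod_cons, Module.End.mul_apply]

theorem spread_collapse_embed {p q P : ℕ} (h : p + q = P) (t : ⨂[ℝ] _ : Fin (q + 1), D.Fun)
    (f : Fin (P + 1) → D.Fun) :
    D.spread (collapse h) (D.spread (embed h) t * D.tailTensor q f) =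
      PiTensorProduct.tprod ℝ (Fin.cons (D.mulMap (q + 1) t) (tailArgs h f) :
        Fin (p + 1) → D.Fun) := by
  induction t using PiTensorProduct.induction_on with
  | add t t' h h' =>
    rw [map_add, add_mul, map_add, h, h', map_add, MultilinearMap.cons_add]
  | smul_tprod r g =>
    rw [map_smul, smul_mul_assoc, map_smul, spread_embed_mul, spread_collapse_tprod, map_smul,
      MultilinearMap.cons_smul, mulMap_tprod]
    congr 3
    · congr 2
      funext v
      exact dif_pos v.2
    · funext i
      exact dif_neg (show ¬ q + 1 + i.1 < q + 1 by omega)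

theorem prod_edgeOp_glue {p q P j k K : ℕ} (h : p + q = P) (hK : j + k = K)
    (E : Multidigraph (P + 1) j) (H : Multidigraph (q + 1) k) :
    (List.ofFn fun e => D.edgeOp (glue h hK E H e).1 (glue h hK E H e).2).prod =
      (List.ofFn fun e => D.edgeOp (E e).1 (E e).2).prod *
        (List.ofFn fun e => D.edgeOp (embed h (H e).1) (embed h (H e).2)).prod := by
  subst hK
  rw [List.ofFn_add, List.prod_append]
  simp [glue]

theorem rep_compGraph {p q P j k K : ℕ} (h : p + q = P) (hK : j + k = K)
    (G : Multidigraph (p + 1) j) (H : Multidigraph (q + 1) k) (f : Fin (P + 1) → D.Fun) :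
    D.rep (compGraph _ h hK G H) f =
      D.repGraph G (Fin.cons (D.repGraph H fun v => f (embed h v)) (tailArgs h f)) := by
  classical
  have hf : PiTensorProduct.tprod ℝ f =
      D.spread (embed h) (PiTensorProduct.tprod ℝ fun v => f (embed h v)) * D.tailTensor q f := by
    rw [spread_embed_mul]
    congr 1
    funext j
    split_ifs <;> rfl
  rw [repGraph_apply, repGraph_apply, ← D.spread_collapse_embed h _ f,
    D.prod_edgeOp_spread _ (monotone_collapse h), compGraph, map_sum, map_sum,
    sum_apply]
  refine Finset.sum_congr rfl fun E _ => ?_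
  by_cases hE : ∀ e, (collapse h (E e).1, collapse h (E e).2) = G e
  · rw [if_pos hE, if_pos (show IsReconnection h G E from hE), rep_mk, repGraph_apply,
      prod_edgeOp_glue, mulMap_spread_collapse, Module.End.mul_apply, hf, prod_edgeOp_embed]
  · rw [if_neg hE, if_neg (show ¬IsReconnection h G E from hE)]
    simp

end NPDomain

theorem Gra.comp_mk (d : ℤ) {p q P j k K : ℕ} (h : p + q = P) (hK : j + k = K)
    (G : Multidigraph (p + 1) j) (H : Multidigraph (q + 1) k) :
    Gra.comp d h hK (Gra.mk d G) (Gra.mk d H) = compGraph d h hK G H := by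
  simp [comp, Gra.lift, Gra.mk]

namespace NPDomain

variable {n : ℕ} (D : NPDomain n)

theorem rep_comp {p q P j k K : ℕ} (h : p + q = P) (hK : j + k = K)
    (γ : Gra ((n : ℤ) + 1) (p + 1) j) (γ' : Gra ((n : ℤ) + 1) (q + 1) k) (f : Fin (P + 1) → D.Fun) :
    D.rep (Gra.comp _ h hK γ γ') f =
      D.rep γ (Fin.cons (D.rep γ' fun v => f (embed h v)) (tailArgs h f)) := by
  induction γ using Gra.induction with
  | zero => simp
  | add a b ha hb => simp only [map_add, LinearMap.add_apply, add_apply, ha, hb]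
  | smul c a ha => simp only [map_smul, LinearMap.smul_apply, smul_apply, ha]
  | mk G =>
    induction γ' using Gra.induction with
    | zero =>
      simp only [map_zero, zero_apply]
      exact ((D.rep (Gra.mk _ G)).map_coord_zero 0 rfl).symm
    | add a b ha hb => simp only [map_add, add_apply, ha, hb, MultilinearMap.cons_add]
    | smul c a ha => simp only [map_smul, smul_apply, ha, MultilinearMap.cons_smul]
    | mk H => rw [Gra.comp_mk, rep_mk, rep_mk, rep_compGraph]

end NPDomain

/-! ### Suspension -/

theorem units_pow_of_even {m : ℕ} (h : Even m) (u : ℤˣ) : u ^ m = 1 := by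
  rw [Int.units_pow_eq_pow_mod_two, Nat.even_iff.1 h, pow_zero]

theorem units_pow_of_odd {m : ℕ} (h : Odd m) (u : ℤˣ) : u ^ m = u := by
  rw [Int.units_pow_eq_pow_mod_two, Nat.odd_iff.1 h, pow_one]

theorem neg_one_zpow_sum {ι : Type*} (s : Finset ι) (y : ι → ℤ) :
    (-1 : ℤˣ) ^ ∑ i ∈ s, y i = ∏ i ∈ s, (-1 : ℤˣ) ^ y i := by
  classical
  induction s using Finset.induction_on with
  | empty => simp
  | insert i s hi ih => rw [Finset.sum_insert hi, Finset.prod_insert hi, zpow_add, ih]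

/-- The sign by which `s^{⊗ N}`, the `N`-fold tensor power of the suspension of degree `n`, acts on
arguments of degrees `x i`. -/
def suspSign (n : ℕ) {N : ℕ} (x : Fin N → ℤ) : ℤˣ :=
  ∏ i, ((-1 : ℤˣ) ^ x i) ^ (n * (N - 1 - i.1))

theorem suspSign_of_even {n : ℕ} (hn : Even n) {N : ℕ} (x : Fin N → ℤ) : suspSign n x = 1 :=
  Finset.prod_eq_one fun _ _ => units_pow_of_even (hn.mul_right _) _

theorem suspSign_of_odd {n : ℕ} (hn : Odd n) {N : ℕ} (x : Fin N → ℤ) :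
    suspSign n x = ∏ i, ((-1 : ℤˣ) ^ x i) ^ (N - 1 - i.1) :=
  Finset.prod_congr rfl fun _ _ => by rw [pow_mul, units_pow_of_odd hn]

theorem suspSign_mul_koszul (n : ℕ) {N : ℕ} (τ : Equiv.Perm (Fin N)) (x : Fin N → ℤ) :
    suspSign n x * koszul τ (fun i => x i + n) =
      Equiv.Perm.sign τ ^ n * koszul τ x * suspSign n (x ∘ τ) := by
  rcases Nat.even_or_odd n with h | h
  · rw [suspSign_of_even h, suspSign_of_even h, units_pow_of_even h, one_mul, mul_one, one_mul]
    refine koszul_congr _ fun i => ?_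
    rw [add_sub_cancel_left]
    exact_mod_cast h
  · have hshift : koszul τ (fun i => x i + n) = koszul τ (fun i => x i + 1) := by
      refine koszul_congr _ fun i => ?_
      obtain ⟨t, rfl⟩ := h
      exact ⟨t, by push_cast; ring⟩
    rw [hshift, koszul_add_one, suspSign_of_odd h, suspSign_of_odd h, units_pow_of_odd h]
    simp only [Function.comp_apply]
    rw [mul_left_comm, ← mul_assoc (∏ i, _), Int.units_mul_self, one_mul]

theorem suspSign_eq_mul (n : ℕ) {p q P : ℕ} (h : p + q = P) (x : Fin (P + 1) → ℤ) :
    suspSign n x = ((-1 : ℤˣ) ^ ∑ v, x (embed h v)) ^ (n * p) *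
      suspSign n (fun v => x (embed h v)) *
        ∏ t : Fin p, ((-1 : ℤˣ) ^ tailArgs h x t) ^ (n * (p - (t.1 + 1))) := by
  have hsplit := prod_ofFn_split (show (q + 1) + p = P + 1 by omega)
    fun i => ((-1 : ℤˣ) ^ x i) ^ (n * (P + 1 - 1 - i.1))
  rw [List.prod_ofFn, List.prod_ofFn, List.prod_ofFn] at hsplit
  rw [suspSign, hsplit, neg_one_zpow_sum, suspSign, ← Finset.prod_pow, ← Finset.prod_mul_distrib]
  congr 1
  · refine Finset.prod_congr rfl fun v _ => ?_
    rw [← pow_add, ← mul_add, show P + 1 - 1 - v.1 = p + (q + 1 - 1 - v.1) by omega]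
    rfl
  · refine Finset.prod_congr rfl fun t _ => ?_
    rw [show P + 1 - 1 - (q + 1 + t.1) = p - (t.1 + 1) by omega]
    rfl

theorem suspSign_cons (n : ℕ) {p q P : ℕ} (h : p + q = P) (x : Fin (P + 1) → ℤ) (e : ℤ) :
    suspSign n (Fin.cons ((∑ v, x (embed h v)) + e) (tailArgs h x) : Fin (p + 1) → ℤ) *
        suspSign n (fun v => x (embed h v)) =
      ((-1 : ℤˣ) ^ e) ^ (n * p) * suspSign n x := by
  rw [suspSign_eq_mul n h x, suspSign, Fin.prod_univ_succ, Fin.cons_zero, zpow_add, mul_pow]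
  simp only [Fin.cons_succ, Fin.val_succ, Fin.val_zero, Nat.add_sub_cancel, Nat.sub_zero]
  ac_rfl

theorem neg_one_zpow_pow_mul (n p : ℕ) (e : ℤ) :
    ((-1 : ℤˣ) ^ ((n : ℤ) * e)) ^ (n * p) = (-1) ^ (p * (n * e)) := by
  rw [← zpow_natCast, ← zpow_mul]
  refine (Int.negOnePow_eq_iff _ _).2 ?_
  have h : (n : ℤ) * e * (n * p : ℕ) - p * (n * e) = n * (n - 1) * (e * p) := by push_cast; ring
  rw [h]
  exact (Int.even_mul_pred_self n).mul_right _

namespace NPDomain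

variable {n : ℕ} (D : NPDomain n)

theorem tParity_of_mem {k : ℤ} {X : D.Fun} (hX : X ∈ D.tGrading k) :
    D.tParity X = ((-1 : ℤˣ) ^ k) • X := by
  rw [tParity, LinearMap.smul_apply, D.parity_of_mem hX, ← neg_one_zpow_smul, smul_smul, zpow_add,
    mul_comm, mul_assoc, Int.units_mul_self, mul_one]

theorem tParity_pow_of_mem {k : ℤ} {X : D.Fun} (hX : X ∈ D.tGrading k) (a : ℕ) :
    (D.tParity ^ a) X = (((-1 : ℤˣ) ^ k) ^ a) • X := by
  induction a with
  | zero => simp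
  | succ a ih =>
    rw [pow_succ', Module.End.mul_apply, ih, LinearMap.map_smul_of_tower, D.tParity_of_mem hX,
      smul_smul, ← pow_succ]

theorem pullback_apply_of_mem {N : ℕ} (θ : MultilinearMap ℝ (fun _ : Fin N => D.Fun) D.Fun)
    (x : Fin N → ℤ) (X : Fin N → D.Fun) (hX : ∀ i, X i ∈ D.tGrading (x i)) :
    D.pullback θ X = suspSign n x • θ X := by
  rw [suspSign, ← multilinearMap_units_smul]
  change θ (fun i => (D.tParity ^ (n * (N - 1 - i.1))) (X i)) = _
  congr 1
  funext i
  exact D.tParity_pow_of_mem (hX i) _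

theorem pullback_rep_act {N k : ℕ} (σ : Equiv.Perm (Fin N)) (γ : Gra ((n : ℤ) + 1) N k)
    (x : Fin N → ℤ) (X : Fin N → D.Fun) (hX : ∀ i, X i ∈ D.tGrading (x i)) :
    D.pullback (D.rep (Equiv.Perm.sign σ ^ ((n : ℤ) + 1) • Gra.act _ σ γ)) X =
      (Equiv.Perm.sign σ * koszul σ⁻¹ x) • D.pullback (D.rep γ) (X ∘ ⇑σ⁻¹) := by
  rw [D.pullback_apply_of_mem _ x X hX,
    D.pullback_apply_of_mem _ (x ∘ ⇑σ⁻¹) (X ∘ ⇑σ⁻¹) fun i => hX _, LinearMap.map_smul_of_tower,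
    smul_apply, D.rep_act σ γ _ X hX, smul_smul, smul_smul, smul_smul]
  congr 1
  have h := suspSign_mul_koszul n σ⁻¹ x
  rw [Equiv.Perm.sign_inv] at h
  rw [mul_assoc (suspSign n x), mul_left_comm, h, zpow_add, zpow_natCast, zpow_one]
  calc Equiv.Perm.sign σ ^ n * Equiv.Perm.sign σ *
        (Equiv.Perm.sign σ ^ n * koszul σ⁻¹ x * suspSign n (x ∘ ⇑σ⁻¹))
      = Equiv.Perm.sign σ ^ n * Equiv.Perm.sign σ ^ n *
        (Equiv.Perm.sign σ * koszul σ⁻¹ x * suspSign n (x ∘ ⇑σ⁻¹)) := by ac_rfl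
    _ = _ := by rw [Int.units_mul_self, one_mul]

theorem pullback_rep_mem {p k : ℕ} (γ : Gra ((n : ℤ) + 1) (p + 1) k) (x : Fin (p + 1) → ℤ)
    (X : Fin (p + 1) → D.Fun) (hX : ∀ i, X i ∈ D.tGrading (x i)) :
    D.pullback (D.rep γ) X ∈ D.tGrading (∑ i, x i + n * (p - k)) := by
  rw [D.pullback_apply_of_mem _ x X hX]
  have h := D.rep_mem γ _ X hX
  have hdeg : ∑ u, (x u + (n : ℤ)) - n * k = ∑ i, x i + n * (p - k) + n := by
    rw [Finset.sum_add_distrib, Finset.sum_const, Finset.card_univ, Fintype.card_fin, nsmul_eq_mul]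
    push_cast
    ring
  rw [hdeg] at h
  exact (D.tGrading _).smul_of_tower_mem (suspSign n x) h

theorem cons_tailArgs_mem {p q P : ℕ} (h : p + q = P) (x : Fin (P + 1) → ℤ)
    (X : Fin (P + 1) → D.Fun) (hX : ∀ i, X i ∈ D.tGrading (x i)) {Y : D.Fun} {e : ℤ}
    (hY : Y ∈ D.tGrading e) (i : Fin (p + 1)) :
    (Fin.cons Y (tailArgs h X) : Fin (p + 1) → D.Fun) i ∈
      D.tGrading ((Fin.cons e (tailArgs h x) : Fin (p + 1) → ℤ) i) := by
  induction i using Fin.cases with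
  | zero => exact hY
  | succ i => exact hX _

theorem pullback_rep_comp {p q P j k K : ℕ} (h : p + q = P) (hK : j + k = K)
    (γ : Gra ((n : ℤ) + 1) (p + 1) j) (γ' : Gra ((n : ℤ) + 1) (q + 1) k)
    (x : Fin (P + 1) → ℤ) (X : Fin (P + 1) → D.Fun) (hX : ∀ i, X i ∈ D.tGrading (x i)) :
    D.pullback (D.rep (Gra.comp _ h hK γ γ')) X =
      (-1 : ℤˣ) ^ ((p : ℤ) * (n * (q - k))) • D.pullback (D.rep γ)
        (Fin.cons (D.pullback (D.rep γ') fun v => X (embed h v)) (tailArgs h X)) := by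
  have hY := D.pullback_rep_mem γ' (fun v => x (embed h v)) (fun v => X (embed h v))
    fun v => hX _
  have hcons : ∀ (u : ℤˣ) (Y : D.Fun), D.rep γ (Fin.cons (u • Y) (tailArgs h X)) =
      u • D.rep γ (Fin.cons Y (tailArgs h X)) := fun u Y =>
    congrArg (· (tailArgs h X)) ((D.rep γ).curryLeft.map_smul_of_tower u Y)
  rw [D.pullback_apply_of_mem _ _ _ (D.cons_tailArgs_mem h x X hX hY),
    D.pullback_apply_of_mem _ x X hX,
    D.pullback_apply_of_mem _ (fun v => x (embed h v)) (fun v => X (embed h v)) fun v => hX _,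
    rep_comp, hcons, smul_smul, smul_smul, mul_assoc, suspSign_cons, neg_one_zpow_pow_mul,
    ← mul_assoc, Int.units_mul_self, one_mul]

end NPDomain

/-! ### The pre-Lie product of the full graph complex -/

open Finset.HasAntidiagonal (antidiagonal mem_antidiagonal)

open Classical in
/-- The pre-Lie product `preLie` on homogeneous components of `fGC_d` as a bilinear map. -/
def preLieHom (d : ℤ) {p q P j k K : ℕ} (h : p + q = P) (hK : j + k = K) :
    Gra d (p + 1) j →ₗ[ℝ] Gra d (q + 1) k →ₗ[ℝ] Gra d (P + 1) K :=
  ∑ σ : Equiv.Perm (Fin (P + 1)) with IsUnshuffle (q + 1) σ,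
    Equiv.Perm.sign σ ^ d • (Gra.comp d h hK).compr₂ (Gra.act d σ)

theorem preLieHom_apply (d : ℤ) {p q P j k K : ℕ} (h : p + q = P) (hK : j + k = K)
    (γ : Gra d (p + 1) j) (γ' : Gra d (q + 1) k) :
    preLieHom d h hK γ γ' = preLie d h hK γ γ' := by
  rw [preLieHom, preLie, ← Finset.sum_filter, LinearMap.sum_apply, LinearMap.sum_apply]
  rfl

/-- The pre-Lie product of the full graph complex, on elements which need not be homogeneous. -/
def preLieSeries {d : ℤ} : GraphSeries d →ₗ[ℝ] GraphSeries d →ₗ[ℝ] GraphSeries d :=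
  LinearMap.mk₂ ℝ
    (fun m m' P K => ∑ x : antidiagonal P, ∑ y : antidiagonal K,
      preLieHom d (mem_antidiagonal.1 x.2) (mem_antidiagonal.1 y.2)
        (m x.1.1 y.1.1) (m' x.1.2 y.1.2))
    (fun a b m => by
      funext P K
      simp only [Pi.add_apply, map_add, LinearMap.add_apply, Finset.sum_add_distrib])
    (fun c a m => by
      funext P K
      simp only [Pi.smul_apply, map_smul, LinearMap.smul_apply, Finset.smul_sum])
    (fun m a b => by
      funext P K
      simp only [Pi.add_apply, map_add, Finset.sum_add_distrib])
    (fun c m a => by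
      funext P K
      simp only [Pi.smul_apply, map_smul, Finset.smul_sum])

theorem preLieSeries_apply {d : ℤ} (m m' : GraphSeries d) (P K : ℕ) :
    preLieSeries m m' P K = ∑ x : antidiagonal P, ∑ y : antidiagonal K,
      preLieHom d (mem_antidiagonal.1 x.2) (mem_antidiagonal.1 y.2)
        (m x.1.1 y.1.1) (m' x.1.2 y.1.2) :=
  rfl

theorem bracket_eq {d i i' : ℤ} {m m' : GraphSeries d} (hm : HasDegree i m)
    (hm' : HasDegree i' m') :
    bracket m m' = preLieSeries m m' - (-1 : ℤˣ) ^ (i * i') • preLieSeries m' m := by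
  funext P K
  have hterm : ∀ (x : antidiagonal P) (y : antidiagonal K),
      (-1 : ℤˣ) ^ (graphDegree d x.1.1 y.1.1 * graphDegree d x.1.2 y.1.2) •
        preLieHom d ((add_comm _ _).trans (mem_antidiagonal.1 x.2))
          ((add_comm _ _).trans (mem_antidiagonal.1 y.2)) (m' x.1.2 y.1.2) (m x.1.1 y.1.1) =
      (-1 : ℤˣ) ^ (i * i') • preLieHom d ((add_comm _ _).trans (mem_antidiagonal.1 x.2))
          ((add_comm _ _).trans (mem_antidiagonal.1 y.2)) (m' x.1.2 y.1.2) (m x.1.1 y.1.1) := by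
    intro x y
    by_cases h : graphDegree d x.1.1 y.1.1 = i
    · by_cases h' : graphDegree d x.1.2 y.1.2 = i'
      · rw [h, h']
      · simp only [hm' _ _ h', map_zero, LinearMap.zero_apply, smul_zero]
    · simp only [hm _ _ h, map_zero, smul_zero]
  let swap (N : ℕ) : antidiagonal N ≃ antidiagonal N :=
    (Equiv.prodComm ℕ ℕ).subtypeEquiv fun x => by
      simp only [mem_antidiagonal, Equiv.prodComm_apply, Prod.fst_swap, Prod.snd_swap, add_comm]
  simp only [bracket, ← preLieHom_apply, hterm, Finset.sum_sub_distrib, Pi.sub_apply,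
    ← Finset.smul_sum]
  congr 2
  exact Fintype.sum_equiv (swap P) _ _ fun x => Fintype.sum_equiv (swap K) _ _ fun y => rfl

/-- The elements of the full graph complex with finitely many numbers of edges in each arity. -/
def finiteEdges (d : ℤ) : Submodule ℝ (GraphSeries d) where
  carrier := {m | HasFiniteEdges m}
  add_mem' {a b} ha hb p := ((ha p).union (hb p)).subset fun k hk => by
    by_contra! h
    simp only [Set.mem_union, Set.mem_ofPred_eq, not_or, not_not] at h
    exact hk (by rw [Pi.add_apply, Pi.add_apply, h.1, h.2, add_zero])
  zero_mem' p := by simp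
  smul_mem' c a ha p := (ha p).subset fun k hk h =>
    hk (by rw [Pi.smul_apply, Pi.smul_apply, h, smul_zero])

/-- The elements of degree `i` of the full graph complex. -/
def homogeneous (d i : ℤ) : Submodule ℝ (GraphSeries d) where
  carrier := {m | HasDegree i m}
  add_mem' {a b} ha hb p k h := by rw [Pi.add_apply, Pi.add_apply, ha p k h, hb p k h, add_zero]
  zero_mem' _ _ _ := rfl
  smul_mem' c a ha p k h := by rw [Pi.smul_apply, Pi.smul_apply, ha p k h, smul_zero]

theorem exists_edge_bound {d : ℤ} {m m' : GraphSeries d} (hf : HasFiniteEdges m)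
    (hf' : HasFiniteEdges m') (P : ℕ) :
    ∃ M, ∀ k ≥ M, ∀ p ≤ P, m p k = 0 ∧ m' p k = 0 := by
  have hev : ∀ {m : GraphSeries d}, HasFiniteEdges m → ∀ p, ∀ᶠ k in Filter.atTop, m p k = 0 :=
    fun hf p => by
      rw [← Nat.cofinite_eq_atTop]
      exact Filter.eventually_cofinite.2 (hf p)
  exact Filter.eventually_atTop.1 ((Filter.eventually_all_finite (Set.finite_Iic P)).2 fun p _ =>
    (hev hf p).and (hev hf' p))

theorem preLieSeries_apply_eq_zero {d : ℤ} {m m' : GraphSeries d} {P M K : ℕ}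
    (hM : ∀ k ≥ M, ∀ p ≤ P, m p k = 0 ∧ m' p k = 0) (hK : 2 * M ≤ K) :
    preLieSeries m m' P K = 0 := by
  rw [preLieSeries_apply]
  refine Finset.sum_eq_zero fun y _ => Finset.sum_eq_zero fun z _ => ?_
  have hy := mem_antidiagonal.1 y.2
  have hz := mem_antidiagonal.1 z.2
  by_cases h : M ≤ z.1.1
  · rw [(hM _ h _ (by omega)).1, map_zero, LinearMap.zero_apply]
  · rw [(hM z.1.2 (by omega) _ (by omega)).2, map_zero]

theorem hasFiniteEdges_preLieSeries {d : ℤ} {m m' : GraphSeries d} (hf : HasFiniteEdges m)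
    (hf' : HasFiniteEdges m') : HasFiniteEdges (preLieSeries m m') := fun P => by
  obtain ⟨M, hM⟩ := exists_edge_bound hf hf' P
  refine (Set.finite_Iio (2 * M)).subset fun K hK => Set.mem_Iio.2 ?_
  by_contra! h
  exact hK (preLieSeries_apply_eq_zero hM h)

theorem hasFiniteEdges_bracket {d i i' : ℤ} {m m' : GraphSeries d} (hd : HasDegree i m)
    (hd' : HasDegree i' m') (hf : HasFiniteEdges m) (hf' : HasFiniteEdges m') :
    HasFiniteEdges (bracket m m') := by
  rw [bracket_eq hd hd']
  have h : preLieSeries m m' ∈ finiteEdges d := hasFiniteEdges_preLieSeries hf hf'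
  have h' : preLieSeries m' m ∈ finiteEdges d := hasFiniteEdges_preLieSeries hf' hf
  exact Submodule.sub_mem (M := GraphSeries d) _ h ((finiteEdges d).smul_of_tower_mem _ h')

/-! ### The Nijenhuis–Richardson product -/

section

variable {V : Type*} [AddCommGroup V] [Module ℝ V]

open Classical in
/-- The summand of the Nijenhuis–Richardson product `nrProd` in which a map of arity `q + 1`,
belonging to a cochain of total degree `i`, is inserted into a map of arity `p + 1`. -/
def nrInsert {p q P : ℕ} (h : p + q = P) (i : ℤ) (x : Fin (P + 1) → ℤ) (X : Fin (P + 1) → V) :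
    MultilinearMap ℝ (fun _ : Fin (p + 1) => V) V →ₗ[ℝ]
      MultilinearMap ℝ (fun _ : Fin (q + 1) => V) V →ₗ[ℝ] V :=
  LinearMap.mk₂ ℝ
    (fun θ θ' => ∑ σ : Equiv.Perm (Fin (P + 1)) with IsUnshuffle (q + 1) σ,
      (Equiv.Perm.sign σ * koszul σ⁻¹ x * (-1) ^ ((p : ℤ) * (i - q))) •
        θ (Fin.cons (θ' fun v => X (σ⁻¹ (embed h v))) (tailArgs h (X ∘ ⇑σ⁻¹))))
    (fun _ _ _ => by simp only [add_apply, smul_add, Finset.sum_add_distrib])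
    (fun c _ _ => by simp only [smul_apply, Finset.smul_sum, smul_comm c])
    (fun θ _ _ => by
      simp only [add_apply, MultilinearMap.cons_add, smul_add, Finset.sum_add_distrib])
    (fun c θ _ => by
      simp only [smul_apply, MultilinearMap.cons_smul, Finset.smul_sum, smul_comm c])

theorem nrProd_eq_sum_nrInsert (i : ℤ) (c c' : Cochains V) (P : ℕ) (x : Fin (P + 1) → ℤ)
    (X : Fin (P + 1) → V) :
    nrProd i c c' P x X =
      ∑ y : antidiagonal P, nrInsert (mem_antidiagonal.1 y.2) i x X (c y.1.1) (c' y.1.2) := by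
  simp only [nrInsert, LinearMap.mk₂_apply, Finset.sum_filter]
  rfl

end

namespace NPDomain

variable {n : ℕ} (D : NPDomain n)

theorem pullback_rep_preLieHom {p q P j k K : ℕ} (h : p + q = P) (hK : j + k = K)
    (γ : Gra ((n : ℤ) + 1) (p + 1) j) (γ' : Gra ((n : ℤ) + 1) (q + 1) k) {i : ℤ}
    (hi : graphDegree ((n : ℤ) + 1) q k = i) (x : Fin (P + 1) → ℤ) (X : Fin (P + 1) → D.Fun)
    (hX : ∀ v, X v ∈ D.tGrading (x v)) :
    D.pullback (D.rep (preLieHom _ h hK γ γ')) X =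
      nrInsert h i x X (D.pullback (D.rep γ)) (D.pullback (D.rep γ')) := by
  have hdeg : (n : ℤ) * (q - k) = i - q := by
    rw [← hi, graphDegree]
    ring
  simp only [nrInsert, LinearMap.mk₂_apply, preLieHom, LinearMap.sum_apply, map_sum, sum_apply]
  refine Finset.sum_congr rfl fun σ _ => ?_
  rw [← hdeg, mul_smul _ ((-1 : ℤˣ) ^ _)]
  exact (D.pullback_rep_act σ _ x X hX).trans (congrArg _
    (D.pullback_rep_comp h hK γ γ' (x ∘ ⇑σ⁻¹) (X ∘ ⇑σ⁻¹) fun v => hX _))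

theorem sRep_eq_sum (m : GraphSeries ((n : ℤ) + 1)) (p : ℕ) (S : Finset ℕ)
    (hS : ∀ k, k ∉ S → m p k = 0) : D.sRep m p = ∑ k ∈ S, D.pullback (D.rep (m p k)) := by
  refine finsum_eq_sum_of_support_subset _ fun k hk => ?_
  by_contra hkS
  exact hk (by simp only [hS k hkS, map_zero])

theorem finite_support_pullback_rep {m : GraphSeries ((n : ℤ) + 1)} (hm : HasFiniteEdges m)
    (p : ℕ) : (Function.support fun k => D.pullback (D.rep (m p k))).Finite :=
  (hm p).subset fun k hk h => hk (by simp only [h, map_zero])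

theorem sRep_zero : D.sRep 0 = 0 :=
  funext fun p => D.sRep_eq_sum 0 p ∅ fun _ _ => rfl

theorem sRep_add {a b : GraphSeries ((n : ℤ) + 1)} (ha : HasFiniteEdges a)
    (hb : HasFiniteEdges b) : D.sRep (a + b) = D.sRep a + D.sRep b := by
  funext p
  simp only [sRep, Pi.add_apply, map_add]
  exact finsum_add_distrib (D.finite_support_pullback_rep ha p) (D.finite_support_pullback_rep hb p)

theorem sRep_sub {a b : GraphSeries ((n : ℤ) + 1)} (ha : HasFiniteEdges a)
    (hb : HasFiniteEdges b) : D.sRep (a - b) = D.sRep a - D.sRep b := by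
  funext p
  simp only [sRep, Pi.sub_apply, map_sub]
  exact finsum_sub_distrib (D.finite_support_pullback_rep ha p) (D.finite_support_pullback_rep hb p)

theorem sRep_units_smul (u : ℤˣ) (m : GraphSeries ((n : ℤ) + 1)) :
    D.sRep (u • m) = u • D.sRep m := by
  funext p
  change ∑ᶠ k, D.pullback (D.rep (u • m p k)) = u • ∑ᶠ k, D.pullback (D.rep (m p k))
  obtain rfl | rfl := Int.units_eq_one_or u <;>
    simp only [Units.neg_smul, one_smul, map_neg, finsum_neg_distrib]

theorem sRep_smul (c : ℝ) (m : GraphSeries ((n : ℤ) + 1)) : D.sRep (c • m) = c • D.sRep m := by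
  funext p
  simp only [sRep, Pi.smul_apply, map_smul, smul_finsum]

theorem sRep_sum {ι : Type*} (S : Finset ι) (m : ι → GraphSeries ((n : ℤ) + 1))
    (h : ∀ i ∈ S, HasFiniteEdges (m i)) : D.sRep (∑ i ∈ S, m i) = ∑ i ∈ S, D.sRep (m i) := by
  funext p
  simp only [sRep, Finset.sum_apply, map_sum]
  exact finsum_sum_comm S _ fun i hi => D.finite_support_pullback_rep (h i hi) p

theorem isCE_sRep {i : ℤ} {m : GraphSeries ((n : ℤ) + 1)} (hm : m ∈ fGC ((n : ℤ) + 1))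
    (hd : HasDegree i m) (hf : HasFiniteEdges m) : IsCE D.tGrading i (D.sRep m) := by
  have hsum : ∀ p, D.sRep m p = ∑ k ∈ (hf p).toFinset, D.pullback (D.rep (m p k)) := fun p =>
    D.sRep_eq_sum m p _ fun k hk => by simpa using hk
  refine ⟨fun p x X hX => ?_, fun p x X hX τ => ?_⟩
  · rw [hsum, sum_apply]
    refine sum_mem fun k hk => ?_
    have hdeg : graphDegree ((n : ℤ) + 1) p k = i :=
      not_imp_comm.1 (hd p k) ((hf p).mem_toFinset.1 hk)
    convert D.pullback_rep_mem (m p k) x X hX using 2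
    rw [← hdeg, graphDegree]
    ring
  · rw [hsum, sum_apply, sum_apply, Finset.smul_sum]
    refine Finset.sum_congr rfl fun k _ => ?_
    have h := D.pullback_rep_act τ⁻¹ (m p k) x X hX
    rw [hm p k τ⁻¹, inv_inv, Equiv.Perm.sign_inv] at h
    rw [h, smul_smul, Int.units_mul_self, one_smul]

end NPDomain

theorem sum_antidiagonal_range {A : Type*} [AddCommMonoid A] (M : ℕ) (g : ℕ → ℕ → A)
    (hl : ∀ j k, M ≤ j → g j k = 0) (hr : ∀ j k, M ≤ k → g j k = 0) :
    ∑ K ∈ Finset.range (2 * M), ∑ z ∈ antidiagonal K, g z.1 z.2 =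
      ∑ j ∈ Finset.range M, ∑ k ∈ Finset.range M, g j k := by
  rw [← Finset.sum_product', Finset.sum_sigma']
  symm
  refine Finset.sum_of_injOn (fun z => ⟨z.1 + z.2, z⟩) (fun z _ w _ h => ?_) (fun z hz => ?_)
    (fun s hs hs' => ?_) fun z _ => rfl
  · exact eq_of_heq (Sigma.mk.inj h).2
  · simp only [Finset.coe_product, Finset.coe_range, Set.mem_prod, Set.mem_Iio] at hz
    simp only [Finset.coe_sigma, Set.mem_sigma_iff, Finset.coe_range, Set.mem_Iio,
      Finset.mem_coe, mem_antidiagonal, and_true]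
    omega
  · by_contra hne
    refine hs' ⟨s.2, ?_, ?_⟩
    · simp only [Finset.coe_product, Finset.coe_range, Set.mem_prod, Set.mem_Iio]
      exact ⟨not_le.1 fun h => hne (hl _ _ h), not_le.1 fun h => hne (hr _ _ h)⟩
    · obtain ⟨K, z⟩ := s
      obtain rfl : z.1 + z.2 = K := mem_antidiagonal.1 (Finset.mem_sigma.1 hs).2
      rfl

namespace NPDomain

variable {n : ℕ} (D : NPDomain n)

theorem sRep_preLieSeries_apply {m m' : GraphSeries ((n : ℤ) + 1)} {P M : ℕ}
    (hM : ∀ k ≥ M, ∀ p ≤ P, m p k = 0 ∧ m' p k = 0) (X : Fin (P + 1) → D.Fun) :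
    D.sRep (preLieSeries m m') P X =
      ∑ y : antidiagonal P, ∑ j ∈ Finset.range M, ∑ k ∈ Finset.range M,
        D.pullback (D.rep (preLieHom _ (mem_antidiagonal.1 y.2) rfl (m y.1.1 j) (m' y.1.2 k)))
          X := by
  have hle : ∀ y : antidiagonal P, y.1.1 ≤ P ∧ y.1.2 ≤ P := fun y => by
    have := mem_antidiagonal.1 y.2
    omega
  rw [D.sRep_eq_sum _ P (Finset.range (2 * M)) fun K hK =>
    preLieSeries_apply_eq_zero hM (not_lt.1 (Finset.mem_range.not.1 hK))]
  simp only [preLieSeries_apply, map_sum, sum_apply]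
  rw [Finset.sum_comm]
  refine Finset.sum_congr rfl fun y _ => ?_
  rw [← sum_antidiagonal_range M fun j k =>
    D.pullback (D.rep (preLieHom _ (mem_antidiagonal.1 y.2) rfl (m y.1.1 j) (m' y.1.2 k))) X]
  · refine Finset.sum_congr rfl fun K _ => ?_
    rw [← Finset.sum_coe_sort (antidiagonal K)]
    refine Finset.sum_congr rfl fun z _ => ?_
    obtain ⟨z, hz⟩ := z
    obtain rfl := mem_antidiagonal.1 hz
    rfl
  · intro j k hj
    rw [(hM _ hj _ (hle y).1).1]
    simp only [map_zero, LinearMap.zero_apply, zero_apply]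
  · intro j k hk
    rw [(hM _ hk _ (hle y).2).2]
    simp only [map_zero, zero_apply]

theorem nrProd_sRep {i : ℤ} {m m' : GraphSeries ((n : ℤ) + 1)} (hd' : HasDegree i m')
    (hf : HasFiniteEdges m) (hf' : HasFiniteEdges m') (P : ℕ) (x : Fin (P + 1) → ℤ)
    (X : Fin (P + 1) → D.Fun) (hX : ∀ v, X v ∈ D.tGrading (x v)) :
    nrProd i (D.sRep m) (D.sRep m') P x X = D.sRep (preLieSeries m m') P X := by
  obtain ⟨M, hM⟩ := exists_edge_bound hf hf' P
  rw [nrProd_eq_sum_nrInsert, D.sRep_preLieSeries_apply hM]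
  refine Finset.sum_congr rfl fun y _ => ?_
  have hy := mem_antidiagonal.1 y.2
  rw [D.sRep_eq_sum m y.1.1 (Finset.range M) fun k hk =>
      (hM k (not_lt.1 (Finset.mem_range.not.1 hk)) _ (by omega)).1,
    D.sRep_eq_sum m' y.1.2 (Finset.range M) fun k hk =>
      (hM k (not_lt.1 (Finset.mem_range.not.1 hk)) _ (by omega)).2, LinearMap.map_sum₂]
  simp only [map_sum]
  refine Finset.sum_congr rfl fun j _ => Finset.sum_congr rfl fun k _ => ?_
  by_cases hk : graphDegree ((n : ℤ) + 1) y.1.2 k = i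
  · exact (D.pullback_rep_preLieHom hy rfl _ _ hk x X hX).symm
  · simp only [hd' _ _ hk, map_zero, zero_apply]

theorem nrBracket_sRep {i i' : ℤ} {m m' : GraphSeries ((n : ℤ) + 1)} (hd : HasDegree i m)
    (hd' : HasDegree i' m') (hf : HasFiniteEdges m) (hf' : HasFiniteEdges m') (P : ℕ)
    (x : Fin (P + 1) → ℤ) (X : Fin (P + 1) → D.Fun) (hX : ∀ v, X v ∈ D.tGrading (x v)) :
    nrBracket i i' (D.sRep m) (D.sRep m') P x X = D.sRep (bracket m m') P X := by
  rw [nrBracket, D.nrProd_sRep hd' hf hf' P x X hX, D.nrProd_sRep hd hf' hf P x X hX,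
    bracket_eq hd hd', D.sRep_sub (hasFiniteEdges_preLieSeries hf hf')
      ((finiteEdges _).smul_of_tower_mem _ (hasFiniteEdges_preLieSeries hf' hf :
        preLieSeries m' m ∈ finiteEdges _)), sRep_units_smul]
  rfl

end NPDomain

/-! ### The edge graph -/

theorem mk_swap_edges (d : ℤ) {N : ℕ} (a b : Fin N × Fin N) :
    Gra.mk d ![b, a] = -((-1 : ℤˣ) ^ d • Gra.mk d ![a, b]) := by
  have h := Gra.mk_perm d ![a, b] (Equiv.swap 0 1)
  have e : ![a, b] ∘ Equiv.swap (0 : Fin 2) 1 = ![b, a] := by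
    funext i
    fin_cases i <;> rfl
  rwa [e, Equiv.Perm.sign_swap (by decide), zpow_add_one, mul_neg_one, Units.neg_smul] at h

theorem mk_flip_fst (d : ℤ) {N : ℕ} (u v : Fin N) (b : Fin N × Fin N) :
    Gra.mk d ![(v, u), b] = (-1 : ℤˣ) ^ d • Gra.mk d ![(u, v), b] := by
  have e : flipEdge 0 ![(u, v), b] = ![(v, u), b] := by
    funext i
    fin_cases i <;> rfl
  rw [← e, Gra.mk_flip]

theorem mk_flip_snd (d : ℤ) {N : ℕ} (u v : Fin N) (a : Fin N × Fin N) :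
    Gra.mk d ![a, (v, u)] = (-1 : ℤˣ) ^ d • Gra.mk d ![a, (u, v)] := by
  have e : flipEdge 1 ![a, (u, v)] = ![a, (v, u)] := by
    funext i
    fin_cases i <;> rfl
  rw [← e, Gra.mk_flip]

theorem compGraph_edge_edge (d : ℤ) :
    compGraph d (show 1 + 1 = 2 from rfl) (show 1 + 1 = 2 from rfl)
      (fun _ => (0, 1)) (fun _ => (0, 1)) =
      Gra.mk d ![((0 : Fin 3), (2 : Fin 3)), (0, 1)] + Gra.mk d ![(1, 2), (0, 1)] := by
  have reconnections : ∀ E : Multidigraph 3 1,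
      IsReconnection (show 1 + 1 = 2 from rfl) (fun _ => (0, 1)) E ↔
        E ∈ ({fun _ => (0, 2), fun _ => (1, 2)} : Finset (Multidigraph 3 1)) := by
    unfold IsReconnection
    decide
  simp only [compGraph, reconnections, Finset.sum_ite_mem, Finset.univ_inter]
  rw [Finset.sum_pair (by decide)]
  congr 2 <;> decide

/-- Each of the three paths of length two on three vertices arises twice, with opposite signs. -/
theorem preLieHom_edge_edge (d : ℤ) :
    preLieHom d (show 1 + 1 = 2 from rfl) (show 1 + 1 = 2 from rfl)
      (Gra.mk d fun _ => (0, 1)) (Gra.mk d fun _ => (0, 1)) = 0 := by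
  have unshuffles : ∀ σ : Equiv.Perm (Fin 3), IsUnshuffle (1 + 1) σ ↔
      σ ∈ ({1, Equiv.swap 1 2, (finRotate 3)⁻¹} : Finset (Equiv.Perm (Fin 3))) := by
    unfold IsUnshuffle
    decide
  have one_first : relabel 1 ![((0 : Fin 3), (2 : Fin 3)), (0, 1)] = ![(0, 2), (0, 1)] := rfl
  have one_second : relabel 1 ![((1 : Fin 3), (2 : Fin 3)), (0, 1)] = ![(1, 2), (0, 1)] := rfl
  have swap_first : relabel (Equiv.swap 1 2) ![((0 : Fin 3), (2 : Fin 3)), (0, 1)] =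
      ![(0, 1), (0, 2)] := by decide
  have swap_second : relabel (Equiv.swap 1 2) ![((1 : Fin 3), (2 : Fin 3)), (0, 1)] =
      ![(2, 1), (0, 2)] := by decide
  have rotate_first : relabel (finRotate 3)⁻¹ ![((0 : Fin 3), (2 : Fin 3)), (0, 1)] =
      ![(1, 0), (1, 2)] := by decide
  have rotate_second : relabel (finRotate 3)⁻¹ ![((1 : Fin 3), (2 : Fin 3)), (0, 1)] =
      ![(2, 0), (1, 2)] := by decide
  have sign_swap : Equiv.Perm.sign (Equiv.swap (1 : Fin 3) 2) = -1 :=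
    Equiv.Perm.sign_swap (by decide)
  have sign_rotate : Equiv.Perm.sign (finRotate 3)⁻¹ = 1 := by
    rw [Equiv.Perm.sign_inv, sign_finRotate]
    rfl
  rw [preLieHom_apply, preLie, Gra.comp_mk, compGraph_edge_edge]
  simp only [unshuffles, Finset.sum_ite_mem, Finset.univ_inter]
  rw [Finset.sum_insert (by decide), Finset.sum_pair (by decide)]
  simp only [map_add, Gra.act_mk, one_first, one_second, swap_first, swap_second, rotate_first,
    rotate_second, Equiv.Perm.sign_one, sign_rotate, sign_swap, one_zpow, one_smul]
  rw [mk_swap_edges d (0, 2) (0, 1), mk_swap_edges d (0, 2) (2, 1), mk_flip_fst d 0 1 (1, 2),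
    mk_swap_edges d (1, 2) (0, 1), mk_flip_fst d 0 2 (1, 2), mk_flip_snd d 2 1 (0, 2)]
  simp only [smul_add, smul_neg, smul_smul, Int.units_mul_self, one_smul]
  abel

theorem edgeGraph_one_one (d : ℤ) : edgeGraph d 1 1 = Gra.mk d fun _ => (0, 1) :=
  if_pos ⟨rfl, rfl⟩

theorem edgeGraph_eq_zero (d : ℤ) {p k : ℕ} (h : ¬ (p = 1 ∧ k = 1)) : edgeGraph d p k = 0 :=
  if_neg h

theorem preLieSeries_edgeGraph (d : ℤ) : preLieSeries (edgeGraph d) (edgeGraph d) = 0 := by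
  funext P K
  rw [preLieSeries_apply]
  refine Finset.sum_eq_zero fun x _ => Finset.sum_eq_zero fun y _ => ?_
  obtain ⟨⟨p, q⟩, hx⟩ := x
  obtain ⟨⟨j, k⟩, hy⟩ := y
  obtain rfl : p + q = P := mem_antidiagonal.1 hx
  obtain rfl : j + k = K := mem_antidiagonal.1 hy
  change preLieHom d rfl rfl (edgeGraph d p j) (edgeGraph d q k) = 0
  by_cases hpj : p = 1 ∧ j = 1
  · by_cases hqk : q = 1 ∧ k = 1
    · obtain ⟨rfl, rfl⟩ := hpj
      obtain ⟨rfl, rfl⟩ := hqk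
      rw [edgeGraph_one_one]
      exact preLieHom_edge_edge d
    · rw [edgeGraph_eq_zero d hqk, map_zero]
  · rw [edgeGraph_eq_zero d hpj, map_zero, LinearMap.zero_apply]

theorem hasDegree_edgeGraph (d : ℤ) : HasDegree 1 (edgeGraph d) := by
  refine fun p k h => edgeGraph_eq_zero d ?_
  rintro ⟨rfl, rfl⟩
  exact h (by simp [graphDegree])

theorem hasFiniteEdges_edgeGraph (d : ℤ) : HasFiniteEdges (edgeGraph d) := fun p =>
  (Set.finite_singleton 1).subset fun k hk => by
    by_contra h
    exact hk (edgeGraph_eq_zero d fun hpk => h hpk.2)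

theorem edgeGraph_mem (d : ℤ) : edgeGraph d ∈ fGC d := by
  intro p k σ
  by_cases h : p = 1 ∧ k = 1
  · obtain ⟨rfl, rfl⟩ := h
    rw [edgeGraph_one_one, Gra.act_mk]
    have one_or_swap : ∀ σ : Equiv.Perm (Fin 2), σ = 1 ∨ σ = Equiv.swap 0 1 := by decide
    have relabel_swap : relabel (Equiv.swap 0 1) (fun _ : Fin 1 => ((0 : Fin 2), (1 : Fin 2))) =
        flipEdge 0 fun _ => (0, 1) := by decide
    rcases one_or_swap σ with rfl | rfl
    · rw [Equiv.Perm.sign_one, one_zpow, one_smul]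
      rfl
    · rw [relabel_swap, Gra.mk_flip, Equiv.Perm.sign_swap (by decide), smul_smul,
        Int.units_mul_self, one_smul]
  · rw [edgeGraph_eq_zero d h, map_zero, smul_zero]

namespace NPDomain

variable {n : ℕ} (D : NPDomain n)

theorem rep_edge : D.rep (Gra.mk _ fun _ : Fin 1 => ((0 : Fin 2), (1 : Fin 2))) = D.poisson := by
  ext f
  have mulMap_slotDeriv : ∀ a b, D.mulMap 2 (D.slotDeriv a (0 : Fin 2)
      (D.slotDeriv b (1 : Fin 2) (PiTensorProduct.tprod ℝ f))) =
        D.deriv a ((D.parity ^ b.deg) (f 0)) * D.deriv b (f 1) := fun a b => by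
    rw [slotDeriv, slotDeriv, PiTensorProduct.map_tprod, PiTensorProduct.map_tprod, mulMap_tprod]
    simp [List.ofFn_succ]
  rw [rep_mk, repGraph_apply, poisson, sum_apply]
  simp [edgeOp, LinearMap.sum_apply, mulMap_slotDeriv, List.ofFn_succ]

theorem sRep_edgeGraph : D.sRep (edgeGraph ((n : ℤ) + 1)) = D.schouten := by
  funext p
  by_cases hp : p = 1
  · subst hp
    rw [D.sRep_eq_sum _ 1 {1} fun k hk => edgeGraph_eq_zero _ fun h =>
        hk (Finset.mem_singleton.2 h.2),
      Finset.sum_singleton, edgeGraph_one_one, rep_edge]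
    rfl
  · rw [D.sRep_eq_sum _ p ∅ fun k _ => edgeGraph_eq_zero _ fun h => hp h.1, Finset.sum_empty]
    match p, hp with
    | 0, _ => rfl
    | _ + 2, _ => rfl

end NPDomain

/-! ### Maurer–Cartan elements -/

section

variable {R M N L : Type*} [CommSemiring R] [AddCommMonoid M] [AddCommMonoid N] [AddCommMonoid L]
  [Module R M] [Module R N] [Module R L]

theorem sum_antidiagonal_single_left (B : M →ₗ[R] N →ₗ[R] L) (a : M) (f : ℕ → N) (r : ℕ) :
    ∑ ij ∈ antidiagonal r, B (Pi.single (M := fun _ => M) 0 a ij.1) (f ij.2) = B a (f r) := by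
  rw [Finset.sum_eq_single (0, r)]
  · rw [Pi.single_eq_same]
  · rintro ⟨i, j⟩ hij hne
    have hi : i ≠ 0 := by
      rintro rfl
      exact hne (Prod.ext rfl ((zero_add j).symm.trans (mem_antidiagonal.1 hij)))
    rw [Pi.single_eq_of_ne hi, map_zero, LinearMap.zero_apply]
  · exact fun h => absurd (mem_antidiagonal.2 (zero_add r)) h

theorem sum_antidiagonal_single_right (B : M →ₗ[R] N →ₗ[R] L) (f : ℕ → M) (b : N) (r : ℕ) :
    ∑ ij ∈ antidiagonal r, B (f ij.1) (Pi.single (M := fun _ => N) 0 b ij.2) = B (f r) b := by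
  rw [← Finset.Nat.sum_antidiagonal_swap]
  exact sum_antidiagonal_single_left B.flip b f r

end

section

variable {d : ℤ}

/-- The coefficients of `Γ + ∑ r, ε ^ r m_r`, where `Γ` is the edge graph. -/
def twisted (m : ℕ → GraphSeries d) : ℕ → GraphSeries d :=
  Pi.single 0 (edgeGraph d) + m

theorem twisted_mem_submodule {S : Submodule ℝ (GraphSeries d)} (hS : edgeGraph d ∈ S)
    {m : ℕ → GraphSeries d} (hm : ∀ r, m r ∈ S) (r : ℕ) : twisted m r ∈ S := by
  refine add_mem ?_ (hm r)
  cases r with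
  | zero => rwa [Pi.single_eq_same]
  | succ r =>
    rw [Pi.single_eq_of_ne r.succ_ne_zero]
    exact zero_mem S

theorem twisted_mem {m : ℕ → GraphSeries d} (hm : ∀ r, m r ∈ fGC d) (r : ℕ) :
    twisted m r ∈ fGC d :=
  twisted_mem_submodule (edgeGraph_mem d) hm r

theorem hasDegree_twisted {m : ℕ → GraphSeries d} (hm : ∀ r, HasDegree 1 (m r)) (r : ℕ) :
    HasDegree 1 (twisted m r) :=
  twisted_mem_submodule (S := homogeneous d 1) (hasDegree_edgeGraph d) hm r

theorem hasFiniteEdges_twisted {m : ℕ → GraphSeries d} (hm : ∀ r, HasFiniteEdges (m r)) (r : ℕ) :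
    HasFiniteEdges (twisted m r) :=
  twisted_mem_submodule (S := finiteEdges d) (hasFiniteEdges_edgeGraph d) hm r

theorem twisted_single (m : GraphSeries d) :
    twisted (Pi.single 0 m) = Pi.single 0 (edgeGraph d + m) :=
  (Pi.single_add (f := fun _ => GraphSeries d) 0 _ _).symm

theorem bracket_eq_add {m m' : GraphSeries d} (hm : HasDegree 1 m) (hm' : HasDegree 1 m') :
    bracket m m' = preLieSeries m m' + preLieSeries m' m := by
  funext P K
  rw [bracket_eq hm hm', mul_one, zpow_one]
  change preLieSeries m m' P K - (-1 : ℤˣ) • preLieSeries m' m P K = _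
  rw [Units.neg_smul, one_smul, sub_neg_eq_add]
  rfl

theorem sum_bracket_eq {m : ℕ → GraphSeries d} (hm : ∀ r, HasDegree 1 (m r)) (r : ℕ) :
    ∑ ij ∈ antidiagonal r, bracket (m ij.1) (m ij.2) =
      (2 : ℝ) • ∑ ij ∈ antidiagonal r, preLieSeries (m ij.1) (m ij.2) := by
  have swap : ∑ ij ∈ antidiagonal r, preLieSeries (m ij.2) (m ij.1) =
      ∑ ij ∈ antidiagonal r, preLieSeries (m ij.1) (m ij.2) :=
    Finset.Nat.sum_antidiagonal_swap (f := fun ij => preLieSeries (m ij.1) (m ij.2))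
  rw [Finset.sum_congr rfl fun ij _ => bracket_eq_add (hm ij.1) (hm ij.2), Finset.sum_add_distrib,
    swap]
  module

/-- Completing the square: `δ m + ½ [m, m] = (Γ + m) ∘ (Γ + m)`, since `Γ ∘ Γ = 0`. -/
theorem differential_add_half_sum_bracket {m : ℕ → GraphSeries d} (hm : ∀ r, HasDegree 1 (m r))
    (r : ℕ) :
    differential (m r) + (1 / 2 : ℝ) • ∑ ij ∈ antidiagonal r, bracket (m ij.1) (m ij.2) =
      ∑ ij ∈ antidiagonal r, preLieSeries (twisted m ij.1) (twisted m ij.2) := by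
  have square_edge : preLieSeries (edgeGraph d)
      (Pi.single (M := fun _ => GraphSeries d) 0 (edgeGraph d) r) = 0 := by
    cases r with
    | zero => rw [Pi.single_eq_same, preLieSeries_edgeGraph]
    | succ r => rw [Pi.single_eq_of_ne r.succ_ne_zero, map_zero]
  rw [differential, bracket_eq_add (hasDegree_edgeGraph d) (hm r), sum_bracket_eq hm]
  simp only [twisted, Pi.add_apply, map_add, LinearMap.add_apply, Finset.sum_add_distrib,
    sum_antidiagonal_single_left, sum_antidiagonal_single_right, square_edge]
  module

theorem isFormalMaurerCartan_iff {m : ℕ → GraphSeries d} (hmem : ∀ r, m r ∈ fGC d)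
    (hdeg : ∀ r, HasDegree 1 (m r)) : IsFormalMaurerCartan m ↔
      ∀ r, ∑ ij ∈ antidiagonal r, preLieSeries (twisted m ij.1) (twisted m ij.2) = 0 := by
  simp only [← differential_add_half_sum_bracket hdeg]
  exact ⟨fun h => h.eqn, fun h => ⟨hmem, hdeg, h⟩⟩

theorem IsFormalMaurerCartan.sum_preLieSeries_twisted {m : ℕ → GraphSeries d}
    (hm : IsFormalMaurerCartan m) (r : ℕ) :
    ∑ ij ∈ antidiagonal r, preLieSeries (twisted m ij.1) (twisted m ij.2) = 0 :=
  (isFormalMaurerCartan_iff hm.mem hm.degree).1 hm r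

theorem IsMaurerCartan.preLieSeries_eq_zero {m : GraphSeries d} (hm : IsMaurerCartan m) :
    preLieSeries (edgeGraph d + m) (edgeGraph d + m) = 0 := by
  have h := differential_add_half_sum_bracket (m := fun _ => m) (fun _ => hm.degree) 0
  simpa only [Finset.Nat.antidiagonal_zero, Finset.sum_singleton, hm.eqn, twisted, Pi.add_apply,
    Pi.single_eq_same, eq_comm] using h

theorem IsMaurerCartan.formal {m : GraphSeries d} (hm : IsMaurerCartan m) :
    IsFormalMaurerCartan (Pi.single (M := fun _ => GraphSeries d) 0 m) := by
  have single_mem : ∀ {S : Submodule ℝ (GraphSeries d)}, m ∈ S →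
      ∀ r, Pi.single (M := fun _ => GraphSeries d) 0 m r ∈ S := by
    rintro S hS (_ | _)
    · rwa [Pi.single_eq_same]
    · exact zero_mem S
  refine (isFormalMaurerCartan_iff (single_mem hm.mem)
    (single_mem (S := homogeneous d 1) hm.degree)).2 fun r => ?_
  rw [twisted_single, sum_antidiagonal_single_left]
  cases r with
  | zero => rw [Pi.single_eq_same, hm.preLieSeries_eq_zero]
  | succ r => rw [Pi.single_eq_of_ne r.succ_ne_zero, map_zero]

end

/-! ### Counting edges -/

section

variable {d : ℤ}

theorem edgePart_self (k p : ℕ) (m : GraphSeries d) : edgePart k m p k = m p k :=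
  if_pos rfl

theorem edgePart_of_ne {k k' : ℕ} (h : k' ≠ k) (p : ℕ) (m : GraphSeries d) :
    edgePart k m p k' = 0 :=
  if_neg h

theorem edgePart_mem {m : GraphSeries d} (hm : m ∈ fGC d) (k : ℕ) : edgePart k m ∈ fGC d := by
  intro p k' σ
  by_cases h : k' = k
  · obtain rfl := h
    rw [edgePart_self, hm p k' σ]
  · rw [edgePart_of_ne h, map_zero, smul_zero]

theorem hasDegree_edgePart {i : ℤ} {m : GraphSeries d} (hm : HasDegree i m) (k : ℕ) :
    HasDegree i (edgePart k m) := fun p k' h => by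
  simp only [edgePart, hm p k' h, ite_self]

theorem hasFiniteEdges_edgePart (m : GraphSeries d) (k : ℕ) : HasFiniteEdges (edgePart k m) :=
  fun p => (Set.finite_singleton k).subset fun k' hk' => by
    by_contra h
    exact hk' (edgePart_of_ne h p m)

theorem edgePart_add (k : ℕ) (m m' : GraphSeries d) :
    edgePart k (m + m') = edgePart k m + edgePart k m' := by
  funext p k'
  by_cases h : k' = k <;> simp only [edgePart, h, if_true, if_false, Pi.add_apply, add_zero]

theorem edgePart_succ_edgeGraph (r : ℕ) :
    edgePart (r + 1) (edgeGraph d) = Pi.single (M := fun _ => GraphSeries d) 0 (edgeGraph d) r := by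
  funext p k
  cases r with
  | zero =>
    by_cases hk : k = 1
    · obtain rfl := hk
      rw [edgePart_self, Pi.single_eq_same]
    · rw [edgePart_of_ne hk, Pi.single_eq_same, edgeGraph_eq_zero d fun h => hk h.2]
  | succ r =>
    rw [Pi.single_eq_of_ne r.succ_ne_zero]
    by_cases hk : k = r + 2
    · obtain rfl := hk
      rw [edgePart_self, edgeGraph_eq_zero d fun h => by omega]
      rfl
    · rw [edgePart_of_ne hk]
      rfl

theorem twisted_edgePart (m : GraphSeries d) :
    twisted (fun r => edgePart (r + 1) m) = fun r => edgePart (r + 1) (edgeGraph d + m) := by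
  funext r
  rw [edgePart_add, edgePart_succ_edgeGraph]
  rfl

theorem edgePart_preLieSeries (K : ℕ) (m m' : GraphSeries d) :
    edgePart K (preLieSeries m m') =
      ∑ ab ∈ antidiagonal K, preLieSeries (edgePart ab.1 m) (edgePart ab.2 m') := by
  have preLieHom_eq_zero : ∀ {p q P K' : ℕ} (h : p + q = P) (y : antidiagonal K') {ab : ℕ × ℕ},
      y.1 ≠ ab → preLieHom d h (mem_antidiagonal.1 y.2) (edgePart ab.1 m p y.1.1)
        (edgePart ab.2 m' q y.1.2) = 0 := by
    intro p q P K' h y ab hne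
    by_cases hfst : y.1.1 = ab.1
    · rw [edgePart_of_ne (fun hsnd => hne (Prod.ext hfst hsnd)), map_zero]
    · rw [edgePart_of_ne hfst, map_zero, LinearMap.zero_apply]
  funext P K'
  simp only [Finset.sum_apply, preLieSeries_apply]
  by_cases hK : K' = K
  · obtain rfl := hK
    rw [edgePart_self, preLieSeries_apply]
    symm
    rw [Finset.sum_comm]
    refine Finset.sum_congr rfl fun x _ => ?_
    rw [Finset.sum_comm]
    refine Finset.sum_congr rfl fun y _ => ?_
    rw [Finset.sum_eq_single_of_mem y.1 y.2 fun ab _ hne => preLieHom_eq_zero _ y hne.symm,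
      edgePart_self, edgePart_self]
  · rw [edgePart_of_ne hK]
    symm
    refine Finset.sum_eq_zero fun ab hab => Finset.sum_eq_zero fun x _ =>
      Finset.sum_eq_zero fun y _ => preLieHom_eq_zero _ y ?_
    rintro rfl
    exact hK ((mem_antidiagonal.1 y.2).symm.trans (mem_antidiagonal.1 hab))

theorem act_edgeless {N : ℕ} (σ : Equiv.Perm (Fin N)) (γ : Gra d N 0) : Gra.act d σ γ = γ := by
  induction γ using Gra.induction with
  | zero => rw [map_zero]
  | add a b ha hb => rw [map_add, ha, hb]
  | smul c a ha => rw [map_smul, ha]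
  | mk G => rw [Gra.act_mk, Subsingleton.elim (relabel σ G) G]

/-- An edgeless graph of degree `1` has two vertices, and `d = 1`: it is killed by antisymmetry. -/
theorem edgePart_zero_eq_zero {m : GraphSeries d} (hm : m ∈ fGC d) (hd : HasDegree 1 m) :
    edgePart 0 m = 0 := by
  funext p k
  by_cases hk : k = 0
  · obtain rfl := hk
    rw [edgePart_self]
    by_cases hdeg : graphDegree d p 0 = 1
    · have hdp : d * p = 1 := by simpa [graphDegree] using hdeg
      obtain ⟨rfl, hp⟩ : d = 1 ∧ p = 1 := by
        rcases Int.mul_eq_one_iff_eq_one_or_neg_one.1 hdp with h | h <;> omega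
      obtain rfl := hp
      have antisymm := hm 1 0 (Equiv.swap 0 1)
      rw [act_edgeless, Equiv.Perm.sign_swap (by decide), zpow_one, Units.neg_smul,
        one_smul] at antisymm
      have : IsAddTorsionFree (Gra 1 (1 + 1) 0) := .of_isTorsionFree ℝ _
      exact self_eq_neg.1 antisymm.symm
    · exact hd p 0 hdeg
  · exact edgePart_of_ne hk p m

theorem IsMaurerCartan.formal_edgePart {m : GraphSeries d} (hm : IsMaurerCartan m) :
    IsFormalMaurerCartan fun r => edgePart (r + 1) m := by
  refine (isFormalMaurerCartan_iff (fun r => edgePart_mem hm.mem _)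
    fun r => hasDegree_edgePart hm.degree _).2 fun r => ?_
  have edgeless : edgePart 0 (edgeGraph d + m) = 0 :=
    edgePart_zero_eq_zero (add_mem (edgeGraph_mem d) hm.mem)
      ((homogeneous d 1).add_mem (hasDegree_edgeGraph d) hm.degree)
  have square := edgePart_preLieSeries (r + 2) (edgeGraph d + m) (edgeGraph d + m)
  rw [Finset.Nat.antidiagonal_succ_succ', Finset.sum_cons, Finset.sum_cons, Finset.sum_map,
    hm.preLieSeries_eq_zero] at square
  simp only [edgeless, map_zero, LinearMap.zero_apply, zero_add] at square
  rw [twisted_edgePart]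
  refine (zero_add _).symm.trans (square.symm.trans ?_)
  funext p k
  exact ite_self 0

end

/-! ### Universal deformations -/

theorem hasFiniteEdges_of_hasDegree {d i : ℤ} (hd : d ≠ 1) {m : GraphSeries d}
    (hm : HasDegree i m) : HasFiniteEdges m := fun p =>
  Set.Subsingleton.finite fun k hk l hl => by
    have hkl : graphDegree d p k = graphDegree d p l :=
      (not_imp_comm.1 (hm p k) hk).trans (not_imp_comm.1 (hm p l) hl).symm
    simpa [graphDegree, sub_eq_zero, hd.symm] using hkl

namespace NPDomain

variable {n : ℕ} (D : NPDomain n) {m : ℕ → GraphSeries ((n : ℤ) + 1)}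

theorem deformed_sRep (hf : ∀ r, HasFiniteEdges (m r)) (r : ℕ) :
    D.deformed (fun r => D.sRep (m r)) r = D.sRep (twisted m r) := by
  cases r with
  | zero =>
    rw [deformed, if_pos rfl, twisted, Pi.add_apply, Pi.single_eq_same,
      D.sRep_add (hasFiniteEdges_edgeGraph _) (hf 0), sRep_edgeGraph]
  | succ r =>
    rw [deformed, if_neg r.succ_ne_zero, twisted, Pi.add_apply,
      Pi.single_eq_of_ne r.succ_ne_zero]
    exact congrArg D.sRep (funext fun p => funext fun k => (zero_add (m (r + 1) p k)).symm)

theorem maurerCartan_sRep (hd : ∀ r, HasDegree 1 (m r)) (hf : ∀ r, HasFiniteEdges (m r)) (r P : ℕ)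
    (x : Fin (P + 1) → ℤ) (X : Fin (P + 1) → D.Fun) (hX : ∀ v, X v ∈ D.tGrading (x v)) :
    nrBracket 1 1 D.schouten (D.sRep (m r)) P x X + (1 / 2 : ℝ) •
        ∑ ij ∈ antidiagonal r, nrBracket 1 1 (D.sRep (m ij.1)) (D.sRep (m ij.2)) P x X =
      D.sRep (differential (m r) +
        (1 / 2 : ℝ) • ∑ ij ∈ antidiagonal r, bracket (m ij.1) (m ij.2)) P X := by
  have hΓ := hasDegree_edgeGraph ((n : ℤ) + 1)
  have hΓf := hasFiniteEdges_edgeGraph ((n : ℤ) + 1)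
  have finite_bracket : ∀ i j, HasFiniteEdges (bracket (m i) (m j)) := fun i j =>
    hasFiniteEdges_bracket (hd i) (hd j) (hf i) (hf j)
  rw [differential, D.sRep_add (hasFiniteEdges_bracket hΓ (hd r) hΓf (hf r))
      ((finiteEdges _).smul_mem _ (sum_mem fun ij _ => finite_bracket ij.1 ij.2)),
    sRep_smul, D.sRep_sum _ _ fun ij _ => finite_bracket ij.1 ij.2, ← sRep_edgeGraph,
    D.nrBracket_sRep hΓ (hd r) hΓf (hf r) P x X hX,
    Finset.sum_congr rfl fun ij _ =>
      D.nrBracket_sRep (hd ij.1) (hd ij.2) (hf ij.1) (hf ij.2) P x X hX]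
  simp only [Pi.add_apply, Pi.smul_apply, Finset.sum_apply, add_apply, smul_apply, sum_apply]

theorem sum_nrProd_sRep (hd : ∀ r, HasDegree 1 (m r)) (hf : ∀ r, HasFiniteEdges (m r)) (r P : ℕ)
    (x : Fin (P + 1) → ℤ) (X : Fin (P + 1) → D.Fun) (hX : ∀ v, X v ∈ D.tGrading (x v)) :
    ∑ ij ∈ antidiagonal r, nrProd 1 (D.sRep (m ij.1)) (D.sRep (m ij.2)) P x X =
      D.sRep (∑ ij ∈ antidiagonal r, preLieSeries (m ij.1) (m ij.2)) P X := by
  rw [D.sRep_sum _ _ fun ij _ => hasFiniteEdges_preLieSeries (hf ij.1) (hf ij.2),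
    Finset.sum_congr rfl fun ij _ => D.nrProd_sRep (hd ij.2) (hf ij.1) (hf ij.2) P x X hX]
  simp only [Finset.sum_apply, sum_apply]

theorem isFormalUniversalDeformation_sRep (hm : IsFormalMaurerCartan m)
    (hf : ∀ r, HasFiniteEdges (m r)) : D.IsFormalUniversalDeformation fun r => D.sRep (m r) where
  cochain r := D.isCE_sRep (hm.mem r) (hm.degree r) (hf r)
  maurerCartan r P x X hX := by
    rw [D.maurerCartan_sRep hm.degree hf r P x X hX, hm.eqn r, sRep_zero]
    rfl
  lieInfty := by
    rw [funext (D.deformed_sRep hf)]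
    refine ⟨fun r => D.isCE_sRep (twisted_mem hm.mem r) (hasDegree_twisted hm.degree r)
      (hasFiniteEdges_twisted hf r), fun r P x X hX => ?_⟩
    rw [D.sum_nrProd_sRep (hasDegree_twisted hm.degree) (hasFiniteEdges_twisted hf) r P x X hX,
      hm.sum_preLieSeries_twisted r, sRep_zero]
    rfl
  universal := by
    refine ⟨twisted m, fun r => ⟨twisted_mem hm.mem r, hasDegree_twisted hm.degree r,
      hasFiniteEdges_twisted hf r⟩, fun r => ?_, D.deformed_sRep hf⟩
    rw [sum_bracket_eq (hasDegree_twisted hm.degree), hm.sum_preLieSeries_twisted]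
    exact smul_zero (A := GraphSeries _) (2 : ℝ)

theorem IsFormalUniversalDeformation.isUniversalDeformation {D : NPDomain n}
    {c : ℕ → Cochains D.Fun} (h : D.IsFormalUniversalDeformation c) :
    D.IsUniversalDeformation (c 0) where
  cochain := h.cochain 0
  maurerCartan P x X hX := by simpa using h.maurerCartan 0 P x X hX
  lieInfty := ⟨h.lieInfty.cochain 0, fun P x X hX => by
    have jacobi := h.lieInfty.jacobi 0 P x X hX
    rwa [Finset.Nat.antidiagonal_zero, Finset.sum_singleton] at jacobi⟩
  universal := by
    obtain ⟨γ, hγ, square, deformed_eq⟩ := h.universal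
    exact ⟨γ 0, (hγ 0).1, (hγ 0).2.1, (hγ 0).2.2, by simpa using square 0, deformed_eq 0⟩

theorem isUniversalDeformation_sRep {m : GraphSeries ((n : ℤ) + 1)} (hm : IsMaurerCartan m)
    (hf : HasFiniteEdges m) : D.IsUniversalDeformation (D.sRep m) := by
  have finite : ∀ r, HasFiniteEdges (Pi.single (M := fun _ => GraphSeries _) 0 m r)
    | 0 => hf
    | _ + 1 => (finiteEdges _).zero_mem
  exact (D.isFormalUniversalDeformation_sRep hm.formal finite).isUniversalDeformation

end NPDomain

end NPGraph

end

theorem mainTheorem4_general (n : ℕ) (D : NPGraph.NPDomain n) :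
    (∀ m : NPGraph.GraphSeries ((n : ℤ) + 1), NPGraph.IsMaurerCartan m →
      NPGraph.HasFiniteEdges m → D.IsUniversalDeformation (D.sRep m)) ∧
    (∀ m : NPGraph.GraphSeries ((n : ℤ) + 1), NPGraph.IsMaurerCartan m →
      D.IsFormalUniversalDeformation fun r => D.sRep (NPGraph.edgePart (r + 1) m)) ∧
    (∀ m : ℕ → NPGraph.GraphSeries ((n : ℤ) + 1), NPGraph.IsFormalMaurerCartan m →
      (∀ r, NPGraph.HasFiniteEdges (m r)) →
      D.IsFormalUniversalDeformation fun r => D.sRep (m r)) :=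
  ⟨fun _ hm hf => D.isUniversalDeformation_sRep hm hf,
    fun m hm => D.isFormalUniversalDeformation_sRep hm.formal_edgePart fun r =>
      NPGraph.hasFiniteEdges_edgePart m (r + 1),
    fun _ hm hf => D.isFormalUniversalDeformation_sRep hm hf⟩

theorem mainTheorem4 (n : ℕ) (D : NPGraph.NPDomain n) :
    (1 ≤ n → ∀ m : NPGraph.GraphSeries ((n : ℤ) + 1), NPGraph.IsMaurerCartan m →
      D.IsUniversalDeformation (D.sRep m)) ∧
    (n = 0 → ∀ m : NPGraph.GraphSeries ((n : ℤ) + 1), NPGraph.IsMaurerCartan m →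
      D.IsFormalUniversalDeformation fun r => D.sRep (NPGraph.edgePart (r + 1) m)) ∧
    (∀ m : ℕ → NPGraph.GraphSeries ((n : ℤ) + 1), NPGraph.IsFormalMaurerCartan m →
      (∀ r, NPGraph.HasFiniteEdges (m r)) →
      D.IsFormalUniversalDeformation fun r => D.sRep (m r)) :=
  have ⟨finite, edges, formal⟩ := mainTheorem4_general n D
  ⟨fun hn m hm => finite m hm (NPGraph.hasFiniteEdges_of_hasDegree (by omega) hm.degree),
    fun _ => edges, formal⟩
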